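/- A wildcard string is a finite string whose characters are letters of an alphabet or the wildcard $\phi$. Two characters match if they are equal or at least one of them is $\phi$; two strings of equal length match if they match position by position; a string is a palindrome if it matches its reverse. For a wildcard string $S$ of length $n$, with positions $1,\dots,n$, an interval $[i..j]$ with $1\le i\le j+1$ and $j\le n$ is a subpalindrome if the factor $S[i..j]$ (empty if $j=i-1$) is a palindrome. It is maximal if $[i-1..j+1]$ is not an interval of positions of $S$ or not a subpalindrome. Its center is $\frac{i+j}{2}$ and its radius is $\lceil\frac{j-i}{2}\rceil$. Each of the $2n-1$ centers $1,\frac32,2,\dots,n$ is the center of exactly one maximal subpalindrome. Theorem. There is an algorithm that computes, for every $n$ and every wildcard string $S$ of length $n$, the radii of the maximal subpalindromes of $S$ at all $2n-1$ centers, in $O(n\sqrt{n\log n})$ time and $O(n)$ space. Here the model is the word RAM: an algorithm is a single program; for a suitable constant $k$, it runs correctly, and within these bounds, for every word size $w$ with $2^w\ge (n+2)^k$; each character of the input occupies one word; arithmetic, bitwise operations and comparisons on words, and memory accesses, take unit time; space is the number of memory words available to the program, input and output included. The implied constants depend neither on $S$, nor on the alphabet, nor on $w$. -/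

import Mathlib

/-! ## Wildcard strings and their maximal subpalindromes

A character of a wildcard string over an alphabet `A` is an `Option A`: `none` is the wildcard and
`some a` is the letter `a`. Positions are numbered from `1`. -/

namespace Wildcard

variable {A : Type*}

/-- Two characters match if they are equal or one of them is the wildcard. -/
def CharMatch (a b : Option A) : Prop :=
  a = none ∨ b = none ∨ a = b

/-- Two strings match if they have the same length and match character by character. -/
def Matches (S T : List (Option A)) : Prop :=
  List.Forall₂ CharMatch S T

/-- A wildcard string is a palindrome if it matches its reverse. -/
def IsPalindrome (S : List (Option A)) : Prop :=
  Matches S S.reverse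

/-- The factor `S[i] S[i+1] ⋯ S[j]` (for `1 ≤ i`), which is empty if `j < i`. -/
def factor (S : List (Option A)) (i j : ℕ) : List (Option A) :=
  (S.drop (i - 1)).take (j + 1 - i)

/-- The interval `[i .. j]` of positions of `S` is a subpalindrome of `S`. The empty interval
`[i .. i - 1]` is allowed: it has the half-integral center `i - 1 / 2`. -/
def IsSubpalindrome (S : List (Option A)) (i j : ℕ) : Prop :=
  1 ≤ i ∧ i ≤ j + 1 ∧ j ≤ S.length ∧ IsPalindrome (factor S i j)

/-- `[i .. j]` is a subpalindrome, and `[i - 1 .. j + 1]` is not an interval of positions of `S` or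
is not a subpalindrome. (If `i = 1`, then `i - 1 = 0` is not a position.) -/
def IsMaximalSubpalindrome (S : List (Option A)) (i j : ℕ) : Prop :=
  IsSubpalindrome S i j ∧ ¬ IsSubpalindrome S (i - 1) (j + 1)

/-- The radius `⌈(j - i) / 2⌉` of the interval `[i .. j]`. -/
def radius (i j : ℕ) : ℤ :=
  ⌈((j : ℚ) - (i : ℚ)) / 2⌉

/-- `r` is the radius of the maximal subpalindrome of `S` whose center `(i + j) / 2` is `d / 2`. The
`2 * |S| - 1` centers of a string `S` are the numbers `d / 2` with `2 ≤ d ≤ 2 * |S|`. -/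
def IsMaximalRadius (S : List (Option A)) (d r : ℕ) : Prop :=
  ∃ i j : ℕ, i + j = d ∧ IsMaximalSubpalindrome S i j ∧ (r : ℤ) = radius i j

end Wildcard

/-! ## The word RAM

A machine with words of `w` bits, finitely many registers (those that the program mentions) and a
memory whose cells hold one word each. Programs are structured, do not depend on `w`, and every
evaluated node of an expression and every executed instruction costs one unit of time. -/

namespace WordRAM

/-- The binary operations on words. -/
inductive Op where
  | add | sub | mul | div | mod
  | and | or | xor | shl | shr
  | eq | lt

/-- Words are unsigned; arithmetic is modulo `2 ^ w`; a comparison yields `1` (true) or `0`. -/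
def Op.eval {w : ℕ} : Op → BitVec w → BitVec w → BitVec w
  | .add, x, y => x + y
  | .sub, x, y => x - y
  | .mul, x, y => x * y
  | .div, x, y => x / y
  | .mod, x, y => x % y
  | .and, x, y => x &&& y
  | .or, x, y => x ||| y
  | .xor, x, y => x ^^^ y
  | .shl, x, y => x <<< y
  | .shr, x, y => x >>> y
  | .eq, x, y => if x = y then 1 else 0
  | .lt, x, y => if x < y then 1 else 0

/-- Expressions over constants and registers. -/
inductive Expr where
  | const (c : ℕ)
  | reg (x : ℕ)
  | op (o : Op) (a b : Expr)

/-- The value of an expression, for given contents `ρ` of the registers. -/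
def Expr.eval {w : ℕ} (ρ : ℕ → BitVec w) : Expr → BitVec w
  | .const c => BitVec.ofNat w c
  | .reg x => ρ x
  | .op o a b => o.eval (a.eval ρ) (b.eval ρ)

/-- The time for evaluating an expression: its number of nodes. -/
def Expr.cost : Expr → ℕ
  | .const _ => 1
  | .reg _ => 1
  | .op _ a b => a.cost + b.cost + 1

/-- Programs. -/
inductive Prog where
  /-- do nothing -/
  | skip
  /-- register `x` := value of `e` -/
  | assign (x : ℕ) (e : Expr)
  /-- register `x` := memory cell at address `a` -/
  | load (x : ℕ) (a : Expr)
  /-- memory cell at address `a` := value of `e` -/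
  | store (a e : Expr)
  /-- first `p`, then `q` -/
  | seq (p q : Prog)
  /-- if `e` is not zero then `p`, else `q` -/
  | ite (e : Expr) (p q : Prog)
  /-- while `e` is not zero, do `p` -/
  | loop (e : Expr) (p : Prog)

/-- The contents of the registers and of the memory. -/
structure State (w : ℕ) where
  reg : ℕ → BitVec w
  mem : ℕ → BitVec w

/-- `Exec L p s t s'`: on a machine whose memory consists of the `L` cells with addresses
`0, …, L - 1`, the program `p`, started in state `s`, halts in state `s'` after `t` units of time.
An access to an address that is not below `L` is a fault, from which no execution continues. -/
inductive Exec {w : ℕ} (L : ℕ) : Prog → State w → ℕ → State w → Prop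
  | skip (s : State w) : Exec L .skip s 1 s
  | assign (s : State w) (x : ℕ) (e : Expr) :
      Exec L (.assign x e) s (e.cost + 1)
        { s with reg := Function.update s.reg x (e.eval s.reg) }
  | load (s : State w) (x : ℕ) (a : Expr) (h : (a.eval s.reg).toNat < L) :
      Exec L (.load x a) s (a.cost + 1)
        { s with reg := Function.update s.reg x (s.mem (a.eval s.reg).toNat) }
  | store (s : State w) (a e : Expr) (h : (a.eval s.reg).toNat < L) :
      Exec L (.store a e) s (a.cost + e.cost + 1)
        { s with mem := Function.update s.mem (a.eval s.reg).toNat (e.eval s.reg) }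
  | seq (s s₁ s₂ : State w) (p q : Prog) (t₁ t₂ : ℕ) :
      Exec L p s t₁ s₁ → Exec L q s₁ t₂ s₂ → Exec L (.seq p q) s (t₁ + t₂) s₂
  | ite_true (s s₁ : State w) (e : Expr) (p q : Prog) (t : ℕ) (h : e.eval s.reg ≠ 0) :
      Exec L p s t s₁ → Exec L (.ite e p q) s (e.cost + 1 + t) s₁
  | ite_false (s s₁ : State w) (e : Expr) (p q : Prog) (t : ℕ) (h : e.eval s.reg = 0) :
      Exec L q s t s₁ → Exec L (.ite e p q) s (e.cost + 1 + t) s₁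
  | loop_done (s : State w) (e : Expr) (p : Prog) (h : e.eval s.reg = 0) :
      Exec L (.loop e p) s (e.cost + 1) s
  | loop_step (s s₁ s₂ : State w) (e : Expr) (p : Prog) (t₁ t₂ : ℕ) (h : e.eval s.reg ≠ 0) :
      Exec L p s t₁ s₁ → Exec L (.loop e p) s₁ t₂ s₂ →
        Exec L (.loop e p) s (e.cost + 1 + t₁ + t₂) s₂

/-- The code of a character, over the alphabet of natural numbers: `0` is the wildcard, `a + 1` is
the letter `a`. -/
def charCode : Option ℕ → ℕ
  | none => 0
  | some a => a + 1

/-- The initial state on the input string `S` of length `n`: register `0` holds `n`, the memory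
cells `0, …, n - 1` hold the characters of `S` in order, and everything else is zero. -/
def inputState (w : ℕ) (S : List (Option ℕ)) : State w where
  reg x := if x = 0 then BitVec.ofNat w S.length else 0
  mem m := BitVec.ofNat w ((S[m]?.map charCode).getD 0)

/-- The output convention: for each of the centers `d / 2` with `2 ≤ d ≤ 2 * |S|`, the memory cell
`d - 2` holds the radius of the maximal subpalindrome of `S` with that center. -/
def HoldsMaximalRadii {w : ℕ} (S : List (Option ℕ)) (s : State w) : Prop :=
  ∀ d : ℕ, 2 ≤ d → d ≤ 2 * S.length → Wildcard.IsMaximalRadius S d (s.mem (d - 2)).toNat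

/-- The program `p` computes the radii of all maximal subpalindromes of every wildcard string of
length `n` within `time n` units of time and `space n` memory cells (the input and the output
included), on every machine whose words have at least `k * log₂ (n + 2)` bits. The letters may be
arbitrary, as long as the code of each character fits into a word. -/
def ComputesMaximalRadii (p : Prog) (k : ℕ) (time space : ℕ → ℕ) : Prop :=
  ∀ (w n : ℕ) (S : List (Option ℕ)), S.length = n → (n + 2) ^ k ≤ 2 ^ w →
    (∀ c ∈ S, charCode c < 2 ^ w) →
      n ≤ space n ∧ 2 * n - 1 ≤ space n ∧
      ∃ (t : ℕ) (s : State w),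
        Exec (space n) p (inputState w S) t s ∧ t ≤ time n ∧ HoldsMaximalRadii S s

end WordRAM

/-! Number the characters from 0 and describe a center by the sum `D` of two reflected positions, so
that `x` is reflected to `D - x`. Replace the letters by ranks between 1 and `n` and the wildcard by
0. Two ranks `x`, `y` match if and only if `x * y * (x - y) ^ 2 = x ^ 3 * y - 2 * x ^ 2 * y ^ 2 + x
* y ^ 3` vanishes. This number is never negative, so all pairs of a set match if and only if the sum
of these numbers is zero, and along a reflection this sum is a combination of three convolutions.

Cut the string into `K` blocks of length `b`, about `√(n / log n)`, and write `D = c * b + r` with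
`r < b`. The reflection of block `k` lies in a window of length `2 * b` that depends on `c - k` but
not on `r`; the remainder `r` only selects a coefficient of the product of two polynomials, one for
the block and one for the window. All polynomials are evaluated naively at the `p` elements `j ^ p ^
19` of `ℤ / p ^ 20`, where `p` is a prime with `2 * b < p ≤ 4 * b`. These elements are 0 and the
lifts of the nonzero residues modulo `p` to roots of unity of order dividing `p - 1`. Their power
sums vanish unless `p - 1` divides the exponent, so a weighted sum over the `p` points recovers any
wanted coefficient up to the unit `p - 1` (`ZMod.sum_pow_mul_transform`). The small prime is found
by trial division, while its power exceeds every sum of mismatches that occurs, so nothing is lost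
modulo `p ^ 20` (`prefix_mod_eq_zero_iff`).

The evaluations take `O(K * b * p) = O(n * b)` time. For each of the `2 * K` values of `c`, prefix
sums over the blocks are formed pointwise, in `O(K ^ 2 * p) = O(n * K)` time altogether. They serve
all `b` remainders `r`: each center does a binary search for the first block with a mismatch, with
`O(p)` time per step, and two scans of at most `b` characters (`isRadius_of_scans`), in `O(n * b *
log n)` time altogether. Both `K` and `b * log n` are `O(√(n log n))`. The tables have `O(K * p + p
^ 2) = O(n)` entries, and the prefix sums for one `c` overwrite those for the previous one.

The program is written in a small language with arrays and bounded loops. Weakest preconditions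
describe its effect, and `Machine.exec_of_wp` turns them into runs on the word RAM whose time is
bounded by an expression that depends on the syntax and on bounds for the loop lengths only. -/

namespace WordRAM

/-! ### Arithmetic of expressions over the natural numbers -/

/-- The value of an operation on natural numbers, in the absence of overflow. -/
def Op.evalNat : Op → ℕ → ℕ → ℕ
  | .add, x, y => x + y
  | .sub, x, y => x - y
  | .mul, x, y => x * y
  | .div, x, y => x / y
  | .mod, x, y => x % y
  | .eq, x, y => if x = y then 1 else 0
  | .lt, x, y => if x < y then 1 else 0
  | _, _, _ => 0

/-- The operation does not overflow words below `W`; the bitwise operations are excluded. -/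
def Op.Fits (W : ℕ) : Op → ℕ → ℕ → Prop
  | .add, x, y => x + y < W
  | .sub, x, y => y ≤ x
  | .mul, x, y => x * y < W
  | .div, _, _ => True
  | .mod, _, _ => True
  | .eq, _, _ => True
  | .lt, _, _ => True
  | _, _, _ => False

/-- The value of an expression over the natural numbers. -/
def Expr.evalNat (v : ℕ → ℕ) : Expr → ℕ
  | .const c => c
  | .reg x => v x
  | .op o a b => o.evalNat (a.evalNat v) (b.evalNat v)

/-- No subexpression overflows words below `W`. -/
def Expr.Fits (W : ℕ) (v : ℕ → ℕ) : Expr → Prop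
  | .const c => c < W
  | .reg _ => True
  | .op o a b => a.Fits W v ∧ b.Fits W v ∧ o.Fits W (a.evalNat v) (b.evalNat v)

theorem Op.toNat_eval {w : ℕ} (hw : 1 < 2 ^ w) (o : Op) (x y : BitVec w)
    (h : o.Fits (2 ^ w) x.toNat y.toNat) : (o.eval x y).toNat = o.evalNat x.toNat y.toNat := by
  have h1 : (1 : BitVec w).toNat = 1 := by
    simp only [BitVec.ofNat_eq_ofNat, BitVec.toNat_ofNat]; exact Nat.mod_eq_of_lt hw
  cases o <;> simp only [Op.Fits] at h <;> simp only [Op.eval, Op.evalNat]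
  case add => rw [BitVec.toNat_add, Nat.mod_eq_of_lt h]
  case sub => rw [BitVec.toNat_sub_of_le (by simpa [BitVec.le_def] using h)]
  case mul => rw [BitVec.toNat_mul, Nat.mod_eq_of_lt h]
  case div => rw [BitVec.toNat_udiv]
  case mod => rw [BitVec.toNat_umod]
  case eq =>
    by_cases hxy : x = y
    · simp only [hxy, if_true]; exact h1
    · rw [if_neg hxy, if_neg (fun hh => hxy (BitVec.eq_of_toNat_eq hh))]; simp
  case lt =>
    by_cases hxy : x < y
    · rw [if_pos hxy, if_pos (BitVec.lt_def.1 hxy)]; exact h1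
    · rw [if_neg hxy, if_neg (fun hh => hxy (BitVec.lt_def.2 hh))]; simp

theorem Expr.toNat_eval {w : ℕ} (hw : 1 < 2 ^ w) (ρ : ℕ → BitVec w) (v : ℕ → ℕ)
    (hv : ∀ x, (ρ x).toNat = v x) (e : Expr) (h : e.Fits (2 ^ w) v) :
    (e.eval ρ).toNat = e.evalNat v := by
  induction e with
  | const c => simpa [Expr.eval, Expr.evalNat] using Nat.mod_eq_of_lt h
  | reg x => exact hv x
  | op o a b iha ihb =>
    obtain ⟨ha, hb, ho⟩ := h
    rw [Expr.eval, Expr.evalNat, ← iha ha, ← ihb hb]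
    rw [← iha ha, ← ihb hb] at ho
    exact o.toNat_eval hw _ _ ho

instance : Add Expr := ⟨.op .add⟩
instance : Sub Expr := ⟨.op .sub⟩
instance : Mul Expr := ⟨.op .mul⟩
instance : Div Expr := ⟨.op .div⟩
instance : Mod Expr := ⟨.op .mod⟩

section
variable (W : ℕ) (v : ℕ → ℕ) (a b : Expr) (n : ℕ)

@[simp] theorem Expr.evalNat_reg (x : ℕ) : (Expr.reg x).evalNat v = v x := rfl
@[simp] theorem Expr.evalNat_const : (Expr.const n).evalNat v = n := rfl
@[simp] theorem Expr.evalNat_add : (a + b).evalNat v = a.evalNat v + b.evalNat v := rfl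
@[simp] theorem Expr.evalNat_sub : (a - b).evalNat v = a.evalNat v - b.evalNat v := rfl
@[simp] theorem Expr.evalNat_mul : (a * b).evalNat v = a.evalNat v * b.evalNat v := rfl
@[simp] theorem Expr.evalNat_div : (a / b).evalNat v = a.evalNat v / b.evalNat v := rfl
@[simp] theorem Expr.evalNat_mod : (a % b).evalNat v = a.evalNat v % b.evalNat v := rfl
@[simp] theorem Expr.evalNat_lt :
    (Expr.op .lt a b).evalNat v = if a.evalNat v < b.evalNat v then 1 else 0 := rfl
@[simp] theorem Expr.evalNat_eq :
    (Expr.op .eq a b).evalNat v = if a.evalNat v = b.evalNat v then 1 else 0 := rfl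
@[simp] theorem Expr.fits_reg (x : ℕ) : (Expr.reg x).Fits W v ↔ True := Iff.rfl
@[simp] theorem Expr.fits_const : (Expr.const n).Fits W v ↔ n < W := Iff.rfl
@[simp] theorem Expr.fits_add : (a + b).Fits W v ↔
    a.Fits W v ∧ b.Fits W v ∧ a.evalNat v + b.evalNat v < W := Iff.rfl
@[simp] theorem Expr.fits_sub : (a - b).Fits W v ↔
    a.Fits W v ∧ b.Fits W v ∧ b.evalNat v ≤ a.evalNat v := Iff.rfl
@[simp] theorem Expr.fits_mul : (a * b).Fits W v ↔
    a.Fits W v ∧ b.Fits W v ∧ a.evalNat v * b.evalNat v < W := Iff.rfl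
@[simp] theorem Expr.fits_div : (a / b).Fits W v ↔ a.Fits W v ∧ b.Fits W v ∧ True := Iff.rfl
@[simp] theorem Expr.fits_mod : (a % b).Fits W v ↔ a.Fits W v ∧ b.Fits W v ∧ True := Iff.rfl
@[simp] theorem Expr.fits_lt :
    (Expr.op .lt a b).Fits W v ↔ a.Fits W v ∧ b.Fits W v ∧ True := Iff.rfl
@[simp] theorem Expr.fits_eq :
    (Expr.op .eq a b).Fits W v ↔ a.Fits W v ∧ b.Fits W v ∧ True := Iff.rfl
end

/-! ### A language with arrays and bounded loops -/

/-- Commands over registers and arrays. The arrays `0, …, 15` are interleaved in the memory from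
cell `2 * n` on, and the array `16` consists of the cells `0, …, 2 * n - 1`, where `n` is the content
of register `0`. -/
inductive Cmd where
  | skip
  | assign (x : ℕ) (e : Expr)
  | load (x a : ℕ) (i : Expr)
  | store (a : ℕ) (i e : Expr)
  | seq (p q : Cmd)
  | ite (e : Expr) (p q : Cmd)
  /-- for register `i` from `0` to the content of register `N`, exclusively -/
  | forRange (i N : ℕ) (p : Cmd)

/-- Execute a list of commands in order. -/
def Cmd.block : List Cmd → Cmd
  | [] => .skip
  | p :: l => .seq p (block l)

/-- The expression for the address of entry `i` of array `a`. -/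
def addrExpr (a : ℕ) (i : Expr) : Expr :=
  if a = 16 then i else
    .op .add (.op .add (.op .mul (.const 2) (.reg 0)) (.op .mul (.const 16) i)) (.const a)

/-- The address of entry `i` of array `a`. -/
def addr (n a i : ℕ) : ℕ :=
  if a = 16 then i else 2 * n + 16 * i + a

/-- The translation of commands into programs. -/
def Cmd.toProg : Cmd → Prog
  | .skip => .skip
  | .assign x e => .assign x e
  | .load x a i => .load x (addrExpr a i)
  | .store a i e => .store (addrExpr a i) e
  | .seq p q => .seq p.toProg q.toProg
  | .ite e p q => .ite e p.toProg q.toProg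
  | .forRange i N p => .seq (.assign i (.const 0))
      (.loop (.op .lt (.reg i) (.reg N)) (.seq p.toProg (.assign i (.op .add (.reg i) (.const 1)))))

/-- The registers that a command may change. -/
def Cmd.regs : Cmd → List ℕ
  | .skip => []
  | .assign x _ => [x]
  | .load x _ _ => [x]
  | .store _ _ _ => []
  | .seq p q => p.regs ++ q.regs
  | .ite _ p q => p.regs ++ q.regs
  | .forRange i _ p => i :: p.regs

/-- The arrays that a command may change. -/
def Cmd.arrs : Cmd → List ℕ
  | .skip => []
  | .assign _ _ => []
  | .load _ _ _ => []
  | .store a _ _ => [a]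
  | .seq p q => p.arrs ++ q.arrs
  | .ite _ p q => p.arrs ++ q.arrs
  | .forRange _ _ p => p.arrs

/-- Register `0` is never changed, and loops do not change their counters and bounds. -/
def Cmd.Wf : Cmd → Prop
  | .skip => True
  | .assign x _ => x ≠ 0
  | .load x _ _ => x ≠ 0
  | .store _ _ _ => True
  | .seq p q => p.Wf ∧ q.Wf
  | .ite _ p q => p.Wf ∧ q.Wf
  | .forRange i N p => i ≠ 0 ∧ i ≠ N ∧ i ∉ p.regs ∧ N ∉ p.regs ∧ p.Wf

instance Cmd.decidableWf : (p : Cmd) → Decidable p.Wf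
  | .skip => inferInstanceAs (Decidable True)
  | .assign x _ => inferInstanceAs (Decidable (x ≠ 0))
  | .load x _ _ => inferInstanceAs (Decidable (x ≠ 0))
  | .store _ _ _ => inferInstanceAs (Decidable True)
  | .seq p q => @instDecidableAnd _ _ p.decidableWf q.decidableWf
  | .ite _ p q => @instDecidableAnd _ _ p.decidableWf q.decidableWf
  | .forRange i N p =>
    have := p.decidableWf
    inferInstanceAs (Decidable (i ≠ 0 ∧ i ≠ N ∧ i ∉ p.regs ∧ N ∉ p.regs ∧ p.Wf))

/-- A bound for the running time if the content of each loop bound `N` is at most `ν N`. -/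
def Cmd.time (ν : ℕ → ℕ) : Cmd → ℕ
  | .skip => 1
  | .assign _ e => e.cost + 1
  | .load _ _ i => i.cost + 9
  | .store _ i e => i.cost + e.cost + 9
  | .seq p q => p.time ν + q.time ν
  | .ite e p q => e.cost + 1 + (p.time ν + q.time ν)
  | .forRange _ N p => ν N * (p.time ν + 8) + 6

/-- The contents of registers and arrays as natural numbers. -/
structure Store where
  v : ℕ → ℕ
  a : ℕ → ℕ → ℕ

/-- Change the content of register `x` to `k`. -/
def Store.set (σ : Store) (x k : ℕ) : Store :=
  { σ with v := fun y => if y = x then k else σ.v y }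

/-- Change entry `i` of array `a` to `k`. -/
def Store.put (σ : Store) (a i k : ℕ) : Store :=
  { σ with a := fun c j => if c = a ∧ j = i then k else σ.a c j }

@[simp] theorem Store.set_v (σ : Store) (x k y : ℕ) :
    (σ.set x k).v y = if y = x then k else σ.v y := rfl
@[simp] theorem Store.set_a (σ : Store) (x k : ℕ) : (σ.set x k).a = σ.a := rfl
@[simp] theorem Store.put_v (σ : Store) (a i k : ℕ) : (σ.put a i k).v = σ.v := rfl
@[simp] theorem Store.put_a (σ : Store) (a i k c j : ℕ) :
    (σ.put a i k).a c j = if c = a ∧ j = i then k else σ.a c j := rfl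

/-- `p` can only lead from `σ` to stores `τ` with these contents of registers and arrays. -/
structure Cmd.Frame (p : Cmd) (σ τ : Store) : Prop where
  v : ∀ x, x ∉ p.regs → τ.v x = σ.v x
  a : ∀ c, c ∉ p.arrs → τ.a c = σ.a c

/-- A machine: the input length, the word size, the length of the arrays `0, …, 15`, and upper bounds
for the contents of the registers that bound loops. -/
structure Machine where
  n : ℕ
  w : ℕ
  B : ℕ
  ν : ℕ → ℕ
  one_lt : 1 < 2 ^ w
  le_word : 2 * n + 16 * B + 16 < 2 ^ w

/-- The number of memory cells. -/
def Machine.cells (E : Machine) : ℕ := 2 * E.n + 16 * E.B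

/-- The number of values of a word. -/
def Machine.W (E : Machine) : ℕ := 2 ^ E.w

/-- `i` is an index of array `a`. -/
def Machine.Valid (E : Machine) (a i : ℕ) : Prop :=
  (a < 16 ∧ i < E.B) ∨ (a = 16 ∧ i < 2 * E.n)

/-- The store `σ` describes the state `s`. -/
structure Machine.Rel (E : Machine) (s : State E.w) (σ : Store) : Prop where
  v : ∀ x, (s.reg x).toNat = σ.v x
  a : ∀ c i, E.Valid c i → (s.mem (addr E.n c i)).toNat = σ.a c i
  n : σ.v 0 = E.n

/-- Iterate a predicate transformer `m` times, increasing register `i` after each round. -/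
def iterWp (f : (Store → Prop) → Store → Prop) (i : ℕ) : ℕ → (Store → Prop) → Store → Prop
  | 0, Q => Q
  | m + 1, Q => f (fun τ => iterWp f i m Q (τ.set i (τ.v i + 1)))

/-- Started in `σ`, the command halts without faults and overflows in a store with property `Q`. -/
def Machine.wp (E : Machine) : Cmd → (Store → Prop) → Store → Prop
  | .skip, Q => Q
  | .assign x e, Q => fun σ => e.Fits E.W σ.v ∧ Q (σ.set x (e.evalNat σ.v))
  | .load x a i, Q => fun σ => i.Fits E.W σ.v ∧ E.Valid a (i.evalNat σ.v) ∧
      Q (σ.set x (σ.a a (i.evalNat σ.v)))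
  | .store a i e, Q => fun σ => i.Fits E.W σ.v ∧ e.Fits E.W σ.v ∧
      E.Valid a (i.evalNat σ.v) ∧ Q (σ.put a (i.evalNat σ.v) (e.evalNat σ.v))
  | .seq p q, Q => E.wp p (E.wp q Q)
  | .ite e p q, Q => fun σ => e.Fits E.W σ.v ∧ (e.evalNat σ.v ≠ 0 → E.wp p Q σ) ∧
      (e.evalNat σ.v = 0 → E.wp q Q σ)
  | .forRange i N p, Q => fun σ => σ.v N ≤ E.ν N ∧ iterWp (E.wp p) i (σ.v N) Q (σ.set i 0)

variable {E : Machine}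

/-! ### Proof rules for weakest preconditions -/

theorem iterWp_mono {f : (Store → Prop) → Store → Prop}
    (hf : ∀ P Q : Store → Prop, (∀ τ, P τ → Q τ) → ∀ σ, f P σ → f Q σ) {i : ℕ} (m : ℕ)
    {P Q : Store → Prop} (h : ∀ τ, P τ → Q τ) (σ : Store) (hσ : iterWp f i m P σ) :
    iterWp f i m Q σ := by
  induction m generalizing σ with
  | zero => exact h _ hσ
  | succ m ih => exact hf _ _ (fun τ hτ => ih _ hτ) _ hσ

theorem Machine.wp_mono (p : Cmd) {P Q : Store → Prop} (h : ∀ τ, P τ → Q τ) (σ : Store)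
    (hσ : E.wp p P σ) : E.wp p Q σ := by
  induction p generalizing P Q σ with
  | skip => exact h _ hσ
  | assign x e => exact ⟨hσ.1, h _ hσ.2⟩
  | load x a i => exact ⟨hσ.1, hσ.2.1, h _ hσ.2.2⟩
  | store a i e => exact ⟨hσ.1, hσ.2.1, hσ.2.2.1, h _ hσ.2.2.2⟩
  | seq p q ihp ihq => exact ihp (fun τ hτ => ihq h τ hτ) σ hσ
  | ite e p q ihp ihq =>
    exact ⟨hσ.1, fun he => ihp h σ (hσ.2.1 he), fun he => ihq h σ (hσ.2.2 he)⟩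
  | forRange i N p ih => exact ⟨hσ.1, iterWp_mono (fun _ _ hPQ => ih hPQ) _ h _ hσ.2⟩

/-- This lets a specification mention only what its command computes: that everything else is
unchanged follows from the syntactic lists `Cmd.regs` and `Cmd.arrs`. -/
theorem Machine.wp_frame (p : Cmd) {Q : Store → Prop} (σ : Store) (hσ : E.wp p Q σ) :
    E.wp p (fun τ => p.Frame σ τ ∧ Q τ) σ := by
  induction p generalizing Q σ with
  | skip => exact ⟨⟨fun _ _ => rfl, fun _ _ => rfl⟩, hσ⟩
  | assign x e =>
    refine ⟨hσ.1, ⟨fun y hy => ?_, fun _ _ => rfl⟩, hσ.2⟩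
    simp only [Cmd.regs, List.mem_singleton] at hy
    simp [hy]
  | load x a i =>
    refine ⟨hσ.1, hσ.2.1, ⟨fun y hy => ?_, fun _ _ => rfl⟩, hσ.2.2⟩
    simp only [Cmd.regs, List.mem_singleton] at hy
    simp [hy]
  | store a i e =>
    refine ⟨hσ.1, hσ.2.1, hσ.2.2.1, ⟨fun _ _ => rfl, fun c hc => ?_⟩, hσ.2.2.2⟩
    simp only [Cmd.arrs, List.mem_singleton] at hc
    ext j
    simp [hc]
  | seq p q ihp ihq =>
    refine wp_mono p (fun τ hτ => ?_) σ (ihp σ hσ)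
    refine wp_mono q (fun τ' hτ' => ⟨⟨fun x hx => ?_, fun c hc => ?_⟩, hτ'.2⟩) τ (ihq τ hτ.2)
    · simp only [Cmd.regs, List.mem_append, not_or] at hx
      rw [hτ'.1.v x hx.2, hτ.1.v x hx.1]
    · simp only [Cmd.arrs, List.mem_append, not_or] at hc
      rw [hτ'.1.a c hc.2, hτ.1.a c hc.1]
  | ite e p q ihp ihq =>
    refine ⟨hσ.1, fun he => ?_, fun he => ?_⟩
    · refine wp_mono p (fun τ hτ => ⟨⟨fun x hx => ?_, fun c hc => ?_⟩, hτ.2⟩) σ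
        (ihp σ (hσ.2.1 he))
      · simp only [Cmd.regs, List.mem_append, not_or] at hx
        exact hτ.1.v x hx.1
      · simp only [Cmd.arrs, List.mem_append, not_or] at hc
        exact hτ.1.a c hc.1
    · refine wp_mono q (fun τ hτ => ⟨⟨fun x hx => ?_, fun c hc => ?_⟩, hτ.2⟩) σ
        (ihq σ (hσ.2.2 he))
      · simp only [Cmd.regs, List.mem_append, not_or] at hx
        exact hτ.1.v x hx.2
      · simp only [Cmd.arrs, List.mem_append, not_or] at hc
        exact hτ.1.a c hc.2
  | forRange i N p ih =>
    refine ⟨hσ.1, ?_⟩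
    -- The frame is kept relative to the store before the loop, while the induction runs over the
    -- remaining rounds from a varying store.
    have key : ∀ (m : ℕ) (τ : Store), (Cmd.forRange i N p).Frame σ τ → iterWp (E.wp p) i m Q τ →
        iterWp (E.wp p) i m (fun τ => (Cmd.forRange i N p).Frame σ τ ∧ Q τ) τ := by
      intro m
      induction m with
      | zero => exact fun τ h1 h2 => ⟨h1, h2⟩
      | succ m ihm =>
        intro τ h1 h2
        refine wp_mono p (fun τ' hτ' => ihm _ ⟨fun x hx => ?_, fun c hc => ?_⟩ hτ'.2) τ (ih τ h2)
        · have hx' := hx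
          simp only [Cmd.regs, List.mem_cons, not_or] at hx'
          rw [Store.set_v, if_neg hx'.1, hτ'.1.v x hx'.2, h1.v x hx]
        · rw [Store.set_a, hτ'.1.a c hc, h1.a c hc]
    refine key _ _ ⟨fun x hx => ?_, fun _ _ => rfl⟩ hσ.2
    simp only [Cmd.regs, List.mem_cons, not_or] at hx
    simp [hx.1]

/-- The rule of consequence, with the frame of the command. -/
theorem Machine.wp_conseq {p : Cmd} {P Q : Store → Prop} {σ : Store} (hσ : E.wp p P σ)
    (h : ∀ τ, p.Frame σ τ → P τ → Q τ) : E.wp p Q σ :=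
  wp_mono p (fun τ hτ => h τ hτ.1 hτ.2) σ (wp_frame p σ hσ)

/-- The rule for loops with an invariant. -/
theorem Machine.wp_for {i N : ℕ} {p : Cmd} {Q : Store → Prop} {σ : Store} (I : ℕ → Store → Prop)
    (hp : (Cmd.forRange i N p).Wf) (hN : σ.v N ≤ E.ν N) (h0 : I 0 (σ.set i 0))
    (hs : ∀ j τ, j < σ.v N → τ.v i = j → (Cmd.forRange i N p).Frame σ τ → I j τ →
      E.wp p (fun τ' => I (j + 1) (τ'.set i (j + 1))) τ)
    (hQ : ∀ τ, τ.v i = σ.v N → (Cmd.forRange i N p).Frame σ τ → I (σ.v N) τ → Q τ) :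
    E.wp (.forRange i N p) Q σ := by
  refine ⟨hN, ?_⟩
  have key : ∀ (m : ℕ) (τ : Store) (j : ℕ), j + m = σ.v N → τ.v i = j →
      (Cmd.forRange i N p).Frame σ τ → I j τ → iterWp (E.wp p) i m Q τ := by
    intro m
    induction m with
    | zero => rintro τ j rfl h2 h3 h4; exact hQ τ h2 h3 h4
    | succ m ihm =>
      intro τ j h1 h2 h3 h4
      refine wp_conseq (hs j τ (by omega) h2 h3 h4) (fun τ' hf hI => ?_)
      have hi : τ'.v i = j := by rw [hf.v i hp.2.2.1, h2]
      rw [hi]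
      refine ihm _ (j + 1) (by omega) (by simp) ⟨fun x hx => ?_, fun c hc => ?_⟩ hI
      · have hx' := hx
        simp only [Cmd.regs, List.mem_cons, not_or] at hx'
        rw [Store.set_v, if_neg hx'.1, hf.v x hx'.2, h3.v x hx]
      · rw [Store.set_a, hf.a c hc, h3.a c hc]
  refine key _ _ 0 (by omega) (by simp) ⟨fun x hx => ?_, fun _ _ => rfl⟩ h0
  simp only [Cmd.regs, List.mem_cons, not_or] at hx
  simp [hx.1]

@[simp] theorem Machine.wp_block_nil (Q : Store → Prop) (σ : Store) :
    E.wp (.block []) Q σ ↔ Q σ := Iff.rfl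
@[simp] theorem Machine.wp_block_cons (p : Cmd) (l : List Cmd) (Q : Store → Prop) (σ : Store) :
    E.wp (.block (p :: l)) Q σ ↔ E.wp p (E.wp (.block l) Q) σ := Iff.rfl
@[simp] theorem Machine.wp_skip (Q : Store → Prop) (σ : Store) : E.wp .skip Q σ ↔ Q σ := Iff.rfl
@[simp] theorem Machine.wp_assign (x : ℕ) (e : Expr) (Q : Store → Prop) (σ : Store) :
    E.wp (.assign x e) Q σ ↔ e.Fits E.W σ.v ∧ Q (σ.set x (e.evalNat σ.v)) := Iff.rfl
@[simp] theorem Machine.wp_load (x a : ℕ) (i : Expr) (Q : Store → Prop) (σ : Store) :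
    E.wp (.load x a i) Q σ ↔ i.Fits E.W σ.v ∧ E.Valid a (i.evalNat σ.v) ∧
      Q (σ.set x (σ.a a (i.evalNat σ.v))) := Iff.rfl
@[simp] theorem Machine.wp_store (a : ℕ) (i e : Expr) (Q : Store → Prop) (σ : Store) :
    E.wp (.store a i e) Q σ ↔ i.Fits E.W σ.v ∧ e.Fits E.W σ.v ∧
      E.Valid a (i.evalNat σ.v) ∧ Q (σ.put a (i.evalNat σ.v) (e.evalNat σ.v)) := Iff.rfl
@[simp] theorem Machine.wp_ite (e : Expr) (p q : Cmd) (Q : Store → Prop) (σ : Store) :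
    E.wp (.ite e p q) Q σ ↔ e.Fits E.W σ.v ∧ (e.evalNat σ.v ≠ 0 → E.wp p Q σ) ∧
      (e.evalNat σ.v = 0 → E.wp q Q σ) := Iff.rfl

-- With this form the branches receive an inequality of natural numbers, ready for `omega`, instead
-- of a test whether a value 0 or 1 is zero.
@[simp high] theorem Machine.wp_ite_lt (a b : Expr) (p q : Cmd) (Q : Store → Prop) (σ : Store) :
    E.wp (.ite (.op .lt a b) p q) Q σ ↔ a.Fits E.W σ.v ∧ b.Fits E.W σ.v ∧
      (a.evalNat σ.v < b.evalNat σ.v → E.wp p Q σ) ∧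
      (b.evalNat σ.v ≤ a.evalNat σ.v → E.wp q Q σ) := by
  rw [wp_ite, Expr.fits_lt, Expr.evalNat_lt]
  by_cases h : a.evalNat σ.v < b.evalNat σ.v
  · simp [h, not_le.2 h, and_assoc]
  · simp [h, not_lt.1 h, and_assoc]

@[simp high] theorem Machine.wp_ite_eq (a b : Expr) (p q : Cmd) (Q : Store → Prop) (σ : Store) :
    E.wp (.ite (.op .eq a b) p q) Q σ ↔ a.Fits E.W σ.v ∧ b.Fits E.W σ.v ∧
      (a.evalNat σ.v = b.evalNat σ.v → E.wp p Q σ) ∧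
      (a.evalNat σ.v ≠ b.evalNat σ.v → E.wp q Q σ) := by
  rw [wp_ite, Expr.fits_eq, Expr.evalNat_eq]
  by_cases h : a.evalNat σ.v = b.evalNat σ.v
  · simp [h, and_assoc]
  · simp [h, and_assoc]

/-! ### Soundness -/

theorem addr_lt {a i : ℕ} (h : E.Valid a i) : addr E.n a i < E.cells := by
  unfold addr Machine.cells
  rcases h with ⟨ha, hi⟩ | ⟨ha, hi⟩
  · rw [if_neg (by omega)]; omega
  · rw [if_pos ha]; omega

/-- The arrays 0 to 15 are the residue classes modulo 16 of the offsets from cell `2 * n`, so they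
are disjoint from each other and from array 16, and addresses do not depend on the array length. -/
theorem addr_injective {a i c j : ℕ} (h : E.Valid a i) (h' : E.Valid c j)
    (e : addr E.n c j = addr E.n a i) : c = a ∧ j = i := by
  unfold addr at e
  rcases h with ⟨ha, hi⟩ | ⟨ha, hi⟩ <;> rcases h' with ⟨hc, hj⟩ | ⟨hc, hj⟩ <;>
    split_ifs at e <;> omega

theorem Machine.Rel.addrExpr {s : State E.w} {σ : Store} (h : E.Rel s σ) {a : ℕ} {i : Expr}
    (hi : i.Fits (2 ^ E.w) σ.v) (hv : E.Valid a (i.evalNat σ.v)) :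
    ((addrExpr a i).eval s.reg).toNat = addr E.n a (i.evalNat σ.v) := by
  have hw := E.le_word
  unfold WordRAM.addrExpr addr
  split_ifs with ha
  · exact Expr.toNat_eval E.one_lt _ _ h.v _ hi
  · have hv' : a < 16 ∧ i.evalNat σ.v < E.B := by
      rcases hv with hv | hv
      · exact hv
      · exact absurd hv.1 ha
    rw [Expr.toNat_eval E.one_lt _ _ h.v]
    · simp only [Expr.evalNat, Op.evalNat, h.n]
    · simp only [Expr.Fits, Op.Fits, Expr.evalNat, Op.evalNat, h.n]
      refine ⟨⟨⟨?_, trivial, ?_⟩, ⟨?_, hi, ?_⟩, ?_⟩, ?_, ?_⟩ <;> omega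

theorem addrExpr_cost (a : ℕ) (i : Expr) : (addrExpr a i).cost ≤ i.cost + 8 := by
  unfold addrExpr
  split_ifs
  · omega
  · simp only [Expr.cost]; omega

theorem Machine.Rel.set {s : State E.w} {σ : Store} (h : E.Rel s σ) {x : ℕ} (hx : x ≠ 0)
    {y : BitVec E.w} {k : ℕ} (hy : y.toNat = k) :
    E.Rel { s with reg := Function.update s.reg x y } (σ.set x k) := by
  refine ⟨fun z => ?_, h.a, ?_⟩
  · by_cases hz : z = x
    · subst hz; simp [hy]
    · simp [hz, h.v z]
  · simpa [Store.set, hx.symm] using h.n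

/-- A command with a weakest precondition runs as described, in time at most `p.time ν`. -/
theorem Machine.exec_of_wp (p : Cmd) (hp : p.Wf) {Q : Store → Prop} {s : State E.w} {σ : Store}
    (hs : E.Rel s σ) (hσ : E.wp p Q σ) :
    ∃ t s' σ', Exec E.cells p.toProg s t s' ∧ t ≤ p.time E.ν ∧ E.Rel s' σ' ∧ Q σ' := by
  induction p generalizing Q s σ with
  | skip => exact ⟨_, _, _, .skip s, le_rfl, hs, hσ⟩
  | assign x e =>
    exact ⟨_, _, _, .assign s x e, le_rfl, hs.set hp (Expr.toNat_eval E.one_lt _ _ hs.v _ hσ.1), hσ.2⟩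
  | load x a i =>
    obtain ⟨h1, h2, h3⟩ := hσ
    have ha := hs.addrExpr h1 h2
    refine ⟨_, _, _, .load s x (addrExpr a i) (by rw [ha]; exact addr_lt h2), ?_, hs.set hp ?_, h3⟩
    · have := addrExpr_cost a i
      simp only [Cmd.time]; omega
    · rw [ha]; exact hs.a _ _ h2
  | store a i e =>
    obtain ⟨h1, h2, h3, h4⟩ := hσ
    have ha := hs.addrExpr h1 h3
    refine ⟨_, _, σ.put a (i.evalNat σ.v) (e.evalNat σ.v),
      .store s (addrExpr a i) e (by rw [ha]; exact addr_lt h3), ?_, ⟨hs.v, fun c j hcj => ?_, hs.n⟩, h4⟩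
    · have := addrExpr_cost a i
      simp only [Cmd.time]; omega
    · simp only [ha, Store.put_a]
      by_cases hc : c = a ∧ j = i.evalNat σ.v
      · rw [if_pos hc, hc.1, hc.2, Function.update_self]
        exact Expr.toNat_eval E.one_lt _ _ hs.v _ h2
      · rw [if_neg hc, Function.update_of_ne (fun he => hc (addr_injective h3 hcj he))]
        exact hs.a c j hcj
  | seq p q ihp ihq =>
    obtain ⟨t, s', σ', h1, h2, h3, h4⟩ := ihp hp.1 hs hσ
    obtain ⟨t', s'', σ'', h1', h2', h3', h4'⟩ := ihq hp.2 h3 h4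
    exact ⟨_, _, _, .seq _ _ _ _ _ _ _ h1 h1', Nat.add_le_add h2 h2', h3', h4'⟩
  | ite e p q ihp ihq =>
    have he := Expr.toNat_eval E.one_lt _ _ hs.v _ hσ.1
    by_cases h0 : e.evalNat σ.v = 0
    · obtain ⟨t, s', σ', h1, h2, h3, h4⟩ := ihq hp.2 hs (hσ.2.2 h0)
      refine ⟨_, _, _, .ite_false _ _ _ _ _ _ ?_ h1, ?_, h3, h4⟩
      · exact BitVec.eq_of_toNat_eq (by rw [he, h0]; simp)
      · simp only [Cmd.time]; omega
    · obtain ⟨t, s', σ', h1, h2, h3, h4⟩ := ihp hp.1 hs (hσ.2.1 h0)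
      refine ⟨_, _, _, .ite_true _ _ _ _ _ _ ?_ h1, ?_, h3, h4⟩
      · intro hh; rw [hh] at he; simp at he; exact h0 he.symm
      · simp only [Cmd.time]; omega
  | forRange i N p ih =>
    obtain ⟨hi0, hiN, hi, hNp, hp'⟩ := hp
    obtain ⟨hN, hσ⟩ := hσ
    have h1w := E.one_lt
    -- Each round costs 8 units besides its body, 4 for the test and 4 for the increment. The last
    -- test costs 4; the initial assignment later adds 2.
    have key : ∀ (m : ℕ) (s : State E.w) (τ : Store), E.Rel s τ → τ.v i + m = τ.v N →
        iterWp (E.wp p) i m Q τ → ∃ t s' σ', Exec E.cells (.loop (.op .lt (.reg i) (.reg N))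
          (.seq p.toProg (.assign i (.op .add (.reg i) (.const 1))))) s t s' ∧
          t ≤ m * (p.time E.ν + 8) + 4 ∧ E.Rel s' σ' ∧ Q σ' := by
      intro m
      induction m with
      | zero =>
        intro s τ hs hm hQ
        refine ⟨_, _, _, .loop_done _ _ _ ?_, by simp [Expr.cost], hs, hQ⟩
        refine BitVec.eq_of_toNat_eq ?_
        rw [Expr.toNat_eval E.one_lt _ _ hs.v (.op .lt (.reg i) (.reg N))
          ⟨trivial, trivial, trivial⟩]
        rw [Expr.evalNat_lt, if_neg (by simp only [Expr.evalNat_reg]; omega)]; simp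
      | succ m ihm =>
        intro s τ hs hm hQ
        obtain ⟨t, s', σ', h1, h2, h3, h4⟩ := ih hp' hs (wp_frame p τ hQ)
        have e1 := h4.1.v i hi
        have e2 := h4.1.v N hNp
        -- The increment cannot overflow: the new counter is at most the loop bound, which is itself
        -- the content of a register.
        have e3 : σ'.v N < 2 ^ E.w := by rw [← h3.v N]; exact (s'.reg N).isLt
        have hf : (Expr.op .add (.reg i) (.const 1)).Fits (2 ^ E.w) σ'.v :=
          ⟨trivial, h1w, by simp only [Op.Fits, Expr.evalNat]; omega⟩
        have hr := h3.set hi0 (Expr.toNat_eval E.one_lt _ _ h3.v _ hf)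
        obtain ⟨t', s'', σ'', h1', h2', h3', h4'⟩ := ihm _ _ hr (by
          simp only [Store.set_v, if_true, if_neg hiN.symm, Expr.evalNat, Op.evalNat]; omega) h4.2
        refine ⟨_, _, _, .loop_step _ _ _ _ _ _ _ ?_ (.seq _ _ _ _ _ _ _ h1 (.assign _ _ _)) h1',
          ?_, h3', h4'⟩
        · intro hh
          have := Expr.toNat_eval E.one_lt _ _ hs.v (.op .lt (.reg i) (.reg N))
            ⟨trivial, trivial, trivial⟩
          rw [hh, Expr.evalNat_lt, if_pos (by simp only [Expr.evalNat_reg]; omega)] at this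
          simp at this
        · simp only [Expr.cost]
          rw [Nat.add_mul]; omega
    have hr := hs.set (x := i) hi0 (y := BitVec.ofNat E.w 0) (k := 0) (by simp)
    obtain ⟨t, s', σ', h1, h2, h3, h4⟩ := key _ _ _ hr (by simp [hiN.symm]) hσ
    refine ⟨_, _, _, .seq _ _ _ _ _ _ _ (.assign _ _ _) h1, ?_, h3, h4⟩
    simp only [Cmd.time, Expr.cost]
    have := Nat.mul_le_mul_right (p.time E.ν + 8) hN
    omega

end WordRAM

/-! ### Power sums modulo a prime power -/

section PowerSums

open Finset

/-- The elements `j ^ p ^ k` of `ℤ / p ^ (k + 1)`, which depend on `j` modulo `p` only. -/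
theorem ZMod.natCast_pow_eq_of_modEq {p k x y : ℕ} (h : x ≡ y [MOD p]) :
    ((x : ZMod (p ^ (k + 1))) ^ p ^ k) = (y : ZMod (p ^ (k + 1))) ^ p ^ k := by
  have h1 : ((p : ℕ) : ℤ) ∣ (x : ℤ) - (y : ℤ) := (Int.natCast_modEq_iff.2 h).symm.dvd
  have h2 := dvd_sub_pow_of_dvd_sub h1 k
  have h3 : (((x : ℤ) ^ p ^ k - (y : ℤ) ^ p ^ k : ℤ) : ZMod (p ^ (k + 1))) = 0 := by
    rw [ZMod.intCast_zmod_eq_zero_iff_dvd]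
    exact_mod_cast h2
  push_cast at h3
  exact sub_eq_zero.1 h3

theorem ZMod.isUnit_natCast_of_not_dvd {p k x : ℕ} (hp : p.Prime) (h : ¬ p ∣ x) :
    IsUnit (x : ZMod (p ^ (k + 1))) := by
  rw [ZMod.isUnit_iff_coprime]
  exact Nat.Coprime.pow_right _ ((Nat.Prime.coprime_iff_not_dvd hp).2 h).symm

/-- Multiplication by a primitive root `a` modulo `p` permutes the residues, and `j ^ p ^ k` depends
on the residue of `j` only. Hence the sum is unchanged when it is multiplied by `(a ^ p ^ k) ^ m`.
-/
theorem ZMod.sum_pow_mul_eq_zero {p k m : ℕ} (hp : p.Prime) (hm : ¬ (p - 1) ∣ m) :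
    ∑ j ∈ range p, ((j : ZMod (p ^ (k + 1))) ^ p ^ k) ^ m = 0 := by
  have := Fact.mk hp
  obtain ⟨g, hg⟩ := IsCyclic.exists_generator (α := (ZMod p)ˣ)
  have hord : orderOf g = p - 1 := by
    rw [orderOf_eq_card_of_forall_mem_zpowers hg, Nat.card_eq_fintype_card, ZMod.card_units]
  set a : ℕ := (g : ZMod p).val with ha
  have hag : ((a : ℕ) : ZMod p) = (g : ZMod p) := ZMod.natCast_zmod_val _
  set τ : ℕ → ZMod (p ^ (k + 1)) := fun j => ((j : ZMod (p ^ (k + 1))) ^ p ^ k) ^ m with hτ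
  have hmul : ∑ j ∈ range p, τ (a * j % p) = ∑ j ∈ range p, τ j := by
    refine Finset.sum_bij (fun j _ => a * j % p) (fun j _ => ?_) (fun i hi j hj h => ?_)
      (fun j hj => ?_) (fun _ _ => rfl)
    · exact mem_range.2 (Nat.mod_lt _ hp.pos)
    · have h' : ((a * i : ℕ) : ZMod p) = ((a * j : ℕ) : ZMod p) :=
        (ZMod.natCast_eq_natCast_iff _ _ _).2 h
      push_cast at h'
      rw [hag] at h'
      have h2 := (Units.mul_right_inj g).1 h'
      have h3 := (ZMod.natCast_eq_natCast_iff _ _ _).1 h2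
      exact Nat.ModEq.eq_of_lt_of_lt h3 (mem_range.1 hi) (mem_range.1 hj)
    · refine ⟨((g⁻¹ : (ZMod p)ˣ) * (j : ZMod p) : ZMod p).val, mem_range.2 (ZMod.val_lt _), ?_⟩
      refine Nat.ModEq.eq_of_lt_of_lt ((Nat.mod_modEq _ _).trans ?_)
        (Nat.mod_lt _ hp.pos) (mem_range.1 hj)
      rw [← ZMod.natCast_eq_natCast_iff]
      push_cast
      rw [hag, ZMod.natCast_zmod_val, mul_inv_cancel_left₀ g.ne_zero]
  have hmul' : ∑ j ∈ range p, τ (a * j % p) = τ a * ∑ j ∈ range p, τ j := by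
    rw [Finset.mul_sum]
    refine Finset.sum_congr rfl (fun j _ => ?_)
    simp only [hτ]
    rw [ZMod.natCast_pow_eq_of_modEq (Nat.mod_modEq (a * j) p)]
    push_cast
    rw [mul_pow, mul_pow]
  rw [hmul] at hmul'
  have hz : (τ a - 1) * ∑ j ∈ range p, τ j = 0 := by
    rw [sub_mul, one_mul, ← hmul', sub_self]
  -- As the ring has zero divisors, the factor must be a unit and not only nonzero. Modulo `p` the
  -- exponent `p ^ k` has no effect, so what matters is that the power `m` of the generator is not
  -- 1.
  have hunit : IsUnit (τ a - 1) := by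
    have hle : 1 ≤ a := by
      rcases Nat.eq_zero_or_pos a with h0 | h0
      · rw [h0] at hag
        exact absurd hag.symm (by simp)
      · exact h0
    have hle' : 1 ≤ (a ^ p ^ k) ^ m := Nat.one_le_pow _ _ (Nat.pow_pos hle)
    have : τ a - 1 = (((a ^ p ^ k) ^ m - 1 : ℕ) : ZMod (p ^ (k + 1))) := by
      rw [Nat.cast_sub hle']; simp [hτ]
    rw [this]
    refine ZMod.isUnit_natCast_of_not_dvd hp (fun hd => hm ?_)
    have h1 : (((a ^ p ^ k) ^ m - 1 : ℕ) : ZMod p) = 0 := (ZMod.natCast_eq_zero_iff _ _).2 hd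
    rw [Nat.cast_sub hle'] at h1
    push_cast at h1
    rw [ZMod.pow_card_pow, hag, sub_eq_zero] at h1
    rw [← hord, orderOf_dvd_iff_pow_eq_one]
    exact Units.ext (by simpa using h1)
  exact (hunit.mul_right_eq_zero).1 hz

/-- By Fermat, `j ^ (p - 1)` is 1 modulo `p` for `0 < j < p`, hence its `p ^ k`-th power is 1 modulo
`p ^ (k + 1)`. The term `j = 0` vanishes because `m` is not zero. -/
theorem ZMod.sum_pow_mul_eq_sub_one {p k m : ℕ} (hp : p.Prime) (hm : (p - 1) ∣ m) (h0 : m ≠ 0) :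
    ∑ j ∈ range p, ((j : ZMod (p ^ (k + 1))) ^ p ^ k) ^ m = ((p - 1 : ℕ) : ZMod (p ^ (k + 1))) := by
  have := Fact.mk hp
  obtain ⟨q, rfl⟩ := hm
  have h1 : ∀ j ∈ range (p - 1), (((j + 1 : ℕ) : ZMod (p ^ (k + 1))) ^ p ^ k) ^ ((p - 1) * q) = 1 := by
    intro j hj
    have hj' := mem_range.1 hj
    have hc : (j + 1) ^ (p - 1) ≡ 1 [MOD p] := by
      rw [← ZMod.natCast_eq_natCast_iff]
      push_cast
      refine ZMod.pow_card_sub_one_eq_one (fun h => ?_)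
      have : ((j + 1 : ℕ) : ZMod p) = 0 := by exact_mod_cast h
      rw [ZMod.natCast_eq_zero_iff] at this
      exact absurd (Nat.le_of_dvd (by omega) this) (by omega)
    have h2 := ZMod.natCast_pow_eq_of_modEq (k := k) hc
    have h3 : ∀ x : ZMod (p ^ (k + 1)),
        (x ^ p ^ k) ^ ((p - 1) * q) = ((x ^ (p - 1)) ^ p ^ k) ^ q := by
      intro x
      simp only [← pow_mul]
      congr 1
      ring
    rw [h3, ← Nat.cast_pow, h2]
    simp
  obtain ⟨r, rfl⟩ : ∃ r, p = r + 1 := ⟨p - 1, by have := hp.pos; omega⟩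
  rw [Nat.add_sub_cancel] at h0 h1 ⊢
  rw [Finset.sum_range_succ', Finset.sum_congr rfl h1]
  simp [h0]

/-- Cyclic convolution of short sequences through power sums. -/
theorem ZMod.sum_pow_mul_transform {p k b r : ℕ} (hp : p.Prime) (hb : 2 * b < p) (hr : r < b)
    (α β : ℕ → ZMod (p ^ (k + 1))) :
    ∑ j ∈ range p, ((j : ZMod (p ^ (k + 1))) ^ p ^ k) ^ (p - 1 - b - r) *
        ((∑ i ∈ range b, α i * ((j : ZMod (p ^ (k + 1))) ^ p ^ k) ^ i) *
          ∑ i ∈ range (2 * b), β i * ((j : ZMod (p ^ (k + 1))) ^ p ^ k) ^ i) =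
      ((p - 1 : ℕ) : ZMod (p ^ (k + 1))) * ∑ i ∈ range b, α i * β (b + r - i) := by
  set τ : ℕ → ZMod (p ^ (k + 1)) := fun j => (j : ZMod (p ^ (k + 1))) ^ p ^ k with hτ
  have h1 : ∀ j ∈ range p, τ j ^ (p - 1 - b - r) * ((∑ i ∈ range b, α i * τ j ^ i) *
      ∑ i ∈ range (2 * b), β i * τ j ^ i) = ∑ i ∈ range b, ∑ i' ∈ range (2 * b),
        α i * β i' * τ j ^ (p - 1 - b - r + i + i') := by
    intro j _
    rw [Finset.sum_mul_sum, Finset.mul_sum]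
    refine Finset.sum_congr rfl (fun i _ => ?_)
    rw [Finset.mul_sum]
    refine Finset.sum_congr rfl (fun i' _ => ?_)
    rw [pow_add (τ j), pow_add (τ j)]
    ring
  rw [Finset.sum_congr rfl h1, Finset.sum_comm, Finset.mul_sum]
  refine Finset.sum_congr rfl (fun i hi => ?_)
  have hi' := mem_range.1 hi
  -- The exponents lie strictly between 0 and `2 * (p - 1)`, since `2 * b < p` and `r < b`. So the
  -- only one divisible by `p - 1` is `p - 1` itself, which means `i + i' = b + r`.
  rw [Finset.sum_comm, Finset.sum_eq_single_of_mem (b + r - i) (mem_range.2 (by omega))]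
  · rw [← Finset.mul_sum, ZMod.sum_pow_mul_eq_sub_one hp _ (by omega), mul_comm]
    rw [show p - 1 - b - r + i + (b + r - i) = p - 1 by omega]
  · intro i' hi2 hne
    have hi2' := mem_range.1 hi2
    rw [← Finset.mul_sum, ZMod.sum_pow_mul_eq_zero hp _, mul_zero]
    rintro ⟨q, hq⟩
    have hq1 : q = 1 := by
      rcases Nat.lt_or_ge q 1 with h | h
      · have : q = 0 := by omega
        subst this; omega
      · rcases Nat.lt_or_ge 1 q with h2 | h2
        · have : (p - 1) * 2 ≤ (p - 1) * q := Nat.mul_le_mul_left _ h2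
          omega
        · omega
    subst hq1; omega

end PowerSums

open WordRAM.Expr (reg const)

namespace WordRAM

variable {E : Machine}

/-! ### Setting up the parameters -/

/-- Copy the input to array `0`. -/
def copyInput : Cmd :=
  .forRange 20 0 (.block [.load 21 16 (reg 20), .store 0 (reg 20) (reg 21)])

/-- The output will overwrite the input cells, so the program works on a copy. The entries from `n`
on keep their initial value, zero, and thus act as wildcards. -/
theorem copyInput_spec {σ : Store} (h0 : σ.v 0 = E.n) (hν : E.n ≤ E.ν 0) (hB : E.n ≤ E.B) :
    E.wp copyInput (fun τ => (∀ i, i < E.n → τ.a 0 i = σ.a 16 i) ∧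
      ∀ i, E.n ≤ i → τ.a 0 i = σ.a 0 i) σ := by
  refine Machine.wp_for (fun j τ => (∀ i, i < j → τ.a 0 i = σ.a 16 i) ∧
    ∀ i, j ≤ i → τ.a 0 i = σ.a 0 i) (by decide) (by rw [h0]; exact hν) ?_ ?_ ?_
  · simp
  · intro j τ hj hi hf hI
    have h16 := hf.a 16 (by decide)
    rw [h0] at hj
    simp [hi, Machine.Valid, h16]
    refine ⟨by omega, by omega, fun i hi' => ?_, fun i hi' => ?_⟩
    · rcases Nat.lt_succ_iff_lt_or_eq.1 (Nat.lt_succ_of_le hi') with h | h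
      · simp [h.ne, hI.1 i h]
      · simp [h]
    · have : i ≠ j := by omega
      simp [this, hI.2 i (by omega)]
  · intro τ _ _ hI
    rwa [h0] at hI

/-- Compute the number of binary digits of the content of register `0` in register `1`. -/
def computeSize : Cmd :=
  .block [.assign 21 (const 1), .assign 1 (const 0),
    .forRange 20 0 (.ite (.op .lt (reg 0) (reg 21)) .skip
      (.block [.assign 21 (reg 21 + reg 21), .assign 1 (reg 1 + const 1)]))]

theorem computeSize_spec {σ : Store} (h0 : σ.v 0 = E.n) (hν : E.n ≤ E.ν 0)
    (hW : 2 * E.n + 2 < E.W) : E.wp computeSize (fun τ => τ.v 1 = Nat.size E.n) σ := by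
  simp only [computeSize, Machine.wp_block_cons, Machine.wp_assign,
    Expr.fits_const, Expr.evalNat_const]
  -- Register 21 holds a power of two that is doubled until it exceeds `n`; `n` rounds suffice
  -- because `n < 2 ^ n`.
  refine ⟨by omega, by omega, Machine.wp_for (fun j τ => τ.v 21 = 2 ^ τ.v 1 ∧ τ.v 1 ≤ Nat.size E.n ∧
    (τ.v 1 = j ∨ E.n < τ.v 21)) (by decide) (by simpa [h0]) (by simp) ?_ ?_⟩
  · intro j τ hj hi hf hI
    have h0' : τ.v 0 = E.n := by rw [hf.v 0 (by decide)]; simp [h0]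
    simp only [Machine.wp_ite, Machine.wp_block_cons, Machine.wp_block_nil, Machine.wp_assign,
      Machine.wp_skip, Expr.fits_lt, Expr.fits_reg, Expr.fits_add, Expr.fits_const,
      Expr.evalNat_lt, Expr.evalNat_reg, Expr.evalNat_add, Expr.evalNat_const, Store.set_v, h0']
    have hsz := (Nat.lt_size (m := τ.v 1) (n := E.n)).2
    have hlt : τ.v 1 < 2 ^ τ.v 1 := Nat.lt_two_pow_self
    obtain ⟨e1, e2, e3⟩ := hI
    rw [← e1] at hsz hlt
    have hp : 2 ^ (τ.v 1 + 1) = τ.v 21 + τ.v 21 := by rw [pow_succ, ← e1]; ring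
    by_cases h : E.n < τ.v 21
    · simp only [h, if_true]
      norm_num
      and_intros <;> omega
    · have := hsz (by omega)
      simp only [h, if_false]
      norm_num
      rw [hp]
      and_intros <;> omega
  · intro τ _ hf hI
    obtain ⟨e1, e2, e3⟩ := hI
    simp only [Store.set_v] at e3
    norm_num [h0] at e3
    refine le_antisymm e2 (Nat.size_le.2 ?_)
    rw [← e1]
    rcases e3 with e3 | e3
    · rw [e1, e3]; exact Nat.lt_two_pow_self
    · exact e3

/-- Compute the block length in register `2`. -/
def computeBlock : Cmd :=
  .block [.assign 2 (const 0),
    .forRange 20 0 (.ite (.op .lt (reg 0) ((reg 2 + const 1) * (reg 2 + const 1) * reg 1)) .skip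
      (.assign 2 (reg 2 + const 1))),
    .assign 2 (reg 2 + const 1)]

/-- The block length. -/
def blockLength (n : ℕ) : ℕ := Nat.sqrt (n / Nat.size n) + 1

theorem size_le_self (n : ℕ) : Nat.size n ≤ n := Nat.size_le.2 Nat.lt_two_pow_self

theorem computeBlock_spec {σ : Store} (h0 : σ.v 0 = E.n) (h1 : σ.v 1 = Nat.size E.n)
    (hν : E.n ≤ E.ν 0) (hW : (E.n + 2) ^ 3 < E.W) :
    E.wp computeBlock (fun τ => τ.v 2 = blockLength E.n) σ := by
  have hW' : E.n + 2 < E.W :=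
    (Nat.le_self_pow (by norm_num) _).trans_lt hW
  simp only [computeBlock, Machine.wp_block_cons, Machine.wp_assign,
    Expr.fits_const, Expr.evalNat_const]
  -- Register 2 climbs to the largest `s` with `s * s * Nat.size n ≤ n`, which is the integer square
  -- root of `n / Nat.size n`.
  refine ⟨by omega, Machine.wp_for (fun j τ => τ.v 2 ≤ j ∧ τ.v 2 * τ.v 2 * Nat.size E.n ≤ E.n ∧
    (τ.v 2 = j ∨ E.n < (τ.v 2 + 1) * (τ.v 2 + 1) * Nat.size E.n))
    (by decide) (by simpa [h0]) (by simp) ?_ ?_⟩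
  · intro j τ hj hi hf hI
    have h0' : τ.v 0 = E.n := by rw [hf.v 0 (by decide)]; simp [h0]
    have h1' : τ.v 1 = Nat.size E.n := by rw [hf.v 1 (by decide)]; simp [h1]
    simp [h0] at hj
    obtain ⟨e1, e2, e3⟩ := hI
    have hb1 : (τ.v 2 + 1) * (τ.v 2 + 1) ≤ (E.n + 2) ^ 2 := by
      rw [sq]; exact Nat.mul_le_mul (by omega) (by omega)
    have hb2 : (τ.v 2 + 1) * (τ.v 2 + 1) * Nat.size E.n ≤ (E.n + 2) ^ 3 := by
      rw [pow_succ _ 2]; exact Nat.mul_le_mul hb1 ((size_le_self _).trans (by omega))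
    have hb3 : (E.n + 2) ^ 2 ≤ (E.n + 2) ^ 3 := Nat.pow_le_pow_right (by omega) (by omega)
    simp only [Machine.wp_ite, Machine.wp_assign,
      Machine.wp_skip, Expr.fits_lt, Expr.fits_reg, Expr.fits_add, Expr.fits_const, Expr.fits_mul,
      Expr.evalNat_lt, Expr.evalNat_reg, Expr.evalNat_add, Expr.evalNat_const, Store.set_v, h0',
      Expr.evalNat_mul, h1']
    by_cases h : E.n < (τ.v 2 + 1) * (τ.v 2 + 1) * Nat.size E.n
    · simp only [h, if_true]
      norm_num
      and_intros <;> omega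
    · simp only [h, if_false]
      norm_num
      and_intros <;> omega
  · intro τ _ hf hI
    obtain ⟨e1, e2, e3⟩ := hI
    simp [h0] at e1 e3
    simp only [Machine.wp_block_cons, Machine.wp_block_nil, Machine.wp_assign, Expr.fits_add,
      Expr.fits_reg, Expr.fits_const, Expr.evalNat_add, Expr.evalNat_reg, Expr.evalNat_const,
      Store.set_v, if_true]
    refine ⟨⟨trivial, by omega, by omega⟩, ?_⟩
    unfold blockLength
    congr 1
    -- For `n = 0` the block length relies on the convention `0 / 0 = 0`.
    rcases Nat.eq_zero_or_pos E.n with hn | hn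
    · rw [hn] at e1 ⊢; simp; omega
    · have hs : 0 < Nat.size E.n := Nat.size_pos.2 hn
      refine Nat.eq_sqrt.2 ⟨(Nat.le_div_iff_mul_le hs).2 e2, (Nat.div_lt_iff_lt_mul hs).2 ?_⟩
      rcases e3 with e3 | e3
      · rw [e3]
        calc E.n < E.n + 1 := by omega
          _ ≤ (E.n + 1) * (E.n + 1) := Nat.le_mul_of_pos_left _ (by omega)
          _ ≤ _ := Nat.le_mul_of_pos_right _ hs
      · exact e3

/-- Find a prime number between the contents of the registers `6` and `11` in register `3`. -/
def findPrime : Cmd :=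
  .block [.assign 3 (const 0),
    .forRange 20 6 (.ite (.op .eq (reg 3) (const 0))
      (.block [.assign 21 (reg 6 + const 1 + reg 20), .assign 22 (const 1),
        .forRange 23 11 (.ite (.op .lt (const 1) (reg 23)) (.ite (.op .lt (reg 23) (reg 21))
          (.ite (.op .eq (reg 21 % reg 23) (const 0)) (.assign 22 (const 0)) .skip) .skip) .skip),
        .ite (reg 22) (.assign 3 (reg 21)) .skip])
      .skip)]

/-- Trial division of the candidates `c + 1, …, 2 * c`; by Bertrand's postulate one of them is
prime. With `c = 2 * b` this takes `O(b ^ 2)` time. -/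
theorem findPrime_spec {σ : Store} {c : ℕ} (hc : 0 < c) (h6 : σ.v 6 = c) (h11 : σ.v 11 = 2 * c)
    (hν6 : c ≤ E.ν 6) (hν11 : 2 * c ≤ E.ν 11) (hW : 2 * c + 2 < E.W) :
    E.wp findPrime (fun τ => (τ.v 3).Prime ∧ c < τ.v 3 ∧ τ.v 3 ≤ 2 * c) σ := by
  simp only [findPrime, Machine.wp_block_cons, Machine.wp_assign,
    Expr.fits_const, Expr.evalNat_const]
  refine ⟨by omega, Machine.wp_for (fun j τ =>
    (τ.v 3 = 0 ∧ ∀ i < j, ¬ (c + 1 + i).Prime) ∨ ((τ.v 3).Prime ∧ c < τ.v 3 ∧ τ.v 3 ≤ 2 * c))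
    (by decide) (by simpa [h6]) (by simp) ?_ ?_⟩
  · intro j τ hj hi hf hI
    have h6' : τ.v 6 = c := by rw [hf.v 6 (by decide)]; simp [h6]
    have h11' : τ.v 11 = 2 * c := by rw [hf.v 11 (by decide)]; simp [h11]
    simp [h6] at hj
    by_cases h3 : τ.v 3 = 0
    swap
    · have hI' := hI.resolve_left (fun h => h3 h.1)
      simp [h3, hI']
      omega
    have hI' : ∀ i < j, ¬ (c + 1 + i).Prime := by
      rcases hI with h | h
      · exact h.2
      · exact absurd h.1 (by rw [h3]; exact Nat.not_prime_zero)
    simp only [Machine.wp_ite, Machine.wp_block_cons, Machine.wp_assign,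
      Expr.fits_reg, Expr.evalNat_eq, Expr.fits_eq, Expr.evalNat_reg, Expr.fits_const,
      Expr.evalNat_const, Expr.fits_add, Expr.evalNat_add, h3, if_true, h6', hi, Store.set_v]
    refine ⟨⟨trivial, by omega, trivial⟩, fun _ => ⟨⟨⟨trivial, by omega, by omega⟩, trivial, by omega⟩,
      by omega, ?_⟩, fun h => absurd h (by norm_num)⟩
    refine Machine.wp_for (fun k ρ => (ρ.v 22 = 0 ∧ ¬ (c + 1 + j).Prime) ∨
      (ρ.v 22 = 1 ∧ ∀ q < k, 1 < q → q < c + 1 + j → ¬ q ∣ c + 1 + j))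
      (by decide) (by simpa [h11']) (by simp) ?_ ?_
    · intro k ρ hk hki hfρ hJ
      have h21 : ρ.v 21 = c + 1 + j := by rw [hfρ.v 21 (by decide)]; simp
      simp only [Machine.wp_ite, Machine.wp_assign, Machine.wp_skip,
        Expr.fits_reg, Expr.evalNat_eq, Expr.fits_eq, Expr.evalNat_reg, Expr.fits_const,
        Expr.evalNat_const, Expr.fits_lt, Expr.evalNat_lt, hki, h21, Expr.fits_mod,
        Expr.evalNat_mod, Store.set_v]
      by_cases g1 : 1 < k
      · by_cases g2 : k < c + 1 + j
        · by_cases g3 : (c + 1 + j) % k = 0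
          · simp only [g1, g2, g3, if_true]
            norm_num
            refine ⟨by omega, by omega, fun hpr => ?_⟩
            rcases (Nat.dvd_prime hpr).1 (Nat.dvd_of_mod_eq_zero g3) with h | h <;> omega
          · simp only [g1, g2, g3, if_true, if_false]
            norm_num
            refine ⟨by omega, by omega, ?_⟩
            rcases hJ with h | ⟨h, h'⟩
            · exact Or.inl h
            · refine Or.inr ⟨h, fun q hq hq1 hq2 => ?_⟩
              rcases Nat.lt_succ_iff_lt_or_eq.1 (Nat.lt_succ_of_le hq) with h4 | h4
              · exact h' q h4 hq1 hq2
              · rw [h4]; exact fun hd => g3 (Nat.mod_eq_zero_of_dvd hd)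
        · simp only [g1, g2, if_true, if_false]
          norm_num
          refine ⟨by omega, ?_⟩
          rcases hJ with h | ⟨h, h'⟩
          · exact Or.inl h
          · exact Or.inr ⟨h, fun q hq hq1 hq2 => h' q (by omega) hq1 hq2⟩
      · simp only [g1, if_false]
        norm_num
        refine ⟨by omega, ?_⟩
        rcases hJ with h | ⟨h, h'⟩
        · exact Or.inl h
        · exact Or.inr ⟨h, fun q hq hq1 hq2 => h' q (by omega) hq1 hq2⟩
    · intro ρ _ hfρ hJ
      have h21 : ρ.v 21 = c + 1 + j := by rw [hfρ.v 21 (by decide)]; simp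
      have h3' : ρ.v 3 = 0 := by rw [hfρ.v 3 (by decide)]; simp [h3]
      simp [h11'] at hJ
      simp only [Machine.wp_ite, Machine.wp_block_cons, Machine.wp_block_nil, Machine.wp_assign,
        Machine.wp_skip, Expr.fits_reg, Expr.evalNat_reg, Store.set_v, h21, h3']
      rcases hJ with ⟨h, h'⟩ | ⟨h, h'⟩
      · simp [h]
        intro i hi
        rcases Nat.lt_succ_iff_lt_or_eq.1 (Nat.lt_succ_of_le hi) with h4 | h4
        · exact hI' i h4
        · rwa [h4]
      · simp [h]
        refine ⟨Nat.prime_def_lt'.2 ⟨by omega, fun q hq hq1 => h' q (by omega) hq hq1⟩,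
          by omega, by omega⟩
  · intro τ _ hf hI
    simp [h6] at hI
    rcases hI with ⟨_, hI⟩ | hI
    · obtain ⟨p, hp, h1, h2⟩ := Nat.exists_prime_lt_and_le_two_mul c hc.ne'
      have := hI (p - (c + 1)) (by omega)
      rw [show c + 1 + (p - (c + 1)) = p by omega] at this
      exact absurd hp this
    · exact hI

/-! ### Ranking the letters -/

/-- `m` is the least nonzero value among `f s, …, f (s + N - 1)`, attained at position `q`, or
`m = 0` if all of these values are zero. -/
def IsArgmin (f : ℕ → ℕ) (s N m q : ℕ) : Prop :=
  (m = 0 ∧ ∀ i < N, f (s + i) = 0) ∨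
    (0 < m ∧ (∃ i < N, q = s + i) ∧ f q = m ∧ ∀ i < N, f (s + i) ≠ 0 → m ≤ f (s + i))

theorem IsArgmin.congr {f g : ℕ → ℕ} {s N m q : ℕ} (h : IsArgmin f s N m q)
    (hfg : ∀ i < N, f (s + i) = g (s + i)) : IsArgmin g s N m q := by
  rcases h with ⟨h1, h2⟩ | ⟨h1, ⟨i, h2, h3⟩, h4, h5⟩
  · exact Or.inl ⟨h1, fun i hi => by rw [← hfg i hi, h2 i hi]⟩
  · refine Or.inr ⟨h1, ⟨i, h2, h3⟩, by rw [h3, ← hfg i h2, ← h3, h4], fun i hi hne => ?_⟩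
    rw [← hfg i hi] at hne ⊢
    exact h5 i hi hne

/-- Compute in the registers `30` and `31` the least nonzero value of an interval of array `a`, and
its position. The interval begins at the content of register `s`; the content of register `N` is its
length. -/
def argmin (a s N : ℕ) : Cmd :=
  .block [.assign 30 (const 0), .assign 31 (const 0),
    .forRange 32 N (.block [.load 33 a (reg s + reg 32),
      .ite (.op .lt (const 0) (reg 33))
        (.ite (.op .lt (const 0) (reg 30))
          (.ite (.op .lt (reg 33) (reg 30))
            (.block [.assign 30 (reg 33), .assign 31 (reg s + reg 32)]) .skip)
          (.block [.assign 30 (reg 33), .assign 31 (reg s + reg 32)]))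
        .skip])]

/-- Zero entries are skipped, since they stand for wildcards and for letters already ranked. The
scratch registers are 30 to 33, whence the bounds on `s` and `N`. -/
theorem argmin_spec {σ : Store} {a s N s₀ N₀ : ℕ} (ha : a < 16) (hs : s < 30) (hN : N < 30)
    (hs₀ : σ.v s = s₀) (hN₀ : σ.v N = N₀) (hν : N₀ ≤ E.ν N) (hB : s₀ + N₀ ≤ E.B) (hW : E.B < E.W) :
    E.wp (argmin a s N) (fun τ => IsArgmin (σ.a a) s₀ N₀ (τ.v 30) (τ.v 31)) σ := by
  have e30 : s ≠ 30 := by omega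
  have e31 : s ≠ 31 := by omega
  have e32 : s ≠ 32 := by omega
  have e33 : s ≠ 33 := by omega
  have f30 : N ≠ 30 := by omega
  have f31 : N ≠ 31 := by omega
  have f32 : N ≠ 32 := by omega
  have f33 : N ≠ 33 := by omega
  simp only [argmin, Machine.wp_block_cons, Machine.wp_assign,
    Expr.fits_const, Expr.evalNat_const]
  refine ⟨by omega, by omega, Machine.wp_for
    (fun j τ => IsArgmin (σ.a a) s₀ j (τ.v 30) (τ.v 31)) ?_ ?_ ?_ ?_ ?_⟩
  · simp [Cmd.Wf, Cmd.regs, Cmd.block, f30, f31, f33, f32.symm]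
  · simpa [f30, f31, hN₀]
  · exact Or.inl ⟨by simp, by simp⟩
  · intro j τ hj hi hf hI
    have hsτ : τ.v s = s₀ := by
      rw [hf.v s (by simp [Cmd.regs, Cmd.block, e30, e31, e32, e33])]; simp [e30, e31, hs₀]
    have haτ : τ.a a = σ.a a := by rw [hf.a a (by simp [Cmd.arrs, Cmd.block])]; simp
    simp [f30, f31, hN₀] at hj
    simp [e33, Machine.Valid, hsτ, hi, haτ]
    refine ⟨by omega, by omega, by omega, fun h1 => ⟨by omega, fun h2 => ⟨fun h3 => ?_, fun h3 => ?_⟩,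
      fun h2 => ?_⟩, fun h1 => ?_⟩
    · rw [if_neg e30]
      refine ⟨by omega, Or.inr ⟨h1, ⟨j, by omega, rfl⟩, rfl, fun i hi' hne => ?_⟩⟩
      rcases hI with h | ⟨_, _, _, h⟩
      · omega
      · rcases Nat.lt_succ_iff_lt_or_eq.1 hi' with h4 | h4
        · exact h3.le.trans (h i h4 hne)
        · rw [h4]
    · rcases hI with h | ⟨g1, ⟨i, g2, g2'⟩, g3, g4⟩
      · omega
      · refine Or.inr ⟨g1, ⟨i, by omega, g2'⟩, g3, fun i hi' hne => ?_⟩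
        rcases Nat.lt_succ_iff_lt_or_eq.1 hi' with h4 | h4
        · exact g4 i h4 hne
        · rwa [h4]
    · rw [if_neg e30]
      refine ⟨by omega, Or.inr ⟨h1, ⟨j, by omega, rfl⟩, rfl, fun i hi' hne => ?_⟩⟩
      rcases hI with h | h
      · rcases Nat.lt_succ_iff_lt_or_eq.1 hi' with h4 | h4
        · exact absurd (h.2 i h4) hne
        · rw [h4]
      · omega
    · rcases hI with ⟨g1, g2⟩ | ⟨g1, ⟨i, g2, g2'⟩, g3, g4⟩
      · refine Or.inl ⟨g1, fun i hi' => ?_⟩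
        rcases Nat.lt_succ_iff_lt_or_eq.1 hi' with h4 | h4
        · exact g2 i h4
        · rwa [h4]
      · refine Or.inr ⟨g1, ⟨i, by omega, g2'⟩, g3, fun i hi' hne => ?_⟩
        rcases Nat.lt_succ_iff_lt_or_eq.1 hi' with h4 | h4
        · exact g4 i h4 hne
        · exact absurd (h4 ▸ h1) hne
  · intro τ _ hf hI
    simpa [f30, f31, hN₀] using hI

/-- Compute the least nonzero entry of array `0` in the block whose number is the content of register
`25`, and store it and its position in the arrays `2` and `3`. -/
def rescan : Cmd :=
  .block [.assign 26 (reg 25 * reg 2), argmin 0 26 2, .store 2 (reg 25) (reg 30),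
    .store 3 (reg 25) (reg 31)]

theorem rescan_spec {σ : Store} {b K k : ℕ} (hk : k < K) (h25 : σ.v 25 = k) (h2 : σ.v 2 = b)
    (hν : b ≤ E.ν 2) (hB : K * b ≤ E.B) (hKB : K ≤ E.B) (hW : E.B < E.W) :
    E.wp rescan (fun τ => (∃ m q, IsArgmin (σ.a 0) (k * b) b m q ∧
      τ.a 2 = (fun i => if i = k then m else σ.a 2 i) ∧
      τ.a 3 = (fun i => if i = k then q else σ.a 3 i))) σ := by
  have hkb : k * b + b ≤ K * b := by
    calc k * b + b = (k + 1) * b := by ring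
      _ ≤ K * b := Nat.mul_le_mul_right _ hk
  simp only [rescan, Machine.wp_block_cons, Machine.wp_assign, Expr.fits_mul, Expr.fits_reg,
    Expr.evalNat_mul, Expr.evalNat_reg, h25, h2]
  refine ⟨⟨trivial, trivial, by omega⟩, Machine.wp_conseq (argmin_spec (by norm_num) (by norm_num)
    (by norm_num) (s₀ := k * b) (N₀ := b) (by simp) (by simp [h2]) hν (by omega) hW) ?_⟩
  intro τ hf hτ
  have e25 : τ.v 25 = k := by rw [hf.v 25 (by decide)]; simp [h25]
  have a2 : τ.a 2 = σ.a 2 := by rw [hf.a 2 (by decide)]; simp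
  have a3 : τ.a 3 = σ.a 3 := by rw [hf.a 3 (by decide)]; simp
  simp [e25, Machine.Valid]
  refine ⟨by omega, τ.v 30, τ.v 31, hτ, ?_, ?_⟩
  · funext i; simp [a2]
  · funext i; simp [a3]

/-- Give the rank in register `28` to the position of the minimum of the block whose number is the
content of register `25`. -/
def assignRank : Cmd :=
  .block [.load 26 3 (reg 25), .store 1 (reg 26 + reg 2) (reg 28), .store 0 (reg 26) (const 0), rescan]

/-- Replace the codes of letters by ranks: array `0` holds the codes of the characters, and array `1`
receives the ranks of the letters, shifted by the content of register `2`. -/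
def rankLetters : Cmd :=
  .block [.forRange 25 4 rescan, .assign 27 (const 0), .assign 28 (const 0), .assign 24 (const 0),
    .forRange 29 0 (.block [argmin 2 24 4,
      .ite (.op .lt (const 0) (reg 30))
        (.block [.assign 25 (reg 31),
          .ite (.op .eq (reg 30) (reg 27)) .skip
            (.block [.assign 27 (reg 30), .assign 28 (reg 28 + const 1)]),
          assignRank])
        .skip])]

/-- The block minima of `f` are stored in `m`, and their positions in `q`. -/
def BlockMinima (f m q : ℕ → ℕ) (b K : ℕ) : Prop :=
  ∀ k < K, IsArgmin f (k * b) b (m k) (q k)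

/-- The letters of `code` at positions outside of `rest` have received ranks `id` up to `r`; the
letter of rank `r` is `v`, and it is the largest letter that has received a rank. -/
structure Ranking (n : ℕ) (code rest id : ℕ → ℕ) (v r : ℕ) : Prop where
  cases : ∀ x < n, (rest x = code x ∧ id x = 0) ∨
    (rest x = 0 ∧ code x ≠ 0 ∧ id x ≠ 0 ∧ id x ≤ r ∧ code x ≤ v ∧ (id x = r ↔ code x = v))
  eq_iff : ∀ x < n, ∀ y < n, id x ≠ 0 → id y ≠ 0 → (code x = code y ↔ id x = id y)
  le : ∀ x < n, rest x ≠ 0 → v ≤ rest x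

/-- Letters are taken out in increasing order. So the next minimum either equals the last letter `v`
and shares its rank, or it exceeds every ranked letter and gets the fresh rank `r + 1`. -/
theorem Ranking.step {n : ℕ} {code rest id : ℕ → ℕ} {v r : ℕ} (h : Ranking n code rest id v r)
    {q : ℕ} (hq : q < n) (hq0 : rest q ≠ 0)
    (hmin : ∀ x < n, rest x ≠ 0 → rest q ≤ rest x) {r' : ℕ}
    (hr' : r' = if rest q = v then r else r + 1) (hr0 : r = 0 → v = 0) :
    Ranking n code (fun x => if x = q then 0 else rest x) (fun x => if x = q then r' else id x)
      (rest q) r' := by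
  have hvq := h.le q hq hq0
  have hcq : rest q = code q := by
    rcases h.cases q hq with g | g
    · exact g.1
    · exact absurd g.1 hq0
  have hr'0 : r' ≠ 0 := by
    rw [hr']; split_ifs with hv
    · intro h0; have := hr0 h0; omega
    · omega
  have hid : ∀ x < n, id x ≠ 0 → id x ≤ r ∧ code x ≤ v ∧ code x ≠ 0 ∧ (id x = r ↔ code x = v) := by
    intro x hx hx0
    rcases h.cases x hx with g | g
    · exact absurd g.2 hx0
    · exact ⟨g.2.2.2.1, g.2.2.2.2.1, g.2.1, g.2.2.2.2.2⟩
  have hnew : ∀ x < n, id x ≠ 0 → (id x = r' ↔ code x = rest q) := by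
    intro x hx hx0
    obtain ⟨g1, g2, g3, g4⟩ := hid x hx hx0
    rw [hr']; split_ifs with hv
    · rw [g4, hv]
    · constructor <;> intro <;> omega
  refine ⟨fun x hx => ?_, fun x hx y hy hx0 hy0 => ?_, fun x hx hx0 => ?_⟩
  · by_cases hxq : x = q
    · subst hxq
      right; simp [hr'0, ← hcq, hq0]
    · simp only [if_neg hxq]
      rcases h.cases x hx with g | g
      · exact Or.inl g
      · refine Or.inr ⟨g.1, g.2.1, g.2.2.1, ?_, ?_, hnew x hx g.2.2.1⟩
        · have := g.2.2.2.1
          rw [hr']; split_ifs <;> omega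
        · have := g.2.2.2.2.1
          omega
  · by_cases hxq : x = q <;> by_cases hyq : y = q
    · simp [hxq, hyq]
    · simp only [if_neg hyq] at hy0
      simp only [if_pos hxq, if_neg hyq]
      rw [hxq, ← hcq, eq_comm, ← hnew y hy hy0, eq_comm]
    · simp only [if_neg hxq] at hx0
      simp only [if_pos hyq, if_neg hxq]
      rw [hyq, ← hcq, ← hnew x hx hx0]
    · simp only [if_neg hyq] at hy0
      simp only [if_neg hxq] at hx0
      simp only [if_neg hyq, if_neg hxq]
      exact h.eq_iff x hx y hy hx0 hy0
  · by_cases hxq : x = q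
    · simp [hxq] at hx0
    · simp only [if_neg hxq] at hx0 ⊢
      exact hmin x hx hx0

/-- The invariant for the computation of the ranks after `j` rounds. -/
structure RankingInv (n b K : ℕ) (code : ℕ → ℕ) (j : ℕ) (τ : Store) (id : ℕ → ℕ) : Prop where
  id_eq : ∀ i, τ.a 1 i = if i < b then 0 else id (i - b)
  id_zero : ∀ x, n ≤ x → id x = 0
  rest_zero : ∀ x, n ≤ x → τ.a 0 x = 0
  minima : BlockMinima (τ.a 0) (τ.a 2) (τ.a 3) b K
  le : τ.v 28 ≤ j
  zero_iff : τ.v 27 = 0 ↔ τ.v 28 = 0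
  ranking : Ranking n code (τ.a 0) id (τ.v 27) (τ.v 28)
  card_le : ((Finset.range n).filter (fun x => τ.a 0 x ≠ 0)).card ≤ n - j

theorem RankingInv.of_eq {n b K : ℕ} {code : ℕ → ℕ} {j : ℕ} {τ τ' : Store} {id : ℕ → ℕ}
    (h : RankingInv n b K code j τ id) (ha : τ'.a = τ.a) (h27 : τ'.v 27 = τ.v 27)
    (h28 : τ'.v 28 = τ.v 28) : RankingInv n b K code j τ' id := by
  obtain ⟨e1, e2, e3, e4, e5, e6, e7, e8⟩ := h
  rw [← ha] at e1 e3 e4 e7 e8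
  rw [← h28] at e5 e6 e7
  rw [← h27] at e6 e7
  exact ⟨e1, e2, e3, e4, e5, e6, e7, e8⟩

/-- Erasing position `q` can affect the minimum of its own block only, so one rescan of length `b`
restores all block minima. -/
theorem assignRank_spec {ρ τ : Store} {b K j k q i : ℕ} {code id : ℕ → ℕ}
    (h : RankingInv E.n b K code j τ id) (hj : j < E.n) (hk : k < K) (hi : i < b)
    (hq : q = k * b + i) (hq3 : τ.a 3 k = q) (hqn : q < E.n) (hq0 : τ.a 0 q ≠ 0)
    (hmin : ∀ x < E.n, τ.a 0 x ≠ 0 → τ.a 0 q ≤ τ.a 0 x) (hb : 0 < b)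
    (hν2 : b ≤ E.ν 2) (hB : K * b + b ≤ E.B) (hKB : K ≤ E.B) (hW : E.B < E.W) (hK : E.n < K * b)
    (r2 : ρ.v 2 = b) (r25 : ρ.v 25 = k) (ra : ρ.a = τ.a)
    (r27 : ρ.v 27 = τ.a 0 q)
    (r28 : ρ.v 28 = if τ.a 0 q = τ.v 27 then τ.v 28 else τ.v 28 + 1) :
    E.wp assignRank (fun τ' => ∃ id', RankingInv E.n b K code (j + 1) τ' id') ρ := by
  obtain ⟨e1, e2, e3, e4, e5, e6, e7, e8⟩ := h
  have hkb : k * b + b ≤ K * b := by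
    calc k * b + b = (k + 1) * b := by ring
      _ ≤ K * b := Nat.mul_le_mul_right _ hk
  have hstep := fun r' hr' => e7.step hqn hq0 hmin (r' := r') hr'
    (fun h => e6.2 h)
  simp only [assignRank, Machine.wp_block_cons, Machine.wp_load,
    Machine.wp_store, Expr.fits_reg, Expr.fits_add, Expr.fits_const, Expr.evalNat_reg,
    Expr.evalNat_add, Expr.evalNat_const, Store.set_v, Store.put_v, Machine.Valid]
  simp only [r25, ra, r2, hq3]
  norm_num
  refine ⟨by omega, by omega, by omega, by omega, by omega, ?_⟩
  refine Machine.wp_conseq (rescan_spec (k := k) (K := K) (b := b) hk (by simp [r25])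
    (by simp [r2]) hν2 (by omega) hKB hW) ?_
  rintro τ₃ hf₃ ⟨m, p, n1, n2, n3⟩
  have z0 : τ₃.a 0 = fun x => if x = q then 0 else τ.a 0 x := by
    rw [hf₃.a 0 (by decide)]; funext x; simp [ra]
  have z1 : τ₃.a 1 = fun x => if x = q + b then ρ.v 28 else τ.a 1 x := by
    rw [hf₃.a 1 (by decide)]; funext x; simp [ra]
  have z0' : (fun x => if x = q then 0 else τ.a 0 x) = (((((ρ.set 26 q).put 1 (q + b)
      (ρ.v 28)).put 0 q 0)).a 0) := by
    funext x; simp [ra]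
  rw [← z0'] at n1
  have w27 : τ₃.v 27 = τ.a 0 q := by rw [hf₃.v 27 (by decide)]; simp [r27]
  have w28 : τ₃.v 28 = (if τ.a 0 q = τ.v 27 then τ.v 28 else τ.v 28 + 1) := by
    rw [hf₃.v 28 (by decide)]; simp [r28]
  have hw28 : τ₃.v 28 = ρ.v 28 := by rw [w28, r28]
  refine ⟨fun x => if x = q then τ₃.v 28 else id x, ⟨fun x => ?_, fun x hx => ?_, fun x hx => ?_,
    fun k' hk' => ?_, ?_, ?_, ?_, ?_⟩⟩
  · rw [z1, ← hw28]
    simp only [e1 x]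
    by_cases hxb : x < b
    · have : x ≠ q + b := by omega
      simp [this, hxb]
    · have : x - b = q ↔ x = q + b := by omega
      simp [this, hxb]
  · have : x ≠ q := by omega
    simp [this, e2 x hx]
  · rw [z0]; simp only; split_ifs
    · rfl
    · exact e3 x hx
  · rw [z0, n2, n3]
    simp only [Store.put_a, Store.set_a, ra]
    by_cases hkk : k' = k
    · subst hkk; simpa using n1
    · simp [hkk]
      refine (e4 k' hk').congr (fun i' hi' => ?_)
      rw [if_neg]
      intro hh
      apply hkk
      have hc : k' * b + i' = k * b + i := by omega
      have h1 : (k' * b + i') / b = k' := by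
        rw [add_comm, Nat.add_mul_div_right _ _ hb, Nat.div_eq_of_lt hi', zero_add]
      have h2 : (k * b + i) / b = k := by
        rw [add_comm, Nat.add_mul_div_right _ _ hb, Nat.div_eq_of_lt hi, zero_add]
      rw [← h1, ← h2, hc]
  · rw [w28]; split_ifs <;> omega
  · rw [w27, w28]
    constructor
    · intro; omega
    · intro hh
      split_ifs at hh with hv
      rw [hv]; exact e6.2 hh
  · rw [z0, w27]
    exact hstep _ w28
  · have hlt : ((Finset.range E.n).filter (fun x => τ₃.a 0 x ≠ 0)).card <
        ((Finset.range E.n).filter (fun x => τ.a 0 x ≠ 0)).card := by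
      refine Finset.card_lt_card ⟨fun x hx => ?_, fun hh => ?_⟩
      · simp only [Finset.mem_filter, z0] at hx ⊢
        refine ⟨hx.1, fun h => hx.2 ?_⟩
        simp [h]
      · have : q ∈ (Finset.range E.n).filter (fun x => τ₃.a 0 x ≠ 0) :=
          hh (by simp only [Finset.mem_filter, Finset.mem_range]; exact ⟨hqn, by omega⟩)
        simp [z0] at this
    omega

/-- Selection sort with block minima takes `O(n * (K + b))` time and linear space. The ranking is
needed because a code may fill a whole word, while the products formed later require numbers of size
at most `n`. -/
theorem rankLetters_spec {σ : Store} {b K : ℕ} (h0 : σ.v 0 = E.n) (h2 : σ.v 2 = b)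
    (h4 : σ.v 4 = K) (hb : 0 < b) (hK : E.n < K * b) (hν0 : E.n ≤ E.ν 0) (hν2 : b ≤ E.ν 2)
    (hν4 : K ≤ E.ν 4) (hB : K * b + b ≤ E.B) (hKB : K ≤ E.B) (hW : E.B < E.W)
    (hz : ∀ i, E.n ≤ i → σ.a 0 i = 0) (hz1 : ∀ i, σ.a 1 i = 0) :
    E.wp rankLetters (fun τ => ∃ id : ℕ → ℕ, (∀ i, τ.a 1 i = if i < b then 0 else id (i - b)) ∧
      (∀ x, E.n ≤ x → id x = 0) ∧ (∀ x, id x ≤ E.n) ∧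
      (∀ x < E.n, id x = 0 ↔ σ.a 0 x = 0) ∧
      ∀ x < E.n, ∀ y < E.n, σ.a 0 x = σ.a 0 y ↔ id x = id y) σ := by
  simp only [rankLetters, Machine.wp_block_cons]
  refine Machine.wp_conseq (P := fun τ => BlockMinima (σ.a 0) (τ.a 2) (τ.a 3) b K) ?_ ?_
  · refine Machine.wp_for (fun j τ => BlockMinima (σ.a 0) (τ.a 2) (τ.a 3) b j) (by decide)
      (by rwa [h4]) (by simp [BlockMinima]) ?_ ?_
    · intro j τ hj hi hf hI
      rw [h4] at hj
      refine Machine.wp_conseq (rescan_spec hj hi (by rw [hf.v 2 (by decide), h2]) hν2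
        (by omega) hKB hW) ?_
      rintro τ' hf' ⟨m, q, e1, e2, e3⟩
      intro k hk
      simp only [Store.set_a, e2, e3]
      by_cases hkj : k = j
      · rw [if_pos hkj, if_pos hkj, hkj]
        rwa [hf.a 0 (by decide)] at e1
      · rw [if_neg hkj, if_neg hkj]
        exact hI k (by omega)
    · intro τ _ _ hI
      rwa [h4] at hI
  intro τ₁ hf₁ hτ₁
  simp only [Machine.wp_block_cons, Machine.wp_assign, Expr.fits_const,
    Expr.evalNat_const]
  refine ⟨by omega, by omega, by omega, Machine.wp_for
    (fun j τ => ∃ id, RankingInv E.n b K (σ.a 0) j τ id) (by decide) ?_ ?_ ?_ ?_⟩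
  · simpa [hf₁.v 0 (by decide), h0]
  · refine ⟨fun _ => 0, ⟨?_, ?_, ?_, ?_, ?_, ?_, ?_, ?_⟩⟩
    · intro i; simp [hf₁.a 1 (by decide), hz1]
    · simp
    · intro x hx; simp [hf₁.a 0 (by decide), hz x hx]
    · simpa [hf₁.a 0 (by decide)] using hτ₁
    · simp
    · simp
    · refine ⟨fun x hx => Or.inl ?_, ?_, ?_⟩ <;> simp [hf₁.a 0 (by decide)]
    · exact (Finset.card_filter_le _ _).trans (by simp)
  · rintro j τ hj hi hf ⟨id, hI⟩
    simp only [Store.set_v] at hj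
    norm_num [hf₁.v 0 (by decide), h0] at hj
    have v2 : τ.v 2 = b := by rw [hf.v 2 (by decide)]; simp [hf₁.v 2 (by decide), h2]
    have v4 : τ.v 4 = K := by rw [hf.v 4 (by decide)]; simp [hf₁.v 4 (by decide), h4]
    have v24 : τ.v 24 = 0 := by rw [hf.v 24 (by decide)]; simp
    rw [Machine.wp_block_cons]
    refine Machine.wp_conseq (argmin_spec (by norm_num) (by norm_num) (by norm_num) v24 v4 hν4
      (by omega) hW) ?_
    intro τ₂ hf₂ hτ₂
    have x2 : τ₂.v 2 = b := by rw [hf₂.v 2 (by decide), v2]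
    have x27 : τ₂.v 27 = τ.v 27 := hf₂.v 27 (by decide)
    have x28 : τ₂.v 28 = τ.v 28 := hf₂.v 28 (by decide)
    have ya : τ₂.a = τ.a := by funext c; exact hf₂.a c (by simp [argmin, Cmd.arrs, Cmd.block])
    have h28 := hI.le
    simp only [Machine.wp_block_cons, Machine.wp_block_nil, Machine.wp_ite_lt, Machine.wp_ite_eq,
      Machine.wp_assign, Machine.wp_skip, Expr.fits_reg, Expr.fits_const, Expr.fits_add,
      Expr.evalNat_const, Expr.evalNat_reg, Expr.evalNat_add]
    have hdiv : ∀ x < E.n, ∃ k < K, ∃ i < b, x = k * b + i := by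
      intro x hx
      refine ⟨x / b, (Nat.div_lt_iff_lt_mul hb).2 (by omega), x % b, Nat.mod_lt _ hb, ?_⟩
      rw [mul_comm]; exact (Nat.div_add_mod x b).symm
    refine ⟨by omega, trivial, fun hpos => ?_, fun hneg => ?_⟩
    · rcases hτ₂ with hh | ⟨_, ⟨k, hk, hk'⟩, g3, g4⟩
      · omega
      simp only [zero_add] at hk' g4
      subst hk'
      rcases hI.minima _ hk with hh | ⟨m1, ⟨i, hi1, hi2⟩, m3, m4⟩
      · omega
      set q := τ.a 3 (τ₂.v 31) with hq
      have hqn : q < E.n := by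
        by_contra hh
        rw [hI.rest_zero q (by omega)] at m3
        omega
      have hmin : ∀ x < E.n, τ.a 0 x ≠ 0 → τ.a 0 q ≤ τ.a 0 x := by
        intro x hx hx0
        obtain ⟨k', hk', i', hi', rfl⟩ := hdiv x hx
        rcases hI.minima k' hk' with hh | ⟨_, _, _, n4⟩
        · exact absurd (hh.2 i' hi') hx0
        · have := n4 i' hi' hx0
          have := g4 k' hk' (by omega)
          omega
      have hx30 : τ₂.v 30 = τ.a 0 q := by rw [m3, g3]
      have key : ∀ ρ : Store, ρ.v 2 = b → ρ.v 25 = τ₂.v 31 → ρ.a = τ.a → ρ.v 27 = τ.a 0 q →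
          ρ.v 28 = (if τ.a 0 q = τ.v 27 then τ.v 28 else τ.v 28 + 1) →
          E.wp assignRank (fun τ' => ∃ id', RankingInv E.n b K (σ.a 0) (j + 1)
            (τ'.set 29 (j + 1)) id') ρ := fun ρ r2 r25 ra r27 r28 =>
        Machine.wp_mono _ (fun τ' ⟨id', hid'⟩ => ⟨id', hid'.of_eq rfl (by simp) (by simp)⟩) _
          (assignRank_spec hI hj hk hi1 hi2 rfl hqn (by omega) hmin hb hν2 hB hKB hW hK r2 r25 ra
            r27 r28)
      refine ⟨trivial, trivial, trivial, fun hv => key _ (by simp [x2]) (by simp) (by simp [ya]) ?_ ?_,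
        fun hv => ⟨trivial, ⟨trivial, by omega, ?_⟩,
          key _ (by simp [x2]) (by simp) (by simp [ya]) ?_ ?_⟩⟩ <;> norm_num at hv ⊢
      · rw [← hv, hx30]
      · rw [← hx30, hv, x27, x28]; simp
      · omega
      · rw [hx30]
      · rw [x28, ← hx30, if_neg (by rwa [← x27])]
    · rcases hτ₂ with ⟨_, hh⟩ | hh
      swap
      · omega
      have hall : ∀ x < E.n, τ.a 0 x = 0 := by
        intro x hx
        obtain ⟨k', hk', i', hi', rfl⟩ := hdiv x hx
        rcases hI.minima k' hk' with hh' | hh'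
        · exact hh'.2 i' hi'
        · have := hh k' hk'
          rw [zero_add] at this
          omega
      -- When no letter is left, the remaining rounds are idle and the count of unranked letters is
      -- zero.
      have hI' : RankingInv E.n b K (σ.a 0) (j + 1) τ id := by
        obtain ⟨e1, e2, e3, e4, e5, e6, e7, e8⟩ := hI
        refine ⟨e1, e2, e3, e4, by omega, e6, e7, ?_⟩
        rw [Finset.card_eq_zero.2]
        · omega
        · exact Finset.filter_eq_empty_iff.2 (fun x hx => not_not.2 (hall x (Finset.mem_range.1 hx)))
      exact ⟨id, hI'.of_eq (by simp [ya]) (by simp [x27]) (by simp [x28])⟩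
  · rintro τ _ hf ⟨id, hI⟩
    obtain ⟨e1, e2, e3, e4, e5, e6, e7, e8⟩ := hI
    simp only [Store.set_v] at e5 e8
    norm_num [hf₁.v 0 (by decide), h0] at e5 e8
    have hiff : ∀ x < E.n, id x = 0 ↔ σ.a 0 x = 0 := by
      intro x hx
      rcases e7.cases x hx with g | g
      · rw [← g.1, e8 hx, g.2]
      · simp [g.2.1, g.2.2.1]
    refine ⟨id, e1, e2, fun x => ?_, hiff, fun x hx y hy => ?_⟩
    · by_cases hx : x < E.n
      · rcases e7.cases x hx with g | g
        · omega
        · have := g.2.2.2.1; omega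
      · rw [e2 x (by omega)]; omega
    · by_cases hx0 : id x = 0
      · rw [hx0, (hiff x hx).1 hx0, eq_comm, ← hiff y hy, eq_comm]
      · by_cases hy0 : id y = 0
        · rw [hy0, (hiff y hy).1 hy0, ← hiff x hx]
        · exact e7.eq_iff x hx y hy hx0 hy0

/-! ### Tables -/

theorem mul_add_eq_iff {p i j i' j' : ℕ} (hi : i < p) (hi' : i' < p) :
    j * p + i = j' * p + i' ↔ j = j' ∧ i = i' := by
  refine ⟨fun h => ?_, by rintro ⟨rfl, rfl⟩; rfl⟩
  have h1 : (j * p + i) / p = j := by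
    rw [add_comm, Nat.add_mul_div_right _ _ (by omega), Nat.div_eq_of_lt hi, zero_add]
  have h2 : (j' * p + i') / p = j' := by
    rw [add_comm, Nat.add_mul_div_right _ _ (by omega), Nat.div_eq_of_lt hi', zero_add]
  have h3 : j = j' := by rw [← h1, ← h2, h]
  subst h3
  exact ⟨rfl, by omega⟩

theorem mul_add_lt {p i j K : ℕ} (hi : i < p) (hj : j < K) : j * p + i < K * p := by
  calc j * p + i < j * p + p := by omega
    _ = (j + 1) * p := by ring
    _ ≤ K * p := Nat.mul_le_mul_right _ hj

/-- Store in row `j` of array `4` the powers of `j ^ p ^ m` modulo `M`, where the registers `3`, `5`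
and `10` hold `p`, `M` and `m`. -/
def powerTable : Cmd :=
  .forRange 20 3 (.block [.assign 21 (reg 20),
    .forRange 22 10 (.block [.assign 23 (const 1), .forRange 24 3 (.assign 23 (reg 23 * reg 21 % reg 5)),
      .assign 21 (reg 23)]),
    .assign 23 (const 1),
    .forRange 24 3 (.block [.store 4 (reg 20 * reg 3 + reg 24) (reg 23),
      .assign 23 (reg 23 * reg 21 % reg 5)])])

/-- The power `j ^ p ^ m` is reached by taking `p`-th powers `m` times, reducing modulo `M` after
each multiplication, so `O(m * p)` multiplications per row suffice. -/
theorem powerTable_spec {σ : Store} {p M m : ℕ} (h3 : σ.v 3 = p) (h5 : σ.v 5 = M) (h10 : σ.v 10 = m)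
    (hM : 1 < M) (hpM : p ≤ M) (hν3 : p ≤ E.ν 3) (hν10 : m ≤ E.ν 10) (hB : p * p ≤ E.B)
    (hBW : E.B < E.W) (hW : M * M < E.W) :
    E.wp powerTable (fun τ => ∀ j < p, ∀ i < p, τ.a 4 (j * p + i) = (j ^ p ^ m) ^ i % M) σ := by
  have hMW : M ≤ M * M := Nat.le_mul_of_pos_left _ (by omega)
  have hmul : ∀ x y : ℕ, x % M * (y % M) < E.W := fun x y =>
    (Nat.mul_le_mul (Nat.mod_lt _ (by omega)).le (Nat.mod_lt _ (by omega)).le).trans_lt hW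
  refine Machine.wp_for (fun j τ => ∀ j' < j, ∀ i < p, τ.a 4 (j' * p + i) = (j' ^ p ^ m) ^ i % M)
    (by decide) (by rwa [h3]) (by simp) ?_ (fun τ _ _ h => by rwa [h3] at h)
  intro j τ hj hi hf hI
  rw [h3] at hj
  have v3 : τ.v 3 = p := by rw [hf.v 3 (by decide), h3]
  have v5 : τ.v 5 = M := by rw [hf.v 5 (by decide), h5]
  have v10 : τ.v 10 = m := by rw [hf.v 10 (by decide), h10]
  simp only [Machine.wp_block_cons, Machine.wp_assign, Expr.fits_reg, Expr.evalNat_reg, hi]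
  refine ⟨trivial, Machine.wp_conseq (P := fun τ' => τ'.v 21 = j ^ p ^ m % M) ?_ ?_⟩
  · refine Machine.wp_for (fun e τ' => τ'.v 21 = j ^ p ^ e % M) (by decide) (by simpa [v10])
      (by simp [Nat.mod_eq_of_lt (hj.trans_le hpM)]) ?_ (fun τ' _ _ h => by simpa [v10] using h)
    intro e τ₁ _ _ hf₁ hI₁
    have w3 : τ₁.v 3 = p := by rw [hf₁.v 3 (by decide)]; simp [v3]
    have w5 : τ₁.v 5 = M := by rw [hf₁.v 5 (by decide)]; simp [v5]
    simp only [Machine.wp_block_cons, Machine.wp_assign, Expr.fits_const, Expr.evalNat_const]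
    refine ⟨by omega, Machine.wp_for (fun i τ' => τ'.v 23 = (j ^ p ^ e) ^ i % M) (by decide)
      (by simpa [w3]) (by simp [Nat.mod_eq_of_lt hM]) ?_ ?_⟩
    · intro i τ₂ _ _ hf₂ hI₂
      have x5 : τ₂.v 5 = M := by rw [hf₂.v 5 (by decide)]; simp [w5]
      have x21 : τ₂.v 21 = j ^ p ^ e % M := by rw [hf₂.v 21 (by decide)]; simp [hI₁]
      simp [x5, x21, hI₂, hmul, pow_succ, ← Nat.mul_mod]
    · intro τ₂ _ _ hI₂
      simp only [Store.set_v] at hI₂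
      norm_num [w3] at hI₂
      simp [hI₂, pow_succ, pow_mul]
  intro τ₁ hf₁ hτ₁
  have w3 : τ₁.v 3 = p := by rw [hf₁.v 3 (by decide)]; simp [v3]
  have w5 : τ₁.v 5 = M := by rw [hf₁.v 5 (by decide)]; simp [v5]
  have w20 : τ₁.v 20 = j := by rw [hf₁.v 20 (by decide)]; simp [hi]
  have a4 : τ₁.a 4 = τ.a 4 := by rw [hf₁.a 4 (by decide)]; simp
  simp only [Machine.wp_block_cons, Machine.wp_assign, Expr.fits_const, Expr.evalNat_const]
  refine ⟨by omega, Machine.wp_for (fun i τ' => τ'.v 23 = (j ^ p ^ m) ^ i % M ∧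
    (∀ j' < j, ∀ i < p, τ'.a 4 (j' * p + i) = (j' ^ p ^ m) ^ i % M) ∧
    ∀ i' < i, τ'.a 4 (j * p + i') = (j ^ p ^ m) ^ i' % M) (by decide)
      (by simpa [w3]) (by simpa [Nat.mod_eq_of_lt hM, a4] using hI) ?_ ?_⟩
  · rintro i τ₂ hi' hii hf₂ ⟨hI₁, hI₂, hI₃⟩
    simp only [Store.set_v] at hi'
    norm_num [w3] at hi'
    have x3 : τ₂.v 3 = p := by rw [hf₂.v 3 (by decide)]; simp [w3]
    have x5 : τ₂.v 5 = M := by rw [hf₂.v 5 (by decide)]; simp [w5]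
    have x21 : τ₂.v 21 = j ^ p ^ m % M := by rw [hf₂.v 21 (by decide)]; simp [hτ₁]
    have x20 : τ₂.v 20 = j := by rw [hf₂.v 20 (by decide)]; simp [w20]
    have hlt := mul_add_lt hi' hj
    simp [x3, x5, x21, x20, hI₁, hii, hmul, pow_succ, ← Nat.mul_mod, Machine.Valid]
    refine ⟨by omega, by omega, fun j' hj' i' hi'' => ?_, fun i' hi'' => ?_⟩
    · rw [if_neg (by rw [mul_add_eq_iff hi'' hi']; omega), hI₂ j' hj' i' hi'']
    · by_cases h : i' = i
      · simp [h]
      · rw [if_neg h, hI₃ i' (by omega)]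
  · rintro τ₂ _ _ ⟨_, hI₂, hI₃⟩
    simp only [Store.set_v] at hI₃
    norm_num [w3] at hI₃
    intro j' hj' i hi'
    rcases Nat.lt_succ_iff_lt_or_eq.1 hj' with h | h
    · exact hI₂ j' h i hi'
    · subst h; exact hI₃ i hi'

/-- The transform of a factor of `f` of length `N`. -/
def transformValue (f T : ℕ → ℕ) (M p N s e j : ℕ) : ℕ :=
  (∑ i ∈ Finset.range N, f (s + i) ^ e * T (j * p + i)) % M

/-- Compute the transforms of the first, second and third powers of the factors of array `1` of
length `N`, in steps of the block length and with a first step of `c` block lengths. -/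
def transform (d N c : ℕ) : Cmd :=
  .forRange 20 8 (.forRange 21 3 (.block [.assign 22 (const 0), .assign 23 (const 0), .assign 24 (const 0),
    .forRange 25 N (.block [.load 26 1 ((reg 20 + const c) * reg 2 + reg 25),
      .load 27 4 (reg 21 * reg 3 + reg 25),
      .assign 28 (reg 26 * reg 27 % reg 5), .assign 22 ((reg 22 + reg 28) % reg 5),
      .assign 28 (reg 28 * reg 26 % reg 5), .assign 23 ((reg 23 + reg 28) % reg 5),
      .assign 28 (reg 28 * reg 26 % reg 5), .assign 24 ((reg 24 + reg 28) % reg 5)]),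
    .store d (reg 20 * reg 3 + reg 21) (reg 22), .store (d + 1) (reg 20 * reg 3 + reg 21) (reg 23),
    .store (d + 2) (reg 20 * reg 3 + reg 21) (reg 24)]))

/-- Each entry is a polynomial evaluated term by term. Called with `L = b` and `L = 2 * b` for `R =
K + 1` rows of `p` points, this costs `O(K * p * b) = O(n * b)`. -/
theorem transform_spec {σ : Store} {d N c p b M R L n : ℕ} (hd : 5 ≤ d) (hd' : d + 2 < 16)
    (hN : N < 20) (h2 : σ.v 2 = b) (h3 : σ.v 3 = p) (h5 : σ.v 5 = M) (h8 : σ.v 8 = R)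
    (hL : σ.v N = L) (hLp : L ≤ p) (hM : 1 < M) (hn : ∀ x, σ.a 1 x ≤ n) (hnM : n ≤ M)
    (hT : ∀ j < p, ∀ i < p, σ.a 4 (j * p + i) < M)
    (hν3 : p ≤ E.ν 3) (hν8 : R ≤ E.ν 8) (hνN : L ≤ E.ν N) (hB : p * p ≤ E.B) (hB' : R * p ≤ E.B)
    (hB'' : (R + c) * b + L ≤ E.B) (hBW : E.B < E.W) (hcW : R + c < E.W) (hW : M * M < E.W)
    (hW' : 2 * M < E.W) :
    E.wp (transform d N c) (fun τ => ∀ k < R, ∀ j < p, ∀ e < 3,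
      τ.a (d + e) (k * p + j) = transformValue (σ.a 1) (σ.a 4) M p L ((k + c) * b) (e + 1) j) σ := by
  have q1 : d ≠ 1 := by omega
  have q4 : d ≠ 4 := by omega
  have hNs : N ≠ 20 ∧ N ≠ 21 ∧ N ≠ 22 ∧ N ≠ 23 ∧ N ≠ 24 ∧ N ≠ 25 ∧ N ≠ 26 ∧ N ≠ 27 ∧ N ≠ 28 := by
    omega
  obtain ⟨n0, n1, n2, n3, n4, n5, n6, n7, n8⟩ := hNs
  have hmod : ∀ x, x % M < M := fun x => Nat.mod_lt _ (by omega)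
  refine Machine.wp_for (fun k τ => ∀ k' < k, ∀ j < p, ∀ e < 3, τ.a (d + e) (k' * p + j) =
    transformValue (σ.a 1) (σ.a 4) M p L ((k' + c) * b) (e + 1) j)
    (by simp [Cmd.Wf, Cmd.regs, Cmd.block, n2, n3, n4, n6, n7, n8, n5.symm])
    (by rwa [h8]) (by simp) ?_ (fun τ _ _ h => by rwa [h8] at h)
  intro k τ hk hi hf hI
  rw [h8] at hk
  have v3 : τ.v 3 = p := by rw [hf.v 3 (by simp [Cmd.regs, Cmd.block]), h3]
  refine Machine.wp_for (fun j τ => (∀ k' < k, ∀ j < p, ∀ e < 3, τ.a (d + e) (k' * p + j) =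
    transformValue (σ.a 1) (σ.a 4) M p L ((k' + c) * b) (e + 1) j) ∧ ∀ j' < j, ∀ e < 3,
    τ.a (d + e) (k * p + j') = transformValue (σ.a 1) (σ.a 4) M p L ((k + c) * b) (e + 1) j')
    (by simp [Cmd.Wf, Cmd.regs, Cmd.block, n2, n3, n4, n6, n7, n8, n5.symm])
    (by rwa [v3]) (by simpa using hI) ?_ ?_
  swap
  · rintro τ₁ _ _ ⟨hI₁, hI₂⟩ k' hk' j hj e he
    rw [v3] at hI₂
    simp only [Store.set_a]
    rcases Nat.lt_succ_iff_lt_or_eq.1 hk' with h | h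
    · exact hI₁ k' h j hj e he
    · subst h; exact hI₂ j hj e he
  rintro j τ₁ hj hij hf₁ ⟨hI₁, hI₂⟩
  rw [v3] at hj
  have fr : ∀ x, x < 20 → τ₁.v x = σ.v x := by
    intro x hx
    rw [hf₁.v x (by simp [Cmd.regs, Cmd.block]; omega), hf.v x (by simp [Cmd.regs, Cmd.block]; omega)]
  have fa : ∀ x, x < 5 → τ₁.a x = σ.a x := by
    intro x hx
    rw [hf₁.a x (by simp [Cmd.arrs, Cmd.block]; omega), hf.a x (by simp [Cmd.arrs, Cmd.block]; omega)]
  have w20 : τ₁.v 20 = k := by rw [hf₁.v 20 (by simp [Cmd.regs, Cmd.block]), hi]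
  simp only [Machine.wp_block_cons, Machine.wp_assign, Expr.fits_const, Expr.evalNat_const]
  refine ⟨by omega, by omega, by omega, Machine.wp_for (fun i τ' =>
    τ'.v 22 = transformValue (σ.a 1) (σ.a 4) M p i ((k + c) * b) 1 j ∧
    τ'.v 23 = transformValue (σ.a 1) (σ.a 4) M p i ((k + c) * b) 2 j ∧
    τ'.v 24 = transformValue (σ.a 1) (σ.a 4) M p i ((k + c) * b) 3 j)
    (by simp [Cmd.Wf, Cmd.regs, Cmd.block, n2, n3, n4, n6, n7, n8, n5.symm])
    (by simpa [n2, n3, n4, fr N hN, hL]) (by simp [transformValue]) ?_ ?_⟩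
  · rintro i τ₂ hi' hii hf₂ ⟨g1, g2, g3⟩
    simp [n2, n3, n4, fr N hN, hL] at hi'
    have fr₂ : ∀ x, x < 20 → τ₂.v x = σ.v x := by
      intro x hx
      rw [hf₂.v x (by simp [Cmd.regs, Cmd.block]; omega), ← fr x hx]
      simp [show x ≠ 22 by omega, show x ≠ 23 by omega, show x ≠ 24 by omega]
    have x20 : τ₂.v 20 = k := by rw [hf₂.v 20 (by simp [Cmd.regs, Cmd.block])]; simp [w20]
    have x21 : τ₂.v 21 = j := by rw [hf₂.v 21 (by simp [Cmd.regs, Cmd.block])]; simp [hij]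
    have y1 : τ₂.a 1 = σ.a 1 := by rw [hf₂.a 1 (by simp [Cmd.arrs, Cmd.block]), ← fa 1 (by omega)]; rfl
    have y4 : τ₂.a 4 = σ.a 4 := by rw [hf₂.a 4 (by simp [Cmd.arrs, Cmd.block]), ← fa 4 (by omega)]; rfl
    have z2 := (fr₂ 2 (by omega)).trans h2
    have z3 := (fr₂ 3 (by omega)).trans h3
    have z5 := (fr₂ 5 (by omega)).trans h5
    have hkb : (k + c) * b ≤ (R + c) * b := Nat.mul_le_mul_right _ (by omega)
    have hlt := mul_add_lt (show i < p by omega) hj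
    have hjp : j * p ≤ p * p := Nat.mul_le_mul_right _ hj.le
    have hTj := hT j hj i (by omega)
    have hA := hn ((k + c) * b + i)
    set A := σ.a 1 ((k + c) * b + i) with hAdef
    set t := σ.a 4 (j * p + i) with htdef
    have step : ∀ e, transformValue (σ.a 1) (σ.a 4) M p (i + 1) ((k + c) * b) e j =
        (transformValue (σ.a 1) (σ.a 4) M p i ((k + c) * b) e j + A ^ e * t % M) % M := by
      intro e
      rw [transformValue, transformValue, Finset.sum_range_succ, ← Nat.add_mod]
    have tlt : ∀ e, transformValue (σ.a 1) (σ.a 4) M p i ((k + c) * b) e j < M := fun e => hmod _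
    have t1 := tlt 1
    have t2 := tlt 2
    have t3 := tlt 3
    have b1 : A * t < E.W := (Nat.mul_le_mul (hA.trans hnM) hTj.le).trans_lt hW
    have b2 : ∀ x, x % M * A < E.W := fun x =>
      (Nat.mul_le_mul (hmod x).le (hA.trans hnM)).trans_lt hW
    -- The summands for the second and third powers arise from that for the first by further
    -- multiplications with `A`.
    have c2 : A * t % M * A % M = A ^ 2 * t % M := by
      rw [Nat.mod_mul_mod]; ring_nf
    have c3 : A ^ 2 * t % M * A % M = A ^ 3 * t % M := by
      rw [Nat.mod_mul_mod]; ring_nf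
    have m1 := hmod (A * t)
    have m2 := hmod (A ^ 2 * t)
    have m3 := hmod (A ^ 3 * t)
    simp [x20, x21, y1, y4, z2, z3, z5, hii, Machine.Valid, ← hAdef, ← htdef, c2, c3, b2, step,
      g1, g2, g3]
    and_intros <;> omega
  · rintro τ₂ _ hf₂ ⟨g1, g2, g3⟩
    have e0 : (((τ₁.set 22 0).set 23 0).set 24 0).v N = L := by simp [n2, n3, n4, fr N hN, hL]
    rw [e0] at g1 g2 g3
    have x20 : τ₂.v 20 = k := by rw [hf₂.v 20 (by simp [Cmd.regs, Cmd.block])]; simp [w20]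
    have x21 : τ₂.v 21 = j := by rw [hf₂.v 21 (by simp [Cmd.regs, Cmd.block])]; simp [hij]
    have x3 : τ₂.v 3 = p := by
      rw [hf₂.v 3 (by simp [Cmd.regs, Cmd.block]), ← h3, ← fr 3 (by omega)]; simp
    have ya : τ₂.a = τ₁.a := by funext x; exact hf₂.a x (by simp [Cmd.arrs, Cmd.block])
    have hlt := mul_add_lt hj hk
    have hkp : k * p ≤ R * p := Nat.mul_le_mul_right _ hk.le
    have hval : ∀ e < 3, E.Valid (d + e) (k * p + j) := fun e he => Or.inl ⟨by omega, by omega⟩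
    have va := hval 0 (by omega)
    have vb := hval 1 (by omega)
    have vc := hval 2 (by omega)
    simp only [add_zero] at va
    simp only [Machine.wp_block_cons, Machine.wp_block_nil, Machine.wp_store, Expr.fits_reg,
      Expr.fits_add, Expr.fits_mul, Expr.evalNat_reg, Expr.evalNat_add, Expr.evalNat_mul,
      Store.put_v, x20, x21, x3]
    refine ⟨⟨⟨trivial, trivial, by omega⟩, trivial, by omega⟩, trivial, va,
      ⟨⟨trivial, trivial, by omega⟩, trivial, by omega⟩, trivial, vb,
      ⟨⟨trivial, trivial, by omega⟩, trivial, by omega⟩, trivial, vc, fun k' hk' j' hj' e he => ?_,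
      fun j' hj' e he => ?_⟩
    · have : k' * p + j' ≠ k * p + j := by rw [Ne, mul_add_eq_iff hj' hj]; omega
      simp [this, ya]
      exact hI₁ k' hk' j' hj' e he
    · by_cases hjj : j' = j
      · subst hjj
        interval_cases e <;> simp [g1, g2, g3]
      · have : k * p + j' ≠ k * p + j := by omega
        simp [hjj, ya]
        exact hI₂ j' (by omega) e he

/-- Store register `22` in the next row of array `11`. -/
def storePrefix : Cmd :=
  .store 11 ((reg 20 + const 1) * reg 3 + reg 21) (reg 22)

/-- Compute in row `k` of array `11` the sums over the blocks before block `k`, from the block in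
register `13` to the block in register `12`. -/
def prefixSums : Cmd :=
  .forRange 20 4 (.forRange 21 3 (.block [.load 22 11 (reg 20 * reg 3 + reg 21),
    .ite (.op .lt (reg 20) (reg 13)) .skip (.ite (.op .lt (reg 12) (reg 20)) .skip (.block [
      .load 23 7 (reg 20 * reg 3 + reg 21), .load 24 8 ((reg 12 - reg 20) * reg 3 + reg 21),
      .assign 22 ((reg 22 + reg 23 * reg 24) % reg 5),
      .load 23 6 (reg 20 * reg 3 + reg 21), .load 24 9 ((reg 12 - reg 20) * reg 3 + reg 21),
      .assign 22 ((reg 22 + const 2 * (reg 5 - reg 23 * reg 24 % reg 5)) % reg 5),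
      .load 23 5 (reg 20 * reg 3 + reg 21), .load 24 10 ((reg 12 - reg 20) * reg 3 + reg 21),
      .assign 22 ((reg 22 + reg 23 * reg 24) % reg 5)])),
    storePrefix]))

/-- The contribution of block `k` to the prefix sums. -/
def prefixTerm (a : ℕ → ℕ → ℕ) (M p c k₀ k j : ℕ) : ZMod M :=
  if k₀ ≤ k ∧ k ≤ c then
    (a 7 (k * p + j) : ZMod M) * a 8 ((c - k) * p + j) -
      2 * (a 6 (k * p + j) * a 9 ((c - k) * p + j)) + a 5 (k * p + j) * a 10 ((c - k) * p + j)
  else 0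

/-- The rows up to row `k` of array `11` are correct, and so are the first `j` entries of row `k + 1`. -/
def PrefixInv (a : ℕ → ℕ → ℕ) (M p c k₀ k j : ℕ) (τ : Store) : Prop :=
  (∀ k' ≤ k, ∀ j < p, τ.a 11 (k' * p + j) < M ∧
    (τ.a 11 (k' * p + j) : ZMod M) = ∑ i ∈ Finset.range k', prefixTerm a M p c k₀ i j) ∧
  ∀ j' < j, τ.a 11 ((k + 1) * p + j') < M ∧ (τ.a 11 ((k + 1) * p + j') : ZMod M) =
    ∑ i ∈ Finset.range (k + 1), prefixTerm a M p c k₀ i j'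

/-- Row `k + 1` is row `k` plus the contribution of block `k`, so only row 0 must be zero beforehand
and old contents of the other rows do no harm. The bound `c < k₀ + K` keeps the row index `c - k`
inside the tables. -/
theorem prefixSums_spec {σ : Store} {p M c k₀ K : ℕ} (h3 : σ.v 3 = p) (h4 : σ.v 4 = K)
    (h5 : σ.v 5 = M) (h12 : σ.v 12 = c) (h13 : σ.v 13 = k₀) (hM : 1 < M) (hck : c < k₀ + K)
    (hlt : ∀ x < 11, 5 ≤ x → ∀ k < K + 1, ∀ j < p, σ.a x (k * p + j) < M)
    (h0 : ∀ j < p, σ.a 11 j = 0) (hν3 : p ≤ E.ν 3) (hν4 : K ≤ E.ν 4)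
    (hB : (K + 1) * p ≤ E.B) (hBW : E.B < E.W) (hKW : K < E.W) (hW : M * M + M < E.W)
    (hW' : 3 * M < E.W) :
    E.wp prefixSums (fun τ => ∀ k ≤ K, ∀ j < p, τ.a 11 (k * p + j) < M ∧
      (τ.a 11 (k * p + j) : ZMod M) =
        ∑ k' ∈ Finset.range k, prefixTerm σ.a M p c k₀ k' j) σ := by
  have hmod : ∀ x, x % M < M := fun x => Nat.mod_lt _ (by omega)
  refine Machine.wp_for (fun k τ => ∀ k' ≤ k, ∀ j < p, τ.a 11 (k' * p + j) < M ∧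
      (τ.a 11 (k' * p + j) : ZMod M) = ∑ i ∈ Finset.range k', prefixTerm σ.a M p c k₀ i j)
    (by decide) (by rwa [h4]) ?_ ?_ (fun τ _ _ h => by rwa [h4] at h)
  · intro k' hk' j hj
    have : k' = 0 := by omega
    subst this
    simp [h0 j hj]; omega
  intro k τ hk hi hf hI
  rw [h4] at hk
  have v3 : τ.v 3 = p := by rw [hf.v 3 (by decide), h3]
  refine Machine.wp_for (PrefixInv σ.a M p c k₀ k)
    (by decide) (by rwa [v3]) (by simpa [PrefixInv] using hI) ?_ ?_
  swap
  · rintro τ₁ _ _ ⟨hI₁, hI₂⟩ k' hk' j hj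
    rw [v3] at hI₂
    simp only [Store.set_a]
    rcases Nat.lt_succ_iff_lt_or_eq.1 (Nat.lt_succ_of_le hk') with h | h
    · exact hI₁ k' (by omega) j hj
    · subst h; exact hI₂ j hj
  rintro j τ₁ hj hij hf₁ ⟨hI₁, hI₂⟩
  rw [v3] at hj
  have fr : ∀ x, x < 20 → τ₁.v x = σ.v x := by
    intro x hx
    rw [hf₁.v x (by simp [Cmd.regs, Cmd.block, storePrefix]; omega), hf.v x (by simp [Cmd.regs, Cmd.block, storePrefix]; omega)]
  have fa : ∀ x, x ≠ 11 → τ₁.a x = σ.a x := by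
    intro x hx
    rw [hf₁.a x (by simpa [Cmd.arrs, Cmd.block, storePrefix]), hf.a x (by simpa [Cmd.arrs, Cmd.block, storePrefix])]
  have w20 : τ₁.v 20 = k := by rw [hf₁.v 20 (by decide), hi]
  have w3 := (fr 3 (by omega)).trans h3
  have w5 := (fr 5 (by omega)).trans h5
  have w12 := (fr 12 (by omega)).trans h12
  have w13 := (fr 13 (by omega)).trans h13
  have hKp : (K + 1) * p = K * p + p := by ring
  have hkp : k * p + p ≤ K * p := by
    calc k * p + p = (k + 1) * p := by ring
      _ ≤ K * p := Nat.mul_le_mul_right _ hk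
  have hkp' : (k + 1) * p = k * p + p := by ring
  obtain ⟨q1, q2⟩ := hI₁ k le_rfl j hj
  set q := τ₁.a 11 (k * p + j) with hq
  -- The three branches, before `k₀`, after `c` and in between, all end with the same store
  -- instruction.
  have key : ∀ ρ : Store, ρ.v 20 = k → ρ.v 21 = j → ρ.v 3 = p → ρ.a = τ₁.a → ρ.v 22 < M →
      (ρ.v 22 : ZMod M) = (q : ZMod M) + prefixTerm σ.a M p c k₀ k j →
      E.wp storePrefix (fun τ' => PrefixInv σ.a M p c k₀ k (j + 1) (τ'.set 21 (j + 1))) ρ := by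
    intro ρ r20 r21 r3 ra r22 hr
    simp [storePrefix, r20, r21, r3, ra, Machine.Valid, hkp', PrefixInv]
    refine ⟨by omega, by omega, fun k' hk' j' hj' => ?_, fun j' hj' => ?_⟩
    · have : k' * p + j' ≠ k * p + p + j := by
        have hle : k' * p ≤ k * p := Nat.mul_le_mul_right _ hk'
        omega
      rw [if_neg this, if_neg this]
      exact hI₁ k' hk' j' hj'
    · by_cases hjj : j' = j
      · subst hjj
        rw [if_pos rfl, if_pos rfl, hr, q2, Finset.sum_range_succ]
        exact ⟨r22, rfl⟩
      · rw [if_neg (by omega), if_neg (by omega), ← hkp']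
        exact hI₂ j' (by omega)
  simp only [Machine.wp_block_cons, Machine.wp_load, Machine.wp_ite_lt, Machine.wp_skip,
    Machine.wp_assign, Machine.wp_block_nil,
    Expr.fits_reg, Expr.fits_add, Expr.fits_mul, Expr.fits_sub, Expr.fits_mod, Expr.fits_const,
    Expr.evalNat_reg, Expr.evalNat_add, Expr.evalNat_mul, Expr.evalNat_mod, Expr.evalNat_sub,
    Expr.evalNat_const]
  norm_num [w20, hij, w3, w5, w12, w13, Machine.Valid]
  refine ⟨by omega, by omega, fun hk1 => ?_, fun hk1 => ⟨fun hk2 => ?_, fun hk2 => ?_⟩⟩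
  · refine key _ (by simp [w20]) (by simp [hij]) (by simp [w3]) (by simp) (by simpa using q1) ?_
    rw [prefixTerm, if_neg (by omega)]; simp [← hq]
  · refine key _ (by simp [w20]) (by simp [hij]) (by simp [w3]) (by simp) (by simpa using q1) ?_
    rw [prefixTerm, if_neg (by omega)]; simp [← hq]
  · have hck' : (c - k) * p + p ≤ K * p + p := by
      have : (c - k) * p ≤ K * p := Nat.mul_le_mul_right _ (by omega)
      omega
    have gU : ∀ x < 11, 5 ≤ x → τ₁.a x (k * p + j) < M := fun x hx hx' => by
      rw [fa x (by omega)]; exact hlt x hx hx' k (by omega) j hj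
    have gV : ∀ x < 11, 5 ≤ x → τ₁.a x ((c - k) * p + j) < M := fun x hx hx' => by
      rw [fa x (by omega)]; exact hlt x hx hx' (c - k) (by omega) j hj
    have gUV : ∀ x < 11, 5 ≤ x → ∀ y < 11, 5 ≤ y →
        τ₁.a x (k * p + j) * τ₁.a y ((c - k) * p + j) ≤ M * M := fun x hx hx' y hy hy' =>
      Nat.mul_le_mul (gU x hx hx').le (gV y hy hy').le
    have p1 := gUV 7 (by omega) (by omega) 8 (by omega) (by omega)
    have p2 := gUV 6 (by omega) (by omega) 9 (by omega) (by omega)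
    have p3 := gUV 5 (by omega) (by omega) 10 (by omega) (by omega)
    have m1 := hmod (q + τ₁.a 7 (k * p + j) * τ₁.a 8 ((c - k) * p + j))
    have m2 := hmod (τ₁.a 6 (k * p + j) * τ₁.a 9 ((c - k) * p + j))
    have m3 := hmod (q + τ₁.a 7 (k * p + j) * τ₁.a 8 ((c - k) * p + j) + 2 * (M -
      τ₁.a 6 (k * p + j) * τ₁.a 9 ((c - k) * p + j) % M))
    refine ⟨by omega, by omega, by omega, ?_⟩
    rw [← hq]
    constructorm* _ ∧ _
    any_goals omega
    refine key _ (by simp [w20]) (by simp [hij]) (by simp [w3]) (by simp) (by simpa using hmod _) ?_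
    rw [prefixTerm, if_pos ⟨hk1, hk2⟩, ← fa 5 (by omega), ← fa 6 (by omega), ← fa 7 (by omega),
      ← fa 8 (by omega), ← fa 9 (by omega), ← fa 10 (by omega)]
    -- The program avoids negative numbers by adding `M` minus a residue, which is the negative of
    -- that residue in `ZMod M`.
    simp [Nat.cast_sub m2.le]
    ring

/-! ### Detecting mismatches -/

/-- Two ranks match if they are equal or one of them is the rank `0` of the wildcard. -/
def RankMatch (x y : ℕ) : Prop := x = 0 ∨ y = 0 ∨ x = y

/-- A number that is zero if and only if the ranks match. -/
def mismatch (x y : ℕ) : ℕ := x * y * ((x - y) ^ 2 + (y - x) ^ 2)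

/-- With truncated subtraction at most one of the two squares is nonzero, so their sum is the true
value of `(x - y) ^ 2`. -/
theorem mismatch_eq_zero_iff {x y : ℕ} : mismatch x y = 0 ↔ RankMatch x y := by
  simp only [mismatch, RankMatch, mul_eq_zero, or_assoc]
  refine or_congr_right (or_congr_right ?_)
  constructor
  · intro h
    have h1 : (x - y) ^ 2 = 0 := by omega
    have h2 : (y - x) ^ 2 = 0 := by omega
    rw [sq_eq_zero_iff] at h1 h2
    omega
  · rintro rfl; simp

theorem mismatch_le {n x y : ℕ} (hx : x ≤ n) (hy : y ≤ n) : mismatch x y ≤ n ^ 4 := by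
  have h : (x - y) ^ 2 + (y - x) ^ 2 ≤ n ^ 2 := by
    rcases Nat.le_total x y with h | h
    · rw [Nat.sub_eq_zero_of_le h]
      simpa using Nat.pow_le_pow_left (show y - x ≤ n by omega) 2
    · rw [Nat.sub_eq_zero_of_le h]
      simpa using Nat.pow_le_pow_left (show x - y ≤ n by omega) 2
  calc mismatch x y ≤ n * n * n ^ 2 := Nat.mul_le_mul (Nat.mul_le_mul hx hy) h
    _ = n ^ 4 := by ring

/-- The expansion separates the variables: each term is a power of `x` times a power of `y`, hence
the sum over reflected pairs is a combination of three convolutions. -/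
theorem cast_mismatch {R : Type*} [CommRing R] (x y : ℕ) :
    (mismatch x y : R) = (x : R) ^ 3 * y - 2 * ((x : R) ^ 2 * (y : R) ^ 2) + x * (y : R) ^ 3 := by
  unfold mismatch
  rcases Nat.le_total x y with h | h
  · rw [Nat.sub_eq_zero_of_le h]
    push_cast [Nat.cast_sub h]
    ring
  · rw [Nat.sub_eq_zero_of_le h]
    push_cast [Nat.cast_sub h]
    ring

/-- The mismatches of block `k` with its reflection at the center sum `c * b + r`. Position `x` of the
string has index `x + b` in `u`. -/
def blockMismatch (u : ℕ → ℕ) (b c r k : ℕ) : ℕ :=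
  ∑ i ∈ Finset.range b, mismatch (u ((k + 1) * b + i)) (u ((c - k) * b + (b + r - i)))

/-- The mismatches of the blocks from `k₀` to `min c (k - 1)`. -/
def prefixMismatch (u : ℕ → ℕ) (b c r k₀ k : ℕ) : ℕ :=
  ∑ k' ∈ Finset.range k, if k₀ ≤ k' ∧ k' ≤ c then blockMismatch u b c r k' else 0

/-- This size bound is what allows a sum to be tested for zero modulo a larger number. -/
theorem prefixMismatch_le {u : ℕ → ℕ} {n : ℕ} (hu : ∀ x, u x ≤ n) (b c r k₀ k : ℕ) :
    prefixMismatch u b c r k₀ k ≤ k * b * n ^ 4 := by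
  have h1 : ∀ k', blockMismatch u b c r k' ≤ b * n ^ 4 := fun k' => by
    refine (Finset.sum_le_card_nsmul _ _ (n ^ 4) (fun i _ => mismatch_le (hu _) (hu _))).trans ?_
    simp
  refine (Finset.sum_le_card_nsmul _ _ (b * n ^ 4) (fun k' _ => ?_)).trans ?_
  · split_ifs
    · exact h1 k'
    · exact Nat.zero_le _
  · simp [mul_assoc]

theorem prefixMismatch_eq_zero_iff {u : ℕ → ℕ} {b c r k₀ k : ℕ} :
    prefixMismatch u b c r k₀ k = 0 ↔ ∀ k' < k, k₀ ≤ k' → k' ≤ c → ∀ i < b,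
      RankMatch (u ((k' + 1) * b + i)) (u ((c - k') * b + (b + r - i))) := by
  simp only [prefixMismatch, Finset.sum_eq_zero_iff, Finset.mem_range, blockMismatch,
    ite_eq_right_iff, mismatch_eq_zero_iff, and_imp]

/-- The tables hold the powers and the transforms. -/
structure Tables (a : ℕ → ℕ → ℕ) (p m b K : ℕ) : Prop where
  power : ∀ j < p, ∀ i < p, a 4 (j * p + i) = (j ^ p ^ m) ^ i % p ^ (m + 1)
  block : ∀ k < K + 1, ∀ j < p, ∀ e < 3, a (5 + e) (k * p + j) =
    transformValue (a 1) (a 4) (p ^ (m + 1)) p b ((k + 1) * b) (e + 1) j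
  window : ∀ k < K + 1, ∀ j < p, ∀ e < 3, a (8 + e) (k * p + j) =
    transformValue (a 1) (a 4) (p ^ (m + 1)) p (2 * b) (k * b) (e + 1) j

theorem cast_transformValue {a : ℕ → ℕ → ℕ} {p m L : ℕ} {j : ℕ} (hj : j < p) (hL : L ≤ p)
    (ha : ∀ j < p, ∀ i < p, a 4 (j * p + i) = (j ^ p ^ m) ^ i % p ^ (m + 1)) (s e : ℕ) :
    (transformValue (a 1) (a 4) (p ^ (m + 1)) p L s e j : ZMod (p ^ (m + 1))) =
      ∑ i ∈ Finset.range L, (a 1 (s + i) : ZMod (p ^ (m + 1))) ^ e *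
        ((j : ZMod (p ^ (m + 1))) ^ p ^ m) ^ i := by
  rw [transformValue, ZMod.natCast_mod]
  push_cast
  refine Finset.sum_congr rfl (fun i hi => ?_)
  rw [ha j hj i (by have := Finset.mem_range.1 hi; omega), ZMod.natCast_mod]
  push_cast
  rfl

/-- Extracting a coefficient is linear in the pointwise products, so it may be applied after the
summation over the blocks. The prefix sums do not involve `r`, which enters through the column `p -
1 - b - r` of the power table only. -/
theorem sum_prefixTerm {a : ℕ → ℕ → ℕ} {p m b K c r k₀ k : ℕ} (h : Tables a p m b K)
    (hp : p.Prime) (hb : 2 * b < p) (hr : r < b) (hk : k ≤ K) (hc : c < k₀ + K) :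
    ∑ j ∈ Finset.range p, (∑ k' ∈ Finset.range k, prefixTerm a (p ^ (m + 1)) p c k₀ k' j) *
        (a 4 (j * p + (p - 1 - b - r)) : ZMod (p ^ (m + 1))) =
      ((p - 1 : ℕ) : ZMod (p ^ (m + 1))) * (prefixMismatch (a 1) b c r k₀ k : ℕ) := by
  simp_rw [Finset.sum_mul]
  rw [Finset.sum_comm, prefixMismatch, Nat.cast_sum, Finset.mul_sum]
  refine Finset.sum_congr rfl (fun k' hk' => ?_)
  have hk'' := Finset.mem_range.1 hk'
  unfold prefixTerm
  by_cases hcond : k₀ ≤ k' ∧ k' ≤ c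
  swap
  · simp [hcond]
  simp only [if_pos hcond]
  have h1 : ∀ j ∈ Finset.range p, ((a 7 (k' * p + j) : ZMod (p ^ (m + 1))) *
      a 8 ((c - k') * p + j) - 2 * (a 6 (k' * p + j) * a 9 ((c - k') * p + j)) +
      a 5 (k' * p + j) * a 10 ((c - k') * p + j)) * a 4 (j * p + (p - 1 - b - r)) =
      ((j : ZMod (p ^ (m + 1))) ^ p ^ m) ^ (p - 1 - b - r) *
        ((∑ i ∈ Finset.range b, (a 1 ((k' + 1) * b + i) : ZMod (p ^ (m + 1))) ^ 3 *
          ((j : ZMod (p ^ (m + 1))) ^ p ^ m) ^ i) * ∑ i ∈ Finset.range (2 * b),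
          (a 1 ((c - k') * b + i) : ZMod (p ^ (m + 1))) ^ 1 *
          ((j : ZMod (p ^ (m + 1))) ^ p ^ m) ^ i) - 2 *
      (((j : ZMod (p ^ (m + 1))) ^ p ^ m) ^ (p - 1 - b - r) *
        ((∑ i ∈ Finset.range b, (a 1 ((k' + 1) * b + i) : ZMod (p ^ (m + 1))) ^ 2 *
          ((j : ZMod (p ^ (m + 1))) ^ p ^ m) ^ i) * ∑ i ∈ Finset.range (2 * b),
          (a 1 ((c - k') * b + i) : ZMod (p ^ (m + 1))) ^ 2 *
          ((j : ZMod (p ^ (m + 1))) ^ p ^ m) ^ i)) +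
      ((j : ZMod (p ^ (m + 1))) ^ p ^ m) ^ (p - 1 - b - r) *
        ((∑ i ∈ Finset.range b, (a 1 ((k' + 1) * b + i) : ZMod (p ^ (m + 1))) ^ 1 *
          ((j : ZMod (p ^ (m + 1))) ^ p ^ m) ^ i) * ∑ i ∈ Finset.range (2 * b),
          (a 1 ((c - k') * b + i) : ZMod (p ^ (m + 1))) ^ 3 *
          ((j : ZMod (p ^ (m + 1))) ^ p ^ m) ^ i) := by
    intro j hj
    have hj' := Finset.mem_range.1 hj
    rw [h.power j hj' _ (by omega), h.block k' (by omega) j hj' 0 (by omega),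
      h.block k' (by omega) j hj' 1 (by omega), h.block k' (by omega) j hj' 2 (by omega),
      h.window (c - k') (by omega) j hj' 0 (by omega), h.window (c - k') (by omega) j hj' 1 (by omega),
      h.window (c - k') (by omega) j hj' 2 (by omega)]
    simp only [cast_transformValue hj' (show b ≤ p by omega) h.power,
      cast_transformValue hj' (show 2 * b ≤ p by omega) h.power, ZMod.natCast_mod]
    push_cast
    ring
  -- One coefficient extraction for each of the three terms of `cast_mismatch`.
  rw [Finset.sum_congr rfl h1, Finset.sum_add_distrib, Finset.sum_sub_distrib, ← Finset.mul_sum,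
    ZMod.sum_pow_mul_transform hp hb hr
      (fun i => (a 1 ((k' + 1) * b + i) : ZMod (p ^ (m + 1))) ^ 3)
      (fun i => (a 1 ((c - k') * b + i) : ZMod (p ^ (m + 1))) ^ 1),
    ZMod.sum_pow_mul_transform hp hb hr
      (fun i => (a 1 ((k' + 1) * b + i) : ZMod (p ^ (m + 1))) ^ 2)
      (fun i => (a 1 ((c - k') * b + i) : ZMod (p ^ (m + 1))) ^ 2),
    ZMod.sum_pow_mul_transform hp hb hr
      (fun i => (a 1 ((k' + 1) * b + i) : ZMod (p ^ (m + 1))) ^ 1)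
      (fun i => (a 1 ((c - k') * b + i) : ZMod (p ^ (m + 1))) ^ 3), blockMismatch, Nat.cast_sum]
  simp only [cast_mismatch, Finset.sum_add_distrib, Finset.sum_sub_distrib, ← Finset.mul_sum,
    pow_one]
  ring

/-- The computed sum is `p - 1` times the number of interest. The factor is a unit, and the number
is below the modulus, so it vanishes modulo `p ^ (m + 1)` only if it is zero. -/
theorem prefix_mod_eq_zero_iff {a : ℕ → ℕ → ℕ} {Q : ℕ → ℕ} {p m b K c r k₀ k n : ℕ}
    (h : Tables a p m b K)
    (hp : p.Prime) (hb : 2 * b < p) (hr : r < b) (hk : k ≤ K) (hc : c < k₀ + K)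
    (hn : ∀ x, a 1 x ≤ n) (hM : K * b * n ^ 4 < p ^ (m + 1))
    (hQ : ∀ j < p, (Q j : ZMod (p ^ (m + 1))) =
      ∑ k' ∈ Finset.range k, prefixTerm a (p ^ (m + 1)) p c k₀ k' j) :
    (∑ j ∈ Finset.range p, Q j * a 4 (j * p + (p - 1 - b - r))) % p ^ (m + 1) = 0 ↔
      prefixMismatch (a 1) b c r k₀ k = 0 := by
  have hp2 := hp.two_le
  rw [← Nat.dvd_iff_mod_eq_zero, ← ZMod.natCast_eq_zero_iff, Nat.cast_sum]
  have h1 : ∀ j ∈ Finset.range p, ((Q j * a 4 (j * p + (p - 1 - b - r)) : ℕ) : ZMod (p ^ (m + 1))) =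
      (∑ k' ∈ Finset.range k, prefixTerm a (p ^ (m + 1)) p c k₀ k' j) *
        (a 4 (j * p + (p - 1 - b - r)) : ZMod (p ^ (m + 1))) := fun j hj => by
    rw [Nat.cast_mul, hQ j (Finset.mem_range.1 hj)]
  rw [Finset.sum_congr rfl h1, sum_prefixTerm h hp hb hr hk hc]
  have hu : IsUnit ((p - 1 : ℕ) : ZMod (p ^ (m + 1))) :=
    ZMod.isUnit_natCast_of_not_dvd hp (fun hd => by
      have := Nat.le_of_dvd (by omega) hd
      omega)
  rw [hu.mul_right_eq_zero, ZMod.natCast_eq_zero_iff]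
  refine ⟨fun hd => Nat.eq_zero_of_dvd_of_lt hd ?_, fun h0 => by simp [h0]⟩
  refine (prefixMismatch_le hn b c r k₀ k).trans_lt (lt_of_le_of_lt ?_ hM)
  exact Nat.mul_le_mul_right _ (Nat.mul_le_mul_right _ hk)

/-! ### Searching for the first mismatch -/

/-- Search, between the contents of the registers `17` and `18`, for the last row of array `11` whose
product with the column of array `4` in register `16` is zero. -/
def searchBlock : Cmd :=
  .forRange 19 1 (.block [.assign 20 ((reg 17 + reg 18 + const 1) / const 2), .assign 21 (const 0),
    .forRange 22 3 (.block [.load 23 11 (reg 20 * reg 3 + reg 22), .load 24 4 (reg 22 * reg 3 + reg 16),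
      .assign 21 ((reg 21 + reg 23 * reg 24) % reg 5)]),
    .ite (.op .eq (reg 21) (const 0)) (.assign 17 (reg 20)) (.assign 18 (reg 20 - const 1))])

/-- Binary search between `k₀` and `k₁`. No monotonicity of `Z` is needed: it keeps a lower end
where `Z` holds and an upper end that is `k₁` or is followed by a failure of `Z`. -/
theorem searchBlock_spec {σ : Store} {p M e k₀ k₁ K l : ℕ} (Z : ℕ → Prop) (h1 : σ.v 1 = l)
    (h3 : σ.v 3 = p) (h5 : σ.v 5 = M) (h16 : σ.v 16 = e) (h17 : σ.v 17 = k₀) (h18 : σ.v 18 = k₁)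
    (hM : 1 < M) (he : e < p) (hk : k₀ ≤ k₁) (hkK : k₁ ≤ K) (hl : k₁ - k₀ < 2 ^ l) (h0 : Z k₀)
    (hZ : ∀ k ≤ K,
      (∑ j ∈ Finset.range p, σ.a 11 (k * p + j) * σ.a 4 (j * p + e)) % M = 0 ↔ Z k)
    (hQM : ∀ k ≤ K, ∀ j < p, σ.a 11 (k * p + j) < M) (hTM : ∀ j < p, σ.a 4 (j * p + e) < M)
    (hν1 : l ≤ E.ν 1) (hν3 : p ≤ E.ν 3) (hB : (K + 1) * p ≤ E.B) (hB' : p * p ≤ E.B)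
    (hBW : E.B < E.W) (hKW : 2 * K + 2 < E.W) (hW : M * M + M < E.W) :
    E.wp searchBlock (fun τ => k₀ ≤ τ.v 17 ∧ τ.v 17 ≤ k₁ ∧ Z (τ.v 17) ∧
      (τ.v 17 = k₁ ∨ ¬ Z (τ.v 17 + 1))) σ := by
  -- The last conjunct says that the interval is at least halved in each round, so it is a single
  -- point after `l` rounds; further rounds after that change nothing.
  refine Machine.wp_for (fun i τ => k₀ ≤ τ.v 17 ∧ τ.v 17 ≤ τ.v 18 ∧ τ.v 18 ≤ k₁ ∧ Z (τ.v 17) ∧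
      (τ.v 18 = k₁ ∨ ¬ Z (τ.v 18 + 1)) ∧ (τ.v 18 - τ.v 17) * 2 ^ i ≤ k₁ - k₀) (by decide)
      (by rwa [h1]) (by simp [h17, h18, h0, hk]) ?_ ?_
  swap
  · rintro τ _ _ ⟨g1, g2, g3, g4, g5, g6⟩
    rw [h1] at g6
    have : τ.v 18 - τ.v 17 = 0 := by
      by_contra hne
      have : 2 ^ l ≤ (τ.v 18 - τ.v 17) * 2 ^ l := Nat.le_mul_of_pos_left _ (by omega)
      omega
    have he' : τ.v 18 = τ.v 17 := by omega
    rw [he'] at g5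
    exact ⟨g1, by omega, g4, g5⟩
  rintro i τ hi _ hf ⟨g1, g2, g3, g4, g5, g6⟩
  have v3 : τ.v 3 = p := by rw [hf.v 3 (by decide), h3]
  have v5 : τ.v 5 = M := by rw [hf.v 5 (by decide), h5]
  have v16 : τ.v 16 = e := by rw [hf.v 16 (by decide), h16]
  have ya : τ.a = σ.a := by funext x; exact hf.a x (by simp [Cmd.arrs, Cmd.block])
  set mid := (τ.v 17 + τ.v 18 + 1) / 2 with hmid
  have hmK : mid ≤ K := by omega
  simp only [Machine.wp_block_cons, Machine.wp_assign, Expr.fits_reg, Expr.fits_add,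
    Expr.fits_const, Expr.fits_div, Expr.evalNat_reg, Expr.evalNat_add, Expr.evalNat_const,
    Expr.evalNat_div, ← hmid]
  refine ⟨by and_intros <;> first | trivial | omega, by omega,
    Machine.wp_conseq (P := fun τ' => τ'.v 21 = 0 ↔ Z mid) ?_ ?_⟩
  · refine Machine.wp_for (fun j τ' => τ'.v 21 = (∑ j' ∈ Finset.range j,
      σ.a 11 (mid * p + j') * σ.a 4 (j' * p + e)) % M) (by decide) (by simpa [v3]) (by simp) ?_ ?_
    · intro j τ₁ hj hij hf₁ hI
      simp only [Store.set_v] at hj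
      norm_num [v3] at hj
      have w3 : τ₁.v 3 = p := by rw [hf₁.v 3 (by decide)]; simp [v3]
      have w5 : τ₁.v 5 = M := by rw [hf₁.v 5 (by decide)]; simp [v5]
      have w16 : τ₁.v 16 = e := by rw [hf₁.v 16 (by decide)]; simp [v16]
      have w20 : τ₁.v 20 = mid := by rw [hf₁.v 20 (by decide)]; simp
      have za : τ₁.a = σ.a := by
        rw [← ya]; funext x; exact hf₁.a x (by simp [Cmd.arrs, Cmd.block])
      have l1 := mul_add_lt hj (show mid < K + 1 by omega)
      have l2 := mul_add_lt he hj
      have l3 : σ.a 11 (mid * p + j) * σ.a 4 (j * p + e) ≤ M * M :=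
        Nat.mul_le_mul (hQM mid hmK j hj).le (hTM j hj).le
      have l4 := Nat.mod_lt (∑ j' ∈ Finset.range j, σ.a 11 (mid * p + j') * σ.a 4 (j' * p + e))
        (show M > 0 by omega)
      simp [w3, w5, w16, w20, za, hij, Machine.Valid, Finset.sum_range_succ, hI]
      and_intros <;> omega
    · intro τ₁ _ _ hI
      simp only [Store.set_v] at hI
      norm_num [v3] at hI
      rw [hI]
      exact hZ mid hmK
  · intro τ₁ hf₁ hτ₁
    have w17 : τ₁.v 17 = τ.v 17 := by rw [hf₁.v 17 (by decide)]; simp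
    have w18 : τ₁.v 18 = τ.v 18 := by rw [hf₁.v 18 (by decide)]; simp
    have w20 : τ₁.v 20 = mid := by rw [hf₁.v 20 (by decide)]; simp
    simp [w17, w18, w20]
    have hpow : ∀ d : ℕ, 2 * d ≤ τ.v 18 - τ.v 17 → d * 2 ^ (i + 1) ≤ k₁ - k₀ := by
      intro d hd
      calc d * 2 ^ (i + 1) = 2 * d * 2 ^ i := by ring
        _ ≤ (τ.v 18 - τ.v 17) * 2 ^ i := Nat.mul_le_mul_right _ hd
        _ ≤ _ := g6
    refine ⟨by omega, fun hz => ⟨by omega, by omega, g3, hτ₁.1 hz, g5, ?_⟩, fun hz => ?_⟩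
    · have := hpow (τ.v 18 - mid) (by omega)
      omega
    · have hnZ : ¬ Z mid := fun h => hz (hτ₁.2 h)
      have hlt : τ.v 17 < mid := by
        have : τ.v 17 ≠ mid := fun h => hnZ (h ▸ g4)
        omega
      rw [show mid - 1 + 1 = mid by omega]
      have := hpow (mid - 1 - τ.v 17) (by omega)
      exact ⟨by omega, g1, by omega, by omega, g4, Or.inr hnZ, by omega⟩

/-- Increase the position in register `24` while it is less than the content of register `N` and
matches its reflection at the center sum in register `15`, at most one block length. -/
def scan (N : ℕ) : Cmd :=
  .forRange 25 2 (.ite (.op .lt (reg 24) (reg N))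
    (.block [.load 26 1 (reg 24 + reg 2), .load 27 1 (reg 15 + reg 2 - reg 24),
      .ite (.op .eq (reg 26) (const 0)) (.assign 24 (reg 24 + const 1))
        (.ite (.op .eq (reg 27) (const 0)) (.assign 24 (reg 24 + const 1))
          (.ite (.op .eq (reg 26) (reg 27)) (.assign 24 (reg 24 + const 1)) .skip))])
    .skip)

/-- The loop always makes `b` rounds, but the position stays put once it has reached the limit or a
mismatch. The last conjunct lists the three possible reasons for stopping. -/
theorem scan_spec {σ : Store} {N b D t x₀ : ℕ} (hN : N < 24) (h2 : σ.v 2 = b) (h15 : σ.v 15 = D)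
    (hNt : σ.v N = t) (h24 : σ.v 24 = x₀) (ht : t ≤ D + 1) (hν2 : b ≤ E.ν 2)
    (hB : D + b + 2 ≤ E.B) (hBW : E.B < E.W) :
    E.wp (scan N) (fun τ => x₀ ≤ τ.v 24 ∧
      (∀ x, x₀ ≤ x → x < τ.v 24 → x < t ∧ RankMatch (σ.a 1 (x + b)) (σ.a 1 (D + b - x))) ∧
      (τ.v 24 = x₀ + b ∨ t ≤ τ.v 24 ∨
        ¬ RankMatch (σ.a 1 (τ.v 24 + b)) (σ.a 1 (D + b - τ.v 24)))) σ := by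
  have n24 : N ≠ 24 := by omega
  have n25 : N ≠ 25 := by omega
  have n26 : N ≠ 26 := by omega
  have n27 : N ≠ 27 := by omega
  refine Machine.wp_for (fun i τ => x₀ ≤ τ.v 24 ∧
      (∀ x, x₀ ≤ x → x < τ.v 24 → x < t ∧ RankMatch (σ.a 1 (x + b)) (σ.a 1 (D + b - x))) ∧
      (τ.v 24 = x₀ + i ∨ t ≤ τ.v 24 ∨
        ¬ RankMatch (σ.a 1 (τ.v 24 + b)) (σ.a 1 (D + b - τ.v 24)))) (by simp [Cmd.Wf, Cmd.regs, Cmd.block])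
    (by rwa [h2]) ?_ ?_ ?_
  · simp [h24]; omega
  · rintro i τ hi _ hf ⟨g1, g2, g3⟩
    have v2 : τ.v 2 = b := by rw [hf.v 2 (by simp [Cmd.regs, Cmd.block]), h2]
    have v15 : τ.v 15 = D := by rw [hf.v 15 (by simp [Cmd.regs, Cmd.block]), h15]
    have vN : τ.v N = t := by rw [hf.v N (by simp [Cmd.regs, Cmd.block]; omega), hNt]
    have ya : τ.a = σ.a := by funext x; exact hf.a x (by simp [Cmd.arrs, Cmd.block])
    set x := τ.v 24 with hx
    have hinc : x < t → RankMatch (σ.a 1 (x + b)) (σ.a 1 (D + b - x)) → (x₀ ≤ x + 1 ∧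
        (∀ y, x₀ ≤ y → y < x + 1 → y < t ∧ RankMatch (σ.a 1 (y + b)) (σ.a 1 (D + b - y))) ∧
        (x + 1 = x₀ + (i + 1) ∨ t ≤ x + 1 ∨
          ¬ RankMatch (σ.a 1 (x + 1 + b)) (σ.a 1 (D + b - (x + 1))))) := by
      intro hxt hm
      refine ⟨by omega, fun y hy hy' => ?_, ?_⟩
      · rcases Nat.lt_succ_iff_lt_or_eq.1 hy' with h | h
        · exact g2 y hy h
        · subst h; exact ⟨hxt, hm⟩
      · rcases g3 with g | g | g
        · left; omega
        · omega
        · exact absurd hm g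
    have hst : (t ≤ x ∨ ¬ RankMatch (σ.a 1 (x + b)) (σ.a 1 (D + b - x))) → (x₀ ≤ x ∧
        (∀ y, x₀ ≤ y → y < x → y < t ∧ RankMatch (σ.a 1 (y + b)) (σ.a 1 (D + b - y))) ∧
        (x = x₀ + (i + 1) ∨ t ≤ x ∨
          ¬ RankMatch (σ.a 1 (x + b)) (σ.a 1 (D + b - x)))) := fun h => ⟨g1, g2, Or.inr h⟩
    simp only [Machine.wp_block_cons, Machine.wp_block_nil, Machine.wp_load, Machine.wp_ite_lt,
      Machine.wp_ite_eq, Machine.wp_skip, Machine.wp_assign, Expr.fits_reg, Expr.fits_add,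
      Expr.fits_const, Expr.fits_sub, Expr.evalNat_reg, Expr.evalNat_add, Expr.evalNat_sub,
      Expr.evalNat_const, Store.set_v, Store.set_a, Machine.Valid, ← hx, v2, v15, vN, ya,
      Nat.reduceEqDiff, reduceIte, true_and]
    refine ⟨fun hxt => ?_, fun hxt => hst (Or.inl hxt)⟩
    refine ⟨by omega, by omega, by omega, by omega, by omega, fun hz => ⟨by omega, hinc hxt (Or.inl hz)⟩,
      fun hz => ⟨by omega, fun hz' => ⟨by omega, hinc hxt (Or.inr (Or.inl hz'))⟩, fun hz' =>
        ⟨fun hz'' => ⟨by omega, hinc hxt (Or.inr (Or.inr hz''))⟩, fun hz'' => hst (Or.inr ?_)⟩⟩⟩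
    rintro (h | h | h) <;> contradiction
  · intro τ _ _ h
    rwa [h2] at h

/-! ### Computing all radii -/

/-- The parameters of the algorithm fit the machine: block length `b`, prime `p`, number of blocks
`K`, modulus `p ^ (m + 1)`, and number `l` of search steps. -/
structure Params (E : Machine) (l b p K m : ℕ) : Prop where
  prime : p.Prime
  b_pos : 0 < b
  b_lt : 2 * b < p
  lt_blocks : E.n < K * b
  blocks_le : K ≤ 2 ^ l
  bound : K * b * E.n ^ 4 < p ^ (m + 1)
  n_le : E.n ≤ p ^ (m + 1)
  tables_le : (K + 2) * p + p * p ≤ E.B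
  array_le : 2 * E.n + b + 2 ≤ E.B
  B_lt : E.B < E.W
  square_lt : p ^ (m + 1) * p ^ (m + 1) + 3 * p ^ (m + 1) < E.W
  ν0 : E.n ≤ E.ν 0
  ν1 : l ≤ E.ν 1
  ν2 : b ≤ E.ν 2
  ν3 : p ≤ E.ν 3
  ν4 : K ≤ E.ν 4
  ν6 : 2 * b ≤ E.ν 6
  ν8 : K + 1 ≤ E.ν 8
  ν9 : 2 * K ≤ E.ν 9
  ν10 : m ≤ E.ν 10

/-- The registers hold the parameters. -/
structure HasParams (E : Machine) (l b p K m : ℕ) (σ : Store) : Prop where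
  v0 : σ.v 0 = E.n
  v1 : σ.v 1 = l
  v2 : σ.v 2 = b
  v3 : σ.v 3 = p
  v4 : σ.v 4 = K
  v5 : σ.v 5 = p ^ (m + 1)
  v6 : σ.v 6 = 2 * b
  v8 : σ.v 8 = K + 1
  v9 : σ.v 9 = 2 * K
  v10 : σ.v 10 = m

theorem HasParams.of_eq {l b p K m : ℕ} {σ τ : Store} (h : HasParams E l b p K m σ)
    (hv : ∀ x < 12, τ.v x = σ.v x) : HasParams E l b p K m τ := by
  obtain ⟨a0, a1, a2, a3, a4, a5, a6, a8, a9, a10⟩ := h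
  constructor <;> rw [hv _ (by norm_num)] <;> assumption

theorem Tables.congr {a a' : ℕ → ℕ → ℕ} {p m b K : ℕ} (h : Tables a p m b K)
    (ha : ∀ x, 1 ≤ x → x < 11 → a' x = a x) : Tables a' p m b K := by
  obtain ⟨h1, h2, h3⟩ := h
  constructor
  · rwa [ha 4 (by norm_num) (by norm_num)]
  · intro k hk j hj e he
    rw [ha (5 + e) (by omega) (by omega), ha 4 (by omega) (by omega), ha 1 (by omega) (by omega)]
    exact h2 k hk j hj e he
  · intro k hk j hj e he
    rw [ha (8 + e) (by omega) (by omega), ha 4 (by omega) (by omega), ha 1 (by omega) (by omega)]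
    exact h3 k hk j hj e he

/-- Position `x` matches its reflection at the center sum `D`; position `x` has index `x + b` in
`u`. -/
def Reflects (u : ℕ → ℕ) (b D x : ℕ) : Prop := RankMatch (u (x + b)) (u (D + b - x))

/-- The positions after `D / 2` match their reflections at the center sum `D` up to a distance of `R`,
but not beyond. -/
structure IsRadius (u : ℕ → ℕ) (b n D R : ℕ) : Prop where
  le_length : D / 2 + 1 + R ≤ n
  le_center : D / 2 + 1 + R ≤ D + 1
  reflects : ∀ x, D / 2 + 1 ≤ x → x < D / 2 + 1 + R → Reflects u b D x
  maximal : D / 2 + 1 + R = n ∨ D / 2 + 1 + R = D + 1 ∨ ¬ Reflects u b D (D / 2 + 1 + R)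

/-- Write a position as `k' * b + i`; its reflection has index `(c - k') * b + (b + r - i)`. The
assumption `k ≤ c + 1` ensures that every block before `k` is counted and that `c - k'` is not
truncated. -/
theorem prefixMismatch_eq_zero_iff_reflects {u : ℕ → ℕ} {b c r k₀ k : ℕ} (hb : 0 < b)
    (hk : k ≤ c + 1) : prefixMismatch u b c r k₀ k = 0 ↔
      ∀ x, k₀ * b ≤ x → x < k * b → Reflects u b (c * b + r) x := by
  rw [prefixMismatch_eq_zero_iff]
  have key : ∀ k' ≤ c, ∀ i < b, (RankMatch (u ((k' + 1) * b + i)) (u ((c - k') * b + (b + r - i))) ↔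
      Reflects u b (c * b + r) (k' * b + i)) := by
    intro k' hk' i hi
    have h1 : (k' + 1) * b + i = k' * b + i + b := by ring
    have h2 : (c - k') * b + (b + r - i) = c * b + r + b - (k' * b + i) := by
      obtain ⟨d, rfl⟩ := Nat.exists_eq_add_of_le hk'
      rw [Nat.add_sub_cancel_left, Nat.add_mul]
      omega
    rw [Reflects, h1, h2]
  constructor
  · intro h x hx hx'
    have h1 : x / b < k := (Nat.div_lt_iff_lt_mul hb).2 hx'
    have h2 : k₀ ≤ x / b := (Nat.le_div_iff_mul_le hb).2 hx
    have h3 := (key (x / b) (by omega) (x % b) (Nat.mod_lt _ hb)).1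
      (h (x / b) h1 h2 (by omega) (x % b) (Nat.mod_lt _ hb))
    rw [mul_comm (x / b) b, Nat.div_add_mod] at h3
    exact h3
  · intro h k' h1 h2 h3 i hi
    refine (key k' h3 i hi).2 (h _ ?_ (mul_add_lt hi h1))
    exact (Nat.mul_le_mul_right _ h2).trans (Nat.le_add_right _ _)

/-- Compute the radius for the center sum in register `15`. -/
def answer : Cmd :=
  .block [.assign 16 (reg 3 - const 1 - reg 2 - reg 14), .assign 17 (reg 13),
    .ite (.op .lt (reg 12 + const 1) (reg 4)) (.assign 18 (reg 12 + const 1)) (.assign 18 (reg 4)),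
    searchBlock,
    .assign 20 (reg 15 / const 2 + const 1),
    .ite (.op .lt (reg 15 + const 1) (reg 0)) (.assign 21 (reg 15 + const 1)) (.assign 21 (reg 0)),
    .assign 22 (reg 13 * reg 2),
    .ite (.op .lt (reg 22) (reg 21)) (.assign 23 (reg 22)) (.assign 23 (reg 21)),
    .assign 24 (reg 20),
    scan 23,
    .ite (.op .eq (reg 24) (reg 22)) (.assign 24 (reg 17 * reg 2)) .skip,
    scan 21,
    .ite (.op .lt (reg 21) (reg 24)) (.assign 24 (reg 21)) .skip,
    .store 16 (reg 15) (reg 24 - reg 20)]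

set_option maxHeartbeats 1000000 in
/-- The last three steps of the search: from the results of two scans to the radius. -/
theorem isRadius_of_scans {u : ℕ → ℕ} {b c r n D K k₀ k₁ k lim t x₁ x₂ x₃ s : ℕ} (hb : 0 < b)
    (hr : r < b) (hD : D = c * b + r) (hDn : D + 1 < n + n) (hK : n < K * b) (hk₀ : k₀ = c / 2 + 1)
    (hk₁ : k₁ = min (c + 1) K) (hs : s = D / 2 + 1) (hlim : lim = min (D + 1) n)
    (ht : t = min (k₀ * b) lim) (hk : k₀ ≤ k) (hkk : k ≤ k₁)
    (hZ : prefixMismatch u b c r k₀ k = 0)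
    (hZ' : k = k₁ ∨ prefixMismatch u b c r k₀ (k + 1) ≠ 0)
    (h₁ : s ≤ x₁) (h₁' : ∀ x, s ≤ x → x < x₁ → x < t ∧ Reflects u b D x)
    (h₁'' : x₁ = s + b ∨ t ≤ x₁ ∨ ¬ Reflects u b D x₁)
    (hx₂ : x₂ = if x₁ = k₀ * b then k * b else x₁)
    (h₃ : x₂ ≤ x₃) (h₃' : ∀ x, x₂ ≤ x → x < x₃ → x < lim ∧ Reflects u b D x)
    (h₃'' : x₃ = x₂ + b ∨ lim ≤ x₃ ∨ ¬ Reflects u b D x₃) :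
    s ≤ min x₃ lim ∧ IsRadius u b n D (min x₃ lim - s) := by
  -- The estimates `q1` and `q2` place `k₀ * b` between `s` and `s + b`, so the first scan can reach
  -- this block boundary.
  have q1 : 2 * (c / 2 * b) ≤ c * b := by
    calc 2 * (c / 2 * b) = (2 * (c / 2)) * b := by ring
      _ ≤ c * b := Nat.mul_le_mul_right _ (by omega)
  have q2 : c * b ≤ 2 * (c / 2 * b) + b := by
    calc c * b ≤ (2 * (c / 2) + 1) * b := Nat.mul_le_mul_right _ (by omega)
      _ = _ := by ring
  have q3 : k₀ * b = c / 2 * b + b := by rw [hk₀]; ring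
  have hsl : s ≤ lim := by omega
  have hst : s ≤ t := by omega
  have hx₁t : x₁ ≤ t := by
    by_contra hh
    have := (h₁' (x₁ - 1) (by omega) (by omega)).1
    omega
  have hx₁ : x₁ = t ∨ ¬ Reflects u b D x₁ := by
    rcases h₁'' with h | h | h
    · left; omega
    · left; omega
    · exact Or.inr h
  have main : s ≤ min x₃ lim ∧ (∀ x, s ≤ x → x < min x₃ lim → Reflects u b D x) ∧
      (min x₃ lim = lim ∨ ¬ Reflects u b D (min x₃ lim)) := by
    -- If the first scan arrives at the block boundary, the whole blocks up to `k * b` are skipped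
    -- by means of the binary search.
    by_cases hc : x₁ = k₀ * b
    · rw [if_pos hc] at hx₂
      have hkb : k₀ * b ≤ k * b := Nat.mul_le_mul_right _ hk
      rw [prefixMismatch_eq_zero_iff_reflects hb (by omega), ← hD] at hZ
      refine ⟨by omega, fun x hx hx' => ?_, ?_⟩
      · by_cases h1 : x < x₁
        · exact (h₁' x hx h1).2
        · by_cases h2 : x < k * b
          · exact hZ x (by omega) h2
          · exact (h₃' x (by omega) (by omega)).2
      · by_cases hxl : lim ≤ x₃
        · left; omega
        · right
          rw [min_eq_left (by omega)]
          rcases h₃'' with h | h | h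
          -- Here the second scan ran through a whole block. If `k = k₁`, then `k * b` is already at
          -- least `lim`; otherwise block `k` has no mismatch and the search should not have stopped
          -- at `k`.
          · exfalso
            rcases hZ' with g | g
            · have g1 : (c + 1) * b = c * b + b := by ring
              have g2 : k * b = min ((c + 1) * b) (K * b) := by
                rw [g, hk₁]
                rcases Nat.le_total (c + 1) K with h5 | h5
                · rw [min_eq_left h5, min_eq_left (Nat.mul_le_mul_right _ h5)]
                · rw [min_eq_right h5, min_eq_right (Nat.mul_le_mul_right _ h5)]
              omega
            · by_cases hkc : k = k₁
              · have g1 : (c + 1) * b = c * b + b := by ring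
                have g2 : k * b = min ((c + 1) * b) (K * b) := by
                  rw [hkc, hk₁]
                  rcases Nat.le_total (c + 1) K with h5 | h5
                  · rw [min_eq_left h5, min_eq_left (Nat.mul_le_mul_right _ h5)]
                  · rw [min_eq_right h5, min_eq_right (Nat.mul_le_mul_right _ h5)]
                omega
              · apply g
                rw [prefixMismatch_eq_zero_iff_reflects hb (by omega), ← hD]
                intro x hx hx'
                have : (k + 1) * b = k * b + b := by ring
                by_cases h2 : x < k * b
                · exact hZ x hx h2
                · exact (h₃' x (by omega) (by omega)).2
          · omega
          · exact h
    -- The first scan ended before the boundary, at `lim` or at a mismatch, and the second scan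
    -- stops there at once.
    · rw [if_neg hc] at hx₂
      have hx₃ : x₃ = x₁ := by
        by_contra hh
        have := h₃' x₁ (by omega) (by omega)
        rcases hx₁ with h | h
        · omega
        · exact h this.2
      rw [hx₃, min_eq_left (by omega)]
      refine ⟨h₁, fun x hx hx' => (h₁' x hx hx').2, ?_⟩
      rcases hx₁ with h | h
      · left; omega
      · exact Or.inr h
  obtain ⟨m1, m2, m3⟩ := main
  have e : D / 2 + 1 + (min x₃ lim - s) = min x₃ lim := by omega
  refine ⟨m1, ?_, ?_, ?_, ?_⟩
  · rw [e]; omega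
  · rw [e]; omega
  · rw [e, ← hs]; exact m2
  · rw [e]
    rcases m3 with h | h
    · rw [h]; omega
    · exact Or.inr (Or.inr h)

-- A block boundary, a binary search and two scans give the radius. Block `k` may extend beyond the
-- string or be reflected to before its beginning; the array has zeros there, which match
-- everything, and cutting off at `lim` removes these spurious matches.
set_option maxHeartbeats 1000000 in
theorem answer_spec {σ : Store} {l b p K m c k₀ r D : ℕ} (hP : Params E l b p K m)
    (hσ : HasParams E l b p K m σ) (hT : Tables σ.a p m b K) (hu : ∀ x, σ.a 1 x ≤ E.n)
    (h12 : σ.v 12 = c) (h13 : σ.v 13 = k₀) (h14 : σ.v 14 = r) (h15 : σ.v 15 = D) (hr : r < b)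
    (hD : D = c * b + r) (hDn : D + 1 < E.n + E.n) (hk₀ : k₀ = c / 2 + 1)
    (hQ : ∀ k ≤ K, ∀ j < p, σ.a 11 (k * p + j) < p ^ (m + 1) ∧
      (σ.a 11 (k * p + j) : ZMod (p ^ (m + 1))) =
        ∑ k' ∈ Finset.range k, prefixTerm σ.a (p ^ (m + 1)) p c k₀ k' j) :
    E.wp answer (fun τ => ∃ R, IsRadius (σ.a 1) b E.n D R ∧
      τ.a 16 = fun i => if i = D then R else σ.a 16 i) σ := by
  obtain ⟨a0, a1, a2, a3, a4, a5, a6, a8, a9, a10⟩ := hσ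
  have hBW := hP.B_lt
  have harr := hP.array_le
  have htab := hP.tables_le
  have hb := hP.b_pos
  have hbp := hP.b_lt
  have hK := hP.lt_blocks
  have hMW := hP.square_lt
  have hM : 1 < p ^ (m + 1) := Nat.one_lt_pow (by omega) hP.prime.one_lt
  have hpp : p ≤ p * p := Nat.le_mul_of_pos_left _ (by omega)
  have hKp : (K + 2) * p = K * p + 2 * p := by ring
  have hKp' : (K + 1) * p = K * p + p := by ring
  have hKle : K ≤ K * p := Nat.le_mul_of_pos_right _ (by omega)
  have h2Kle : 2 * K ≤ K * p := by
    rw [mul_comm]; exact Nat.mul_le_mul_left _ (by omega)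
  have q1 : 2 * (c / 2 * b) ≤ c * b := by
    calc 2 * (c / 2 * b) = (2 * (c / 2)) * b := by ring
      _ ≤ c * b := Nat.mul_le_mul_right _ (by omega)
  have hcK : c / 2 < K := by
    by_contra hh
    have : K * b ≤ c / 2 * b := Nat.mul_le_mul_right _ (by omega)
    omega
  -- Positions from `(c + 1) * b` on exceed `D`, and there are `K` blocks, so no block number above
  -- `k₁` is of interest.
  set k₁ := min (c + 1) K with hk₁
  have hk₀₁ : k₀ ≤ k₁ := by omega
  have hc : c < k₀ + K := by omega
  have hl := hP.blocks_le
  have hb3 : b ≤ p := by omega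
  simp only [answer, Machine.wp_block_cons, Machine.wp_assign, Expr.fits_reg, Expr.fits_sub,
    Expr.fits_const, Expr.evalNat_reg, Expr.evalNat_sub, Expr.evalNat_const, Store.set_v,
    Nat.reduceEqDiff, reduceIte, a2, a3, h14, h13]
  refine ⟨by and_intros <;> first | trivial | omega, trivial,
    Machine.wp_conseq (P := fun τ => τ.v 18 = k₁) ?_ ?_⟩
  · simp only [Machine.wp_ite_lt, Machine.wp_assign, Expr.fits_reg, Expr.fits_add,
      Expr.fits_const, Expr.evalNat_reg, Expr.evalNat_add, Expr.evalNat_const, Store.set_v,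
      Nat.reduceEqDiff, reduceIte, a4, h12]
    refine ⟨⟨trivial, by omega, by omega⟩, trivial, fun h => ⟨⟨trivial, by omega, by omega⟩, by omega⟩,
      fun h => ⟨trivial, by omega⟩⟩
  intro τ₁ hf₁ hτ₁
  have fr₁ : ∀ x, x < 16 → τ₁.v x = σ.v x := by
    intro x hx
    rw [hf₁.v x (by simp [Cmd.regs]; omega)]
    simp [show x ≠ 16 by omega, show x ≠ 17 by omega]
  have fa₁ : τ₁.a = σ.a := by funext x; exact hf₁.a x (by simp [Cmd.arrs])
  have w16 : τ₁.v 16 = p - 1 - b - r := by rw [hf₁.v 16 (by decide)]; simp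
  have w17 : τ₁.v 17 = k₀ := by rw [hf₁.v 17 (by decide)]; simp
  rw [Machine.wp_block_cons]
  have hZiff : ∀ k ≤ K, (∑ j ∈ Finset.range p, σ.a 11 (k * p + j) *
      σ.a 4 (j * p + (p - 1 - b - r))) % p ^ (m + 1) = 0 ↔
      prefixMismatch (σ.a 1) b c r k₀ k = 0 := fun k hk =>
    prefix_mod_eq_zero_iff (Q := fun j => σ.a 11 (k * p + j)) hT hP.prime hbp hr hk hc hu hP.bound
      (fun j hj => (hQ k hk j hj).2)
  refine Machine.wp_conseq (searchBlock_spec (p := p) (M := p ^ (m + 1)) (e := p - 1 - b - r)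
    (k₀ := k₀) (k₁ := k₁) (K := K) (l := l) (fun k => prefixMismatch (σ.a 1) b c r k₀ k = 0)
    (by rw [fr₁ 1 (by omega), a1]) (by rw [fr₁ 3 (by omega), a3]) (by rw [fr₁ 5 (by omega), a5])
    w16 w17 hτ₁ hM (by omega) hk₀₁ (by omega) (by omega) ?_ (by rw [fa₁]; exact hZiff)
    (by rw [fa₁]; exact fun k hk j hj => (hQ k hk j hj).1) ?_ hP.ν1 hP.ν3 (by omega) (by omega) hBW
    (by omega) (by omega)) ?_
  -- The search starts with the empty range of blocks, which has no mismatch.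
  · refine prefixMismatch_eq_zero_iff.2 (fun k' h1 h2 => ?_)
    omega
  · intro j hj
    rw [fa₁, hT.power j hj _ (by omega)]
    exact Nat.mod_lt _ (by omega)
  intro τ₂ hf₂ hτ₂
  obtain ⟨z1, z2, z3, z4⟩ := hτ₂
  have fr₂ : ∀ x, x < 16 → τ₂.v x = σ.v x := by
    intro x hx
    rw [hf₂.v x (by simp [searchBlock, Cmd.regs, Cmd.block]; omega), fr₁ x hx]
  have fa₂ : τ₂.a = σ.a := by
    rw [← fa₁]; funext x; exact hf₂.a x (by simp [searchBlock, Cmd.arrs, Cmd.block])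
  set k := τ₂.v 17 with hk
  set lim := min (D + 1) E.n with hlim
  simp only [Machine.wp_block_cons, Machine.wp_assign, Expr.fits_reg, Expr.fits_add, Expr.fits_div,
    Expr.fits_const, Expr.evalNat_reg, Expr.evalNat_add, Expr.evalNat_const, Expr.evalNat_div,
    fr₂ 15 (by omega), h15]
  refine ⟨⟨⟨trivial, by omega, trivial⟩, by omega, by omega⟩,
    Machine.wp_conseq (P := fun τ => τ.v 21 = lim) ?_ ?_⟩
  · simp only [Machine.wp_ite_lt, Machine.wp_assign, Expr.fits_reg, Expr.fits_add,
      Expr.fits_const, Expr.evalNat_reg, Expr.evalNat_add, Expr.evalNat_const, Store.set_v,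
      Nat.reduceEqDiff, reduceIte, fr₂ 15 (by omega), h15, fr₂ 0 (by omega), a0]
    refine ⟨⟨trivial, by omega, by omega⟩, trivial, fun h => ⟨⟨trivial, by omega, by omega⟩, by omega⟩,
      fun h => ⟨trivial, by omega⟩⟩
  intro τ₃ hf₃ hτ₃
  have fr₃ : ∀ x, x < 16 → τ₃.v x = σ.v x := by
    intro x hx
    rw [hf₃.v x (by simp [Cmd.regs]; omega)]
    simp [show x ≠ 20 by omega, fr₂ x hx]
  have fa₃ : τ₃.a = σ.a := by
    rw [← fa₂]; funext x; rw [hf₃.a x (by simp [Cmd.arrs])]; rfl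
  have y17 : τ₃.v 17 = k := by rw [hf₃.v 17 (by decide)]; simp [← hk]
  have y20 : τ₃.v 20 = D / 2 + 1 := by rw [hf₃.v 20 (by decide)]; simp
  have hkb : k₀ * b = c / 2 * b + b := by rw [hk₀]; ring
  simp only [Machine.wp_block_cons, Machine.wp_assign, Expr.fits_reg, Expr.fits_mul,
    Expr.evalNat_reg, Expr.evalNat_mul, fr₃ 13 (by omega), h13, fr₃ 2 (by omega), a2]
  refine ⟨⟨trivial, trivial, by omega⟩,
    Machine.wp_conseq (P := fun τ => τ.v 23 = min (k₀ * b) lim) ?_ ?_⟩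
  · simp only [Machine.wp_ite_lt, Machine.wp_assign, Expr.fits_reg, Expr.evalNat_reg, Store.set_v,
      Nat.reduceEqDiff, reduceIte, hτ₃]
    exact ⟨trivial, trivial, fun h => ⟨trivial, by omega⟩, fun h => ⟨trivial, by omega⟩⟩
  intro τ₄ hf₄ hτ₄
  have fr₄ : ∀ x, x < 16 → τ₄.v x = σ.v x := by
    intro x hx
    rw [hf₄.v x (by simp [Cmd.regs]; omega)]
    simp [show x ≠ 22 by omega, fr₃ x hx]
  have fa₄ : τ₄.a = σ.a := by
    rw [← fa₃]; funext x; rw [hf₄.a x (by simp [Cmd.arrs])]; rfl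
  have x17 : τ₄.v 17 = k := by rw [hf₄.v 17 (by decide)]; simp [y17]
  have x20 : τ₄.v 20 = D / 2 + 1 := by rw [hf₄.v 20 (by decide)]; simp [y20]
  have x21 : τ₄.v 21 = lim := by rw [hf₄.v 21 (by decide)]; simp [hτ₃]
  have x22 : τ₄.v 22 = k₀ * b := by rw [hf₄.v 22 (by decide)]; simp
  simp only [Machine.wp_block_cons, Machine.wp_assign, Expr.fits_reg, Expr.evalNat_reg, x20]
  refine ⟨trivial, Machine.wp_conseq (scan_spec (N := 23) (b := b) (D := D)
    (t := min (k₀ * b) lim) (x₀ := D / 2 + 1) (by norm_num) (by simp [fr₄ 2, a2])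
    (by simp [fr₄ 15, h15]) (by simp [hτ₄]) (by simp) (by omega) hP.ν2 (by omega) hBW) ?_⟩
  intro τ₅ hf₅ hτ₅
  simp only [Store.set_a, fa₄] at hτ₅
  have fr₅ : ∀ x, x < 24 → τ₅.v x = τ₄.v x := by
    intro x hx
    rw [hf₅.v x (by simp [scan, Cmd.regs, Cmd.block]; omega)]
    simp [show x ≠ 24 by omega]
  have fa₅ : τ₅.a = σ.a := by
    rw [← fa₄]; funext x; rw [hf₅.a x (by simp [scan, Cmd.arrs, Cmd.block])]; rfl
  set x₁ := τ₅.v 24 with hx₁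
  have hkkb : k * b ≤ K * b := Nat.mul_le_mul_right _ (by omega)
  have hKb : K * b ≤ K * p := Nat.mul_le_mul_left _ hb3
  rw [Machine.wp_block_cons]
  refine Machine.wp_conseq (P := fun τ => τ.v 24 = if x₁ = k₀ * b then k * b else x₁) ?_ ?_
  · simp only [Machine.wp_ite_eq, Machine.wp_assign, Machine.wp_skip, Expr.fits_reg, Expr.fits_mul,
      Expr.evalNat_reg, Expr.evalNat_mul, Store.set_v, reduceIte, fr₅ 22 (by omega), x22,
      fr₅ 17 (by omega), x17, fr₅ 2 (by omega), fr₄ 2 (by omega), a2, ← hx₁]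
    refine ⟨trivial, trivial, fun h => ⟨⟨trivial, trivial, by omega⟩, by rw [if_pos h]⟩,
      fun h => by rw [if_neg h]⟩
  intro τ₆ hf₆ hτ₆
  have fr₆ : ∀ x, x < 24 → τ₆.v x = τ₄.v x := by
    intro x hx
    rw [hf₆.v x (by simp [Cmd.regs]; omega), fr₅ x hx]
  have fa₆ : τ₆.a = σ.a := by
    rw [← fa₅]; funext x; rw [hf₆.a x (by simp [Cmd.arrs])]
  rw [Machine.wp_block_cons]
  refine Machine.wp_conseq (scan_spec (N := 21) (b := b) (D := D) (t := lim) (by norm_num)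
    (by rw [fr₆ 2 (by omega), fr₄ 2 (by omega), a2])
    (by rw [fr₆ 15 (by omega), fr₄ 15 (by omega), h15])
    (by rw [fr₆ 21 (by omega), x21]) hτ₆ (by omega) hP.ν2 (by omega) hBW) ?_
  intro τ₇ hf₇ hτ₇
  rw [fa₆] at hτ₇
  have fr₇ : ∀ x, x < 24 → τ₇.v x = τ₄.v x := by
    intro x hx
    rw [hf₇.v x (by simp [scan, Cmd.regs, Cmd.block]; omega), fr₆ x hx]
  have fa₇ : τ₇.a = σ.a := by
    rw [← fa₆]; funext x; rw [hf₇.a x (by simp [scan, Cmd.arrs, Cmd.block])]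
  obtain ⟨hs, hrad⟩ := isRadius_of_scans hb hr hD hDn hK hk₀ hk₁ rfl hlim rfl z1 z2 z3 z4 hτ₅.1
    hτ₅.2.1 hτ₅.2.2 rfl hτ₇.1 hτ₇.2.1 hτ₇.2.2
  rw [Machine.wp_block_cons]
  refine Machine.wp_conseq (P := fun τ => τ.v 24 = min (τ₇.v 24) lim) ?_ ?_
  · simp only [Machine.wp_ite_lt, Machine.wp_assign, Machine.wp_skip, Expr.fits_reg,
      Expr.evalNat_reg, Store.set_v, reduceIte, fr₇ 21 (by omega), x21]
    exact ⟨trivial, trivial, fun h => ⟨trivial, by omega⟩, fun h => by omega⟩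
  intro τ₈ hf₈ hτ₈
  have y15 : τ₈.v 15 = D := by
    rw [hf₈.v 15 (by decide), fr₇ 15 (by omega), fr₄ 15 (by omega), h15]
  have y20' : τ₈.v 20 = D / 2 + 1 := by rw [hf₈.v 20 (by decide), fr₇ 20 (by omega), x20]
  have fa₈ : τ₈.a = σ.a := by
    rw [← fa₇]; funext x; rw [hf₈.a x (by simp [Cmd.arrs])]
  simp only [Machine.wp_block_cons, Machine.wp_block_nil, Machine.wp_store, Expr.fits_reg,
    Expr.fits_sub, Expr.evalNat_reg, Expr.evalNat_sub, hτ₈, y15, y20', Machine.Valid]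
  refine ⟨trivial, ⟨trivial, trivial, hs⟩, Or.inr ⟨trivial, by omega⟩, _, hrad, ?_⟩
  funext i
  simp [fa₈]

/-- Compute all radii from the tables. -/
def allRadii : Cmd :=
  .forRange 12 9 (.block [.assign 13 (reg 12 / const 2 + const 1), prefixSums,
    .forRange 14 2 (.block [.assign 15 (reg 12 * reg 2 + reg 14),
      .ite (.op .lt (reg 15 + const 1) (reg 0 + reg 0)) answer .skip])])

/-- The center sums are enumerated as `D = c * b + r`, and one table of prefix sums serves all `b`
values of `r`. Since `n < K * b`, the range `c < 2 * K` covers all centers; the test `D + 1 < n + n`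
discards the surplus. -/
theorem allRadii_spec {σ : Store} {l b p K m : ℕ} (hP : Params E l b p K m)
    (hσ : HasParams E l b p K m σ) (hT : Tables σ.a p m b K) (hu : ∀ x, σ.a 1 x ≤ E.n)
    (h11 : ∀ j < p, σ.a 11 j = 0) :
    E.wp allRadii (fun τ => ∀ D, D + 1 < E.n + E.n → IsRadius (σ.a 1) b E.n D (τ.a 16 D)) σ := by
  have hBW := hP.B_lt
  have harr := hP.array_le
  have htab := hP.tables_le
  have hb := hP.b_pos
  have hbp := hP.b_lt
  have hK := hP.lt_blocks
  have hMW := hP.square_lt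
  have hM : 1 < p ^ (m + 1) := Nat.one_lt_pow (by omega) hP.prime.one_lt
  have hpp : p ≤ p * p := Nat.le_mul_of_pos_left _ (by omega)
  have hKp : (K + 2) * p = K * p + 2 * p := by ring
  have hKp' : (K + 1) * p = K * p + p := by ring
  have h2Kle : 2 * K ≤ K * p := by
    rw [mul_comm]; exact Nat.mul_le_mul_left _ (by omega)
  have h2Kb : 2 * K * b ≤ K * p := by
    calc 2 * K * b = K * (2 * b) := by ring
      _ ≤ K * p := Nat.mul_le_mul_left _ (by omega)
  refine Machine.wp_for (fun c τ => (∀ j < p, τ.a 11 j = 0) ∧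
    ∀ D < c * b, D + 1 < E.n + E.n → IsRadius (σ.a 1) b E.n D (τ.a 16 D))
    (by decide) (by rw [hσ.v9]; exact hP.ν9) (by simpa using h11) ?_ ?_
  swap
  · rintro τ _ _ ⟨_, hI⟩ D hD
    rw [hσ.v9] at hI
    have : 2 * K * b = K * b + K * b := by ring
    exact hI D (by omega) hD
  rintro c τ hc hic hf ⟨hI₁, hI₂⟩
  rw [hσ.v9] at hc
  have hcb : c * b + b ≤ 2 * K * b := by
    calc c * b + b = (c + 1) * b := by ring
      _ ≤ 2 * K * b := Nat.mul_le_mul_right _ hc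
  have hτ : HasParams E l b p K m τ := hσ.of_eq (fun x hx =>
    hf.v x (by simp [Cmd.regs, Cmd.block, prefixSums, storePrefix, answer, searchBlock, scan]; omega))
  have ha : ∀ x, 1 ≤ x → x < 11 → τ.a x = σ.a x := fun x hx hx' =>
    hf.a x (by simp [Cmd.arrs, Cmd.block, prefixSums, storePrefix, answer, searchBlock, scan]; omega)
  have hTτ : Tables τ.a p m b K := hT.congr ha
  set k₀ := c / 2 + 1 with hk₀
  simp only [Machine.wp_block_cons, Machine.wp_assign, Expr.fits_reg, Expr.fits_add, Expr.fits_div,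
    Expr.fits_const, Expr.evalNat_reg, Expr.evalNat_add, Expr.evalNat_const, Expr.evalNat_div, hic,
    ← hk₀]
  refine ⟨⟨⟨trivial, by omega, trivial⟩, by omega, by omega⟩, ?_⟩
  have hlt : ∀ x < 11, 5 ≤ x → ∀ k < K + 1, ∀ j < p, τ.a x (k * p + j) < p ^ (m + 1) := by
    intro x hx hx' k hk j hj
    by_cases h : x < 8
    · have := hTτ.block k hk j hj (x - 5) (by omega)
      rw [show 5 + (x - 5) = x by omega] at this
      rw [this]; exact Nat.mod_lt _ (by omega)
    · have := hTτ.window k hk j hj (x - 8) (by omega)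
      rw [show 8 + (x - 8) = x by omega] at this
      rw [this]; exact Nat.mod_lt _ (by omega)
  refine Machine.wp_conseq (prefixSums_spec (p := p) (M := p ^ (m + 1)) (c := c) (k₀ := k₀) (K := K)
    (by simp [hτ.v3]) (by simp [hτ.v4]) (by simp [hτ.v5]) (by simp [hic]) (by simp) hM (by omega)
    (by simpa using hlt) (by simpa using hI₁) hP.ν3 hP.ν4 (by omega) hBW (by omega) (by omega)
    (by omega)) ?_
  intro τ₁ hf₁ hτ₁
  have ha₁ : ∀ x, x ≠ 11 → τ₁.a x = τ.a x := fun x hx => by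
    rw [hf₁.a x (by simpa [Cmd.arrs, Cmd.block, prefixSums, storePrefix] using hx)]; rfl
  have fr₁ : ∀ x, x < 13 → τ₁.v x = τ.v x := fun x hx => by
    rw [hf₁.v x (by simp [Cmd.regs, Cmd.block, prefixSums, storePrefix]; omega)]
    simp [show x ≠ 13 by omega]
  have w13 : τ₁.v 13 = k₀ := by rw [hf₁.v 13 (by decide)]; simp
  have hP₁ : HasParams E l b p K m τ₁ := hτ.of_eq (fun x hx => fr₁ x (by omega))
  rw [Machine.wp_block_cons]
  refine Machine.wp_for (fun r τ' => ∀ D < c * b + r, D + 1 < E.n + E.n →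
    IsRadius (σ.a 1) b E.n D (τ'.a 16 D)) (by decide) (by rw [hP₁.v2]; exact hP.ν2)
    (by simpa [ha₁ 16] using hI₂) ?_ ?_
  · intro r τ₂ hr hir hf₂ hI
    rw [hP₁.v2] at hr
    have hP₂ : HasParams E l b p K m τ₂ := hP₁.of_eq (fun x hx =>
      hf₂.v x (by simp [Cmd.regs, Cmd.block, answer, searchBlock, scan]; omega))
    have ha₂ : ∀ x, x ≠ 16 → τ₂.a x = τ₁.a x := fun x hx =>
      hf₂.a x (by simpa [Cmd.arrs, Cmd.block, answer, searchBlock, scan] using hx)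
    have y12 : τ₂.v 12 = c := by rw [hf₂.v 12 (by decide), fr₁ 12 (by omega), hic]
    have y13 : τ₂.v 13 = k₀ := by rw [hf₂.v 13 (by decide), w13]
    have hT₂ : Tables τ₂.a p m b K := hTτ.congr (fun x hx hx' => by
      rw [ha₂ x (by omega), ha₁ x (by omega)])
    have hu₂ : τ₂.a 1 = σ.a 1 := by
      rw [ha₂ 1 (by omega), ha₁ 1 (by omega), ha 1 (by omega) (by omega)]
    simp only [Machine.wp_block_cons, Machine.wp_assign, Expr.fits_reg, Expr.fits_add,
      Expr.fits_mul, Expr.evalNat_reg, Expr.evalNat_add, Expr.evalNat_mul, y12, hP₂.v2, hir,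
      Machine.wp_ite_lt, Expr.fits_const, Expr.evalNat_const, Store.set_v, Nat.reduceEqDiff,
      reduceIte, hP₂.v0, Machine.wp_skip, Machine.wp_block_nil]
    refine ⟨⟨⟨trivial, trivial, by omega⟩, trivial, by omega⟩, ⟨trivial, by omega, by omega⟩,
      ⟨trivial, trivial, by omega⟩, fun hD => ?_, fun hD D h1 h2 => ?_⟩
    · refine Machine.wp_conseq (answer_spec (c := c) (k₀ := k₀) (r := r) (D := c * b + r) hP
        (hP₂.of_eq (fun x hx => ?_)) hT₂ (by simpa [hu₂] using hu) (by simp [y12]) (by simp [y13])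
        (by simp [hir]) (by simp) hr rfl hD hk₀ ?_) ?_
      · simp [show x ≠ 15 by omega]
      · intro k hk j hj
        have := hτ₁ k hk j hj
        simp only [Store.set_a] at this ⊢
        rw [ha₂ 11 (by omega)]
        refine ⟨this.1, this.2.trans (Finset.sum_congr rfl (fun k' _ => ?_))⟩
        simp only [prefixTerm, ha₂ 5 (by omega), ha₂ 6 (by omega), ha₂ 7 (by omega),
          ha₂ 8 (by omega), ha₂ 9 (by omega), ha₂ 10 (by omega), ha₁ 5 (by omega),
          ha₁ 6 (by omega), ha₁ 7 (by omega), ha₁ 8 (by omega), ha₁ 9 (by omega), ha₁ 10 (by omega)]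
      · rintro τ₃ _ ⟨R, hR, hR'⟩ D h1 h2
        simp only [Store.set_a] at hR hR' ⊢
        rw [hu₂] at hR
        rw [hR']
        by_cases h : D = c * b + r
        · simp only [if_pos h]; rwa [h]
        · simp only [if_neg h]; exact hI D (by omega) h2
    · exact hI D (by omega) h2
  · intro τ₂ _ hf₂ hI
    rw [hP₁.v2] at hI
    simp only [Machine.wp_block_nil, Store.set_a]
    refine ⟨fun j hj => ?_, fun D h1 h2 => hI D ?_ h2⟩
    · rw [hf₂.a 11 (by simp [Cmd.arrs, Cmd.block, answer, searchBlock, scan])]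
      -- Row 0 holds an empty sum, reduced below the modulus, and is therefore zero again for the
      -- next `c`.
      have := hτ₁ 0 (by omega) j hj
      rw [zero_mul, zero_add, Finset.range_zero, Finset.sum_empty, ZMod.natCast_eq_zero_iff] at this
      exact Nat.eq_zero_of_dvd_of_lt this.2 this.1
    · have : (c + 1) * b = c * b + b := by ring
      omega

/-! ### The whole program -/

/-- The number of blocks. -/
def blockCount (n : ℕ) : ℕ := n / blockLength n + 1

/-- Upper bounds for the contents of the registers that bound loops. -/
def loopBound (n x : ℕ) : ℕ :=
  [n, Nat.size n, blockLength n, 4 * blockLength n, blockCount n, 0, 2 * blockLength n, 0,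
    blockCount n + 1, 2 * blockCount n, 19, 4 * blockLength n].getD x 0

/-! ### Estimates for the block length, the modulus and the word size -/

theorem blockLength_pos (n : ℕ) : 0 < blockLength n := Nat.succ_pos _

theorem sqrt_div_size_le (n : ℕ) : Nat.sqrt (n / Nat.size n) * Nat.sqrt (n / Nat.size n) ≤ n :=
  (Nat.sqrt_le _).trans (Nat.div_le_self _ _)

theorem blockLength_le (n : ℕ) : blockLength n ≤ n + 1 :=
  Nat.succ_le_succ ((Nat.sqrt_le_self _).trans (Nat.div_le_self _ _))

theorem sq_blockLength_le (n : ℕ) : blockLength n * blockLength n ≤ 3 * n + 1 := by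
  have h1 := sqrt_div_size_le n
  have h2 : Nat.sqrt (n / Nat.size n) ≤ n := (Nat.sqrt_le_self _).trans (Nat.div_le_self _ _)
  have h3 : blockLength n * blockLength n = Nat.sqrt (n / Nat.size n) * Nat.sqrt (n / Nat.size n) +
    2 * Nat.sqrt (n / Nat.size n) + 1 := by unfold blockLength; ring
  omega

theorem lt_sq_blockLength_mul_size {n : ℕ} (hn : 0 < n) :
    n < blockLength n * blockLength n * Nat.size n :=
  (Nat.div_lt_iff_lt_mul (Nat.size_pos.2 hn)).1 (Nat.lt_succ_sqrt _)

theorem lt_blockCount_mul (n : ℕ) : n < blockCount n * blockLength n := by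
  rw [blockCount, mul_comm]
  exact Nat.lt_mul_div_succ n (blockLength_pos n)

theorem blockCount_mul_le (n : ℕ) : blockCount n * blockLength n ≤ n + blockLength n := by
  rw [blockCount, Nat.add_mul, one_mul]
  exact Nat.add_le_add_right (Nat.div_mul_le_self _ _) _

/-- With `Nat.size n = 1 + s` one has `2 ^ s ≤ n`, and `(1 + s) ^ 2 ≤ 8 * 2 ^ s`. -/
theorem sq_size_le {n : ℕ} (hn : 0 < n) : Nat.size n * Nat.size n ≤ 8 * n := by
  obtain ⟨s, hs⟩ := Nat.exists_eq_add_of_le (Nat.size_pos.2 hn : 1 ≤ Nat.size n)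
  have h1 : 2 ^ s ≤ n := Nat.lt_size.1 (by omega)
  have h2 : ∀ s : ℕ, (1 + s) * (1 + s) ≤ 8 * 2 ^ s := by
    intro s
    induction s with
    | zero => norm_num
    | succ s ih =>
      rcases Nat.lt_or_ge s 3 with h | h
      · interval_cases s <;> norm_num
      · rw [pow_succ]; nlinarith
  rw [hs]
  exact (h2 s).trans (Nat.mul_le_mul_left _ h1)

/-- Squaring `n < b ^ 2 * Nat.size n` and using `Nat.size n ^ 2 ≤ 8 * n` gives `n < 8 * b ^ 4`, so a
fixed power of `p` dominates `n`. -/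
theorem two_mul_lt_pow_four {n p : ℕ} (hp : 2 * blockLength n < p) : 2 * n < p ^ 4 := by
  set b := blockLength n with hb
  rcases Nat.eq_zero_or_pos n with hn | hn
  · have : 0 < p ^ 4 := Nat.pow_pos (by omega)
    omega
  have h1 := lt_sq_blockLength_mul_size hn
  have h2 := sq_size_le hn
  rw [← hb] at h1
  have h3 : n * n < b * b * (b * b) * (8 * n) := by
    calc n * n < (b * b * Nat.size n) * (b * b * Nat.size n) := Nat.mul_lt_mul'' h1 h1
      _ = b * b * (b * b) * (Nat.size n * Nat.size n) := by ring
      _ ≤ _ := Nat.mul_le_mul_left _ h2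
  have h4 : n < 8 * (b * b * (b * b)) := by
    refine Nat.lt_of_mul_lt_mul_right (a := n) ?_
    calc n * n < b * b * (b * b) * (8 * n) := h3
      _ = _ := by ring
  calc 2 * n ≤ (2 * b) ^ 4 := by rw [show (2 * b) ^ 4 = 16 * (b * b * (b * b)) by ring]; omega
    _ < p ^ 4 := Nat.pow_lt_pow_left hp (by norm_num)

theorem pow_modulus_le {n p : ℕ} (hp : p ≤ 4 * blockLength n) : p ^ 20 ≤ (n + 2) ^ 60 := by
  have h1 : p ≤ (n + 2) ^ 3 := by
    calc p ≤ 4 * (n + 1) := hp.trans (Nat.mul_le_mul_left _ (blockLength_le n))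
      _ ≤ (n + 2) ^ 2 * (n + 2) := Nat.mul_le_mul
        (Nat.pow_le_pow_left (show 2 ≤ n + 2 by omega) 2) (by omega)
      _ = _ := by ring
  calc p ^ 20 ≤ ((n + 2) ^ 3) ^ 20 := Nat.pow_le_pow_left h1 _
    _ = _ := by rw [← pow_mul]

theorem linear_lt {n W : ℕ} (hW : (n + 2) ^ 130 ≤ W) : 2000 * (n + 1) < W := by
  calc 2000 * (n + 1) < 2 ^ 11 * (n + 2) := by omega
    _ ≤ (n + 2) ^ 11 * (n + 2) := Nat.mul_le_mul_right _ (Nat.pow_le_pow_left (by omega) _)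
    _ = (n + 2) ^ 12 := by ring
    _ ≤ (n + 2) ^ 130 := Nat.pow_le_pow_right (by omega) (by norm_num)
    _ ≤ W := hW

/-- Products of two residues must fit into a word. Since `p ≤ (n + 2) ^ 3`, the square of `p ^ 20`
is at most `(n + 2) ^ 120`, which leaves room below `(n + 2) ^ 130`. -/
theorem square_modulus_lt {n p W : ℕ} (hp : p ≤ 4 * blockLength n) (h0 : 0 < p)
    (hW : (n + 2) ^ 130 ≤ W) : p ^ 20 * p ^ 20 + 3 * p ^ 20 < W := by
  have h1 : 0 < p ^ 20 := Nat.pow_pos h0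
  have h2 := pow_modulus_le hp
  calc p ^ 20 * p ^ 20 + 3 * p ^ 20 ≤ 2 ^ 2 * (p ^ 20 * p ^ 20) := by nlinarith
    _ ≤ (n + 2) ^ 2 * ((n + 2) ^ 60 * (n + 2) ^ 60) := Nat.mul_le_mul
        (Nat.pow_le_pow_left (by omega) _) (Nat.mul_le_mul h2 h2)
    _ = (n + 2) ^ 122 := by rw [← pow_add, ← pow_add]
    _ < (n + 2) ^ 130 := Nat.pow_lt_pow_right (by omega) (by norm_num)
    _ ≤ W := hW

/-- The tables need at most `4 * (n + b) + 8 * b + 16 * b ^ 2` entries, and `b ^ 2 ≤ 3 * n + 1`;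
arrays of length `64 * n + 64` are thus long enough. -/
theorem params_of_prime {p : ℕ} (hB : E.B = 64 * E.n + 64) (hν : E.ν = loopBound E.n)
    (hW : (E.n + 2) ^ 130 ≤ E.W) (hp : p.Prime) (h1 : 2 * blockLength E.n < p)
    (h2 : p ≤ 4 * blockLength E.n) :
    Params E (Nat.size E.n) (blockLength E.n) p (blockCount E.n) 19 := by
  have b0 := blockLength_pos E.n
  have b1 := blockLength_le E.n
  have b2 := sq_blockLength_le E.n
  have k1 := lt_blockCount_mul E.n
  have k2 := blockCount_mul_le E.n
  have h4 := two_mul_lt_pow_four h1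
  have hl := linear_lt hW
  have h5 : p ^ 20 = p ^ 4 * (p ^ 4) ^ 4 := by ring
  have h6 : E.n ^ 4 < (p ^ 4) ^ 4 := Nat.pow_lt_pow_left (by omega) (by norm_num)
  constructor
  · exact hp
  · exact b0
  · exact h1
  · exact k1
  · calc blockCount E.n ≤ E.n + 1 := Nat.succ_le_succ (Nat.div_le_self _ _)
      _ ≤ _ := Nat.lt_size_self _
  -- Here the exponent 20 is fixed: a factor `p ^ 4` dominates the length `K * b`, which is at most
  -- `2 * n + 1`, and `p ^ 16` exceeds `n ^ 4`, the bound for one mismatch.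
  · rw [h5]
    exact Nat.mul_lt_mul_of_le_of_lt (by omega) h6 (by omega)
  · rw [h5]
    exact (show E.n ≤ p ^ 4 by omega).trans (Nat.le_mul_of_pos_right _ (by omega))
  · rw [hB]
    have e1 : (blockCount E.n + 2) * p ≤ (blockCount E.n + 2) * (4 * blockLength E.n) :=
      Nat.mul_le_mul_left _ h2
    have e2 : p * p ≤ 4 * blockLength E.n * (4 * blockLength E.n) := Nat.mul_le_mul h2 h2
    have e3 : (blockCount E.n + 2) * (4 * blockLength E.n) =
      4 * (blockCount E.n * blockLength E.n) + 8 * blockLength E.n := by ring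
    have e4 : 4 * blockLength E.n * (4 * blockLength E.n) =
      16 * (blockLength E.n * blockLength E.n) := by ring
    omega
  · omega
  · omega
  · exact square_modulus_lt h2 (by omega) hW
  all_goals simp [hν, loopBound, h2]

/-- Compute the parameters. -/
def setup : Cmd :=
  .block [computeSize, computeBlock, .assign 4 (reg 0 / reg 2 + const 1), .assign 6 (reg 2 + reg 2),
    .assign 11 (reg 6 + reg 6), .assign 8 (reg 4 + const 1), .assign 9 (reg 4 + reg 4),
    .assign 10 (const 19), findPrime, .assign 21 (reg 3 * reg 3), .assign 21 (reg 21 * reg 21),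
    .assign 21 (reg 21 * reg 3), .assign 21 (reg 21 * reg 21), .assign 5 (reg 21 * reg 21)]

theorem setup_spec {σ : Store} (hB : E.B = 64 * E.n + 64) (hν : E.ν = loopBound E.n)
    (hW : (E.n + 2) ^ 130 ≤ E.W) (h0 : σ.v 0 = E.n) :
    E.wp setup (fun τ => ∃ p, Params E (Nat.size E.n) (blockLength E.n) p (blockCount E.n) 19 ∧
      HasParams E (Nat.size E.n) (blockLength E.n) p (blockCount E.n) 19 τ) σ := by
  have b0 := blockLength_pos E.n
  have b1 := blockLength_le E.n
  have k0 : blockCount E.n ≤ E.n + 1 := Nat.succ_le_succ (Nat.div_le_self _ _)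
  have hl := linear_lt hW
  rw [setup, Machine.wp_block_cons]
  refine Machine.wp_conseq (computeSize_spec h0 (by simp [hν, loopBound]) (by omega)) ?_
  intro τ₁ hf₁ hτ₁
  have x0 : τ₁.v 0 = E.n := by rw [hf₁.v 0 (by decide), h0]
  rw [Machine.wp_block_cons]
  refine Machine.wp_conseq (computeBlock_spec x0 hτ₁ (by simp [hν, loopBound])
    ((Nat.pow_lt_pow_right (by omega) (by norm_num)).trans_le hW)) ?_
  intro τ₂ hf₂ hτ₂
  have y0 : τ₂.v 0 = E.n := by rw [hf₂.v 0 (by decide), x0]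
  have y1 : τ₂.v 1 = Nat.size E.n := by rw [hf₂.v 1 (by decide), hτ₁]
  simp only [Machine.wp_block_cons, Machine.wp_assign, Expr.fits_reg, Expr.fits_add, Expr.fits_div,
    Expr.fits_const, Expr.evalNat_reg, Expr.evalNat_add, Expr.evalNat_const, Expr.evalNat_div,
    Store.set_v, Nat.reduceEqDiff, reduceIte, y0, hτ₂]
  have hc : E.n / blockLength E.n + 1 = blockCount E.n := rfl
  rw [hc]
  refine ⟨⟨⟨trivial, trivial, trivial⟩, by omega, by omega⟩, ⟨trivial, trivial, by omega⟩,
    ⟨trivial, trivial, by omega⟩, ⟨trivial, by omega, by omega⟩, ⟨trivial, trivial, by omega⟩,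
    by omega, Machine.wp_conseq (findPrime_spec (c := 2 * blockLength E.n) (by omega)
      (by simp [two_mul]) (by simp; omega) (by simp [hν, loopBound])
      (by simp [hν, loopBound]; omega) (by omega)) ?_⟩
  rintro τ₃ hf₃ ⟨hp, hp1, hp2⟩
  set p := τ₃.v 3 with hp'
  have hP := params_of_prime hB hν hW hp hp1 (by omega)
  have hpw : ∀ i < 40, p ^ i < E.W := by
    intro i hi
    calc p ^ i ≤ p ^ 40 := Nat.pow_le_pow_right hp.pos (by omega)
      _ = p ^ 20 * p ^ 20 := by rw [← pow_add]
      _ < E.W := (Nat.le_add_right _ _).trans_lt hP.square_lt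
  have hsq : p * p = p ^ 2 := by ring
  have h4 : p ^ 2 * p ^ 2 = p ^ 4 := by ring
  have h5 : p ^ 4 * p = p ^ 5 := by ring
  have h10 : p ^ 5 * p ^ 5 = p ^ 10 := by ring
  have h20 : p ^ 10 * p ^ 10 = p ^ 20 := by ring
  -- The modulus is reached along the exponents 2, 4, 5, 10, 20.
  simp only [Machine.wp_block_cons, Machine.wp_block_nil, Machine.wp_assign, Expr.fits_reg,
    Expr.fits_mul, Expr.evalNat_reg, Expr.evalNat_mul, Store.set_v, Nat.reduceEqDiff, reduceIte,
    ← hp', hsq, h4, h5, h10, h20]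
  refine ⟨⟨trivial, trivial, hpw 2 (by omega)⟩, ⟨trivial, trivial, hpw 4 (by omega)⟩,
    ⟨trivial, trivial, hpw 5 (by omega)⟩, ⟨trivial, trivial, hpw 10 (by omega)⟩,
    ⟨trivial, trivial, hpw 20 (by omega)⟩, p, hP, ?_⟩
  constructor
  · simp [hf₃.v 0 (by decide), y0]
  · simp [hf₃.v 1 (by decide), y1]
  · simp [hf₃.v 2 (by decide), hτ₂]
  · simp [← hp']
  · simp [hf₃.v 4 (by decide)]
  · simp
  · simp [hf₃.v 6 (by decide), two_mul]
  · simp [hf₃.v 8 (by decide)]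
  · simp [hf₃.v 9 (by decide), two_mul]
  · simp [hf₃.v 10 (by decide)]

/-- The whole program. -/
def main : Cmd :=
  .block [copyInput, setup, rankLetters, powerTable, transform 5 2 1, transform 8 6 0, allRadii]

theorem main_spec {σ : Store} (hB : E.B = 64 * E.n + 64) (hν : E.ν = loopBound E.n)
    (hW : (E.n + 2) ^ 130 ≤ E.W) (h0 : σ.v 0 = E.n) (ha : ∀ x < 16, ∀ i, σ.a x i = 0) :
    E.wp main (fun τ => ∃ id : ℕ → ℕ, (∀ x < E.n, id x = 0 ↔ σ.a 16 x = 0) ∧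
      (∀ x < E.n, ∀ y < E.n, σ.a 16 x = σ.a 16 y ↔ id x = id y) ∧
      ∀ D, D + 1 < E.n + E.n → IsRadius (fun i => id (i - blockLength E.n)) (blockLength E.n) E.n D
        (τ.a 16 D)) σ := by
  have b0 := blockLength_pos E.n
  have b1 := blockLength_le E.n
  have k0 : blockCount E.n ≤ E.n + 1 := Nat.succ_le_succ (Nat.div_le_self _ _)
  have k2 := blockCount_mul_le E.n
  have hl := linear_lt hW
  rw [main, Machine.wp_block_cons]
  refine Machine.wp_conseq (copyInput_spec h0 (by simp [hν, loopBound]) (by omega)) ?_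
  rintro τ₁ hf₁ ⟨c1, c2⟩
  rw [Machine.wp_block_cons]
  refine Machine.wp_conseq (setup_spec hB hν hW (by rw [hf₁.v 0 (by decide), h0])) ?_
  rintro τ₂ hf₂ ⟨p, hP, hσ₂⟩
  have hbp := hP.b_lt
  have htab := hP.tables_le
  have hsq := hP.square_lt
  have hM : 1 < p ^ (19 + 1) := Nat.one_lt_pow (by omega) hP.prime.one_lt
  have hpM : p ≤ p ^ (19 + 1) := Nat.le_self_pow (by omega) p
  have hKp : (blockCount E.n + 2) * p = (blockCount E.n + 1) * p + p := by ring
  have ar₂ : ∀ x, x ≠ 0 → τ₂.a x = σ.a x := fun x hx => by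
    rw [hf₂.a x (by simp [setup, computeSize, computeBlock, findPrime, Cmd.arrs, Cmd.block]),
      hf₁.a x (by simpa [copyInput, Cmd.arrs, Cmd.block] using hx)]
  have ar0 : τ₂.a 0 = τ₁.a 0 := hf₂.a 0 (by decide)
  have hn : ∀ i, E.n ≤ i → τ₂.a 0 i = 0 := fun i hi => by
    rw [ar0, c2 i hi, ha 0 (by omega)]
  rw [Machine.wp_block_cons]
  refine Machine.wp_conseq (rankLetters_spec hσ₂.v0 hσ₂.v2 hσ₂.v4 b0 hP.lt_blocks hP.ν0 hP.ν2 hP.ν4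
    (by omega) (by omega) (by omega) hn (fun i => by rw [ar₂ 1 (by omega), ha 1 (by omega)])) ?_
  rintro τ₃ hf₃ ⟨id, i1, i2, i3, i4, i5⟩
  have hσ₃ : HasParams E _ _ _ _ _ τ₃ := hσ₂.of_eq (fun x hx =>
    hf₃.v x (by simp [rankLetters, rescan, argmin, assignRank, Cmd.regs, Cmd.block]; omega))
  have hle : ∀ x, τ₃.a 1 x ≤ E.n := fun x => by
    rw [i1]; split_ifs
    · omega
    · exact i3 _
  rw [Machine.wp_block_cons]
  refine Machine.wp_conseq (powerTable_spec hσ₃.v3 hσ₃.v5 hσ₃.v10 hM hpM hP.ν3 hP.ν10 (by omega)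
    (by omega) (by omega)) ?_
  intro τ₄ hf₄ hτ₄
  have hσ₄ : HasParams E _ _ _ _ _ τ₄ := hσ₃.of_eq (fun x hx =>
    hf₄.v x (by simp [powerTable, Cmd.regs, Cmd.block]; omega))
  have a4 : τ₄.a 1 = τ₃.a 1 := hf₄.a 1 (by decide)
  have hT : ∀ j < p, ∀ i < p, τ₄.a 4 (j * p + i) < p ^ (19 + 1) := fun j hj i hi => by
    rw [hτ₄ j hj i hi]; exact Nat.mod_lt _ (by omega)
  rw [Machine.wp_block_cons]
  refine Machine.wp_conseq (transform_spec (by omega) (by omega) (by omega) hσ₄.v2 hσ₄.v3 hσ₄.v5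
    hσ₄.v8 hσ₄.v2 (by omega) hM (by rwa [a4]) hP.n_le hT hP.ν3 hP.ν8 hP.ν2 (by omega) (by omega)
    (by simp only [Nat.add_mul]; omega) (by omega) (by omega) (by omega) (by omega)) ?_
  intro τ₅ hf₅ hτ₅
  have hσ₅ : HasParams E _ _ _ _ _ τ₅ := hσ₄.of_eq (fun x hx =>
    hf₅.v x (by simp [transform, Cmd.regs, Cmd.block]; omega))
  have a5 : ∀ x, x ≠ 5 → x ≠ 6 → x ≠ 7 → τ₅.a x = τ₄.a x := fun x h5 h6 h7 =>
    hf₅.a x (by simp [transform, Cmd.arrs, Cmd.block, h5, h6, h7])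
  have a51 := a5 1 (by omega) (by omega) (by omega)
  have a54 := a5 4 (by omega) (by omega) (by omega)
  rw [Machine.wp_block_cons]
  refine Machine.wp_conseq (transform_spec (by omega) (by omega) (by omega) hσ₅.v2 hσ₅.v3 hσ₅.v5
    hσ₅.v8 hσ₅.v6 (by omega) hM (by rwa [a51, a4]) hP.n_le (by rwa [a54]) hP.ν3 hP.ν8 hP.ν6
    (by omega) (by omega) (by simp only [Nat.add_mul]; omega) (by omega) (by omega) (by omega)
    (by omega)) ?_
  intro τ₆ hf₆ hτ₆
  have hσ₆ : HasParams E _ _ _ _ _ τ₆ := hσ₅.of_eq (fun x hx =>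
    hf₆.v x (by simp [transform, Cmd.regs, Cmd.block]; omega))
  have a6 : ∀ x, x ≠ 8 → x ≠ 9 → x ≠ 10 → τ₆.a x = τ₅.a x := fun x h5 h6 h7 =>
    hf₆.a x (by simp [transform, Cmd.arrs, Cmd.block, h5, h6, h7])
  have a61 := a6 1 (by omega) (by omega) (by omega)
  have a64 := a6 4 (by omega) (by omega) (by omega)
  have hT₆ : Tables τ₆.a p 19 (blockLength E.n) (blockCount E.n) := by
    refine ⟨?_, fun k hk j hj e he => ?_, fun k hk j hj e he => ?_⟩
    · rw [a64, a54]; exact hτ₄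
    · rw [a6 (5 + e) (by omega) (by omega) (by omega), a61, a64, a51, a54, hτ₅ k hk j hj e he]
    · rw [a61, a64]
      have := hτ₆ k hk j hj e he
      rwa [Nat.add_zero k] at this
  have a11 : τ₆.a 11 = σ.a 11 := by
    rw [a6 11 (by omega) (by omega) (by omega), a5 11 (by omega) (by omega) (by omega),
      hf₄.a 11 (by decide), hf₃.a 11 (by decide), ar₂ 11 (by omega)]
  rw [Machine.wp_block_cons]
  refine Machine.wp_conseq (allRadii_spec hP hσ₆ hT₆ (by rwa [a61, a51, a4])
    (fun j _ => by rw [a11, ha 11 (by omega)])) ?_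
  intro τ₇ _ hτ₇
  rw [Machine.wp_block_nil]
  refine ⟨id, fun x hx => ?_, fun x hx y hy => ?_, fun D hD => ?_⟩
  · rw [i4 x hx, ar0, c1 x hx]
  · rw [← i5 x hx y hy, ar0, c1 x hx, c1 y hy]
  · have hR := hτ₇ D hD
    rw [a61, a51, a4] at hR
    -- For positions from 0 to `D` both indices are at least `b`, so the padding of array 1 in front
    -- of the string is not consulted.
    have key : ∀ x, D / 2 + 1 ≤ x → x ≤ D → (Reflects (τ₃.a 1) (blockLength E.n) D x ↔
        Reflects (fun i => id (i - blockLength E.n)) (blockLength E.n) D x) := by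
      intro x _ hx
      simp only [Reflects, i1]
      rw [if_neg (by omega), if_neg (by omega)]
    obtain ⟨r1, r2, r3, r4⟩ := hR
    refine ⟨r1, r2, fun x hx hx' => (key x hx (by omega)).1 (r3 x hx hx'), ?_⟩
    rcases r4 with h | h | h
    · exact Or.inl h
    · exact Or.inr (Or.inl h)
    · by_cases h' : D / 2 + 1 + τ₇.a 16 D = D + 1
      · exact Or.inr (Or.inl h')
      · exact Or.inr (Or.inr fun hh => h ((key _ (by omega) (by omega)).2 hh))

theorem wf_main : main.Wf := by decide

end WordRAM

namespace Wildcard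

/-! ### Radii of maximal subpalindromes -/

theorem CharMatch.symm {A : Type*} {a b : Option A} (h : CharMatch a b) : CharMatch b a := by
  rcases h with h | h | h
  · exact Or.inr (Or.inl h)
  · exact Or.inl h
  · exact Or.inr (Or.inr h.symm)

/-- The characters at the positions `x` and `y`, counted from `0`, match. -/
def MatchAt {A : Type*} (S : List (Option A)) (x y : ℕ) : Prop :=
  CharMatch (S[x]?.getD none) (S[y]?.getD none)

theorem isPalindrome_iff {A : Type*} {S : List (Option A)} :
    IsPalindrome S ↔ ∀ x < S.length, MatchAt S x (S.length - 1 - x) := by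
  simp only [IsPalindrome, Matches, List.forall₂_iff_get, List.length_reverse, true_and,
    List.get_eq_getElem, List.getElem_reverse, MatchAt]
  constructor
  · intro h x hx
    have := h x hx hx
    rwa [List.getElem?_eq_getElem hx, List.getElem?_eq_getElem (by omega)]
  · intro h x hx _
    have := h x hx
    rwa [List.getElem?_eq_getElem hx, List.getElem?_eq_getElem (by omega)] at this

/-- Positions from 1 become positions from 0 here, so reflected positions of the factor add up to `i
+ j - 2`. -/
theorem isPalindrome_factor_iff {A : Type*} {S : List (Option A)} {i j : ℕ} (hi : 1 ≤ i)
    (hj : j ≤ S.length) : IsPalindrome (factor S i j) ↔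
      ∀ x, i - 1 ≤ x → x < j → MatchAt S x (i + j - 2 - x) := by
  have hl : (factor S i j).length = j + 1 - i := by
    simp only [factor, List.length_take, List.length_drop]; omega
  have hg : ∀ x < j + 1 - i, (factor S i j)[x]? = S[i - 1 + x]? := by
    intro x hx
    rw [factor, List.getElem?_take_of_lt hx, List.getElem?_drop]
  rw [isPalindrome_iff, hl]
  constructor
  · intro h x hx hx'
    have := h (x - (i - 1)) (by omega)
    rw [MatchAt, hg _ (by omega), hg _ (by omega)] at this
    rw [MatchAt]
    convert this using 4 <;> omega
  · intro h x hx
    have := h (i - 1 + x) (by omega) (by omega)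
    rw [MatchAt, hg _ (by omega), hg _ (by omega)]
    rw [MatchAt] at this
    convert this using 4; omega

/-- The radius at the center `(D + 2) / 2` is the number of positions after the center up to which
the characters match their reflections. -/
theorem isMaximalRadius_of_reflections {A : Type*} {S : List (Option A)} {D R : ℕ}
    (h1 : D / 2 + 1 + R ≤ S.length) (h2 : D / 2 + 1 + R ≤ D + 1)
    (h3 : ∀ x, D / 2 + 1 ≤ x → x < D / 2 + 1 + R → MatchAt S x (D - x))
    (h4 : D / 2 + 1 + R = S.length ∨ D / 2 + 1 + R = D + 1 ∨
      (D / 2 + 1 + R < S.length ∧ D / 2 + 1 + R ≤ D ∧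
        ¬ MatchAt S (D / 2 + 1 + R) (D - (D / 2 + 1 + R)))) :
    IsMaximalRadius S (D + 2) R := by
  -- The right end is the last of the `R` matching positions after the center, increased by one as
  -- positions start from 1; the left end makes the sum `D + 2`.
  refine ⟨D + 1 - D / 2 - R, D / 2 + 1 + R, by omega, ⟨⟨by omega, by omega, h1, ?_⟩, ?_⟩, ?_⟩
  · rw [isPalindrome_factor_iff (by omega) h1]
    intro x hx hx'
    rw [show D + 1 - D / 2 - R + (D / 2 + 1 + R) - 2 - x = D - x by omega]
    by_cases hxD : D / 2 + 1 ≤ x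
    · exact h3 x hxD hx'
    -- Positions before the center follow by symmetry, and the center itself matches itself.
    · by_cases he : D - x = x
      · rw [he]; exact Or.inr (Or.inr rfl)
      · have := h3 (D - x) (by omega) (by omega)
        rw [show D - (D - x) = x by omega] at this
        exact CharMatch.symm this
  -- The three alternatives: the right end of the string is reached, or the left end, or the next
  -- pair does not match.
  · rintro ⟨g1, g2, g3, g4⟩
    rcases h4 with h | h | ⟨h, h', h''⟩
    · omega
    · omega
    · rw [isPalindrome_factor_iff g1 g3] at g4
      have := g4 (D / 2 + 1 + R) (by omega) (by omega)
      apply h''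
      convert this using 1; omega
  -- The difference `j - i` is `2 * R` or `2 * R - 1`, according to the parity of `D`.
  · rw [radius, eq_comm, Int.ceil_eq_iff]
    have e : ((D + 1 - D / 2 - R : ℕ) : ℚ) = (D : ℚ) + 1 - (D / 2 : ℕ) - R := by
      rw [Nat.cast_sub (by omega), Nat.cast_sub (by omega)]; push_cast; ring
    rw [e]
    push_cast
    have e1 : (2 * (D / 2) : ℕ) ≤ D := by omega
    have e2 : D ≤ (2 * (D / 2) + 1 : ℕ) := by omega
    have e1' : (2 : ℚ) * (D / 2 : ℕ) ≤ D := by exact_mod_cast e1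
    have e2' : (D : ℚ) ≤ 2 * (D / 2 : ℕ) + 1 := by exact_mod_cast e2
    constructor <;> linarith

end Wildcard

namespace WordRAM

/-! ### Correctness and complexity -/

/-- The machine for inputs of length `n` with words of `w` bits. -/
def machine (n w : ℕ) (h : (n + 2) ^ 130 ≤ 2 ^ w) : Machine where
  n := n
  w := w
  B := 64 * n + 64
  ν := loopBound n
  one_lt := lt_of_le_of_lt (by omega) (linear_lt h)
  le_word := lt_of_le_of_lt (by omega) (linear_lt h)

/-- The initial store on the input `S`. -/
def inputStore (S : List (Option ℕ)) : Store where
  v x := if x = 0 then S.length else 0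
  a x i := if x = 16 then (S[i]?.map charCode).getD 0 else 0

/-- No code is truncated because it fits into a word, and the arrays 0 to 15 start out zero because
they lie beyond the input. -/
theorem rel_inputStore {n w : ℕ} {S : List (Option ℕ)} (hn : S.length = n)
    (h : (n + 2) ^ 130 ≤ 2 ^ w) (hS : ∀ c ∈ S, charCode c < 2 ^ w) :
    (machine n w h).Rel (inputState w S) (inputStore S) := by
  have hl := linear_lt h
  refine ⟨fun x => ?_, fun c i hv => ?_, ?_⟩
  · change (if x = 0 then BitVec.ofNat w S.length else 0 : BitVec w).toNat = if x = 0 then S.length else 0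
    split_ifs
    · rw [BitVec.toNat_ofNat]; exact Nat.mod_eq_of_lt (by omega)
    · simp
  · change (BitVec.ofNat w ((S[addr n c i]?.map charCode).getD 0)).toNat =
      if c = 16 then (S[i]?.map charCode).getD 0 else 0
    have hpos : 0 < 2 ^ w := by omega
    rcases hv with ⟨hc, _⟩ | ⟨hc, _⟩
    · rw [if_neg (by omega), addr, if_neg (by omega), List.getElem?_eq_none (by omega)]
      simp
    · rw [if_pos hc, addr, if_pos hc, BitVec.toNat_ofNat]
      refine Nat.mod_eq_of_lt ?_
      by_cases hi : i < S.length
      · rw [List.getElem?_eq_getElem hi]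
        exact hS _ (List.getElem_mem hi)
      · rw [List.getElem?_eq_none (by omega)]
        exact hpos
  · simp [inputStore, hn, machine]

theorem charCode_injective : Function.Injective charCode := by
  rintro (_ | a) (_ | b) h <;> simp_all [charCode]

theorem charCode_eq_zero_iff {c : Option ℕ} : charCode c = 0 ↔ c = none := by
  cases c <;> simp [charCode]

theorem matchAt_iff_rankMatch {S : List (Option ℕ)} {id : ℕ → ℕ}
    (h1 : ∀ x < S.length, id x = 0 ↔ (inputStore S).a 16 x = 0)
    (h2 : ∀ x < S.length, ∀ y < S.length,
      (inputStore S).a 16 x = (inputStore S).a 16 y ↔ id x = id y) {x y : ℕ}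
    (hx : x < S.length) (hy : y < S.length) :
    RankMatch (id x) (id y) ↔ Wildcard.MatchAt S x y := by
  rw [RankMatch, h1 x hx, h1 y hy, ← h2 x hx y hy]
  simp only [inputStore, reduceIte, List.getElem?_eq_getElem hx, List.getElem?_eq_getElem hy,
    Option.map_some, Option.getD_some, charCode_eq_zero_iff, charCode_injective.eq_iff,
    Wildcard.MatchAt, Wildcard.CharMatch]

theorem isMaximalRadius_of_isRadius {S : List (Option ℕ)} {id : ℕ → ℕ} {b D R : ℕ}
    (h1 : ∀ x < S.length, id x = 0 ↔ (inputStore S).a 16 x = 0)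
    (h2 : ∀ x < S.length, ∀ y < S.length,
      (inputStore S).a 16 x = (inputStore S).a 16 y ↔ id x = id y)
    (hR : IsRadius (fun i => id (i - b)) b S.length D R) :
    Wildcard.IsMaximalRadius S (D + 2) R := by
  obtain ⟨r1, r2, r3, r4⟩ := hR
  have key : ∀ x, D / 2 + 1 ≤ x → x ≤ D → x < S.length →
      (Reflects (fun i => id (i - b)) b D x ↔ Wildcard.MatchAt S x (D - x)) := by
    intro x hx hx' hxS
    rw [← matchAt_iff_rankMatch h1 h2 hxS (by omega), Reflects, Nat.add_sub_cancel,
      show D + b - x - b = D - x by omega]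
  refine Wildcard.isMaximalRadius_of_reflections r1 r2 (fun x hx hx' => ?_) ?_
  · exact (key x hx (by omega) (by omega)).1 (r3 x hx hx')
  · by_cases g1 : D / 2 + 1 + R = S.length
    · exact Or.inl g1
    by_cases g2 : D / 2 + 1 + R = D + 1
    · exact Or.inr (Or.inl g2)
    rcases r4 with h | h | h
    · exact absurd h g1
    · exact absurd h g2
    · refine Or.inr (Or.inr ⟨by omega, by omega, ?_⟩)
      rwa [← key _ (by omega) (by omega) (by omega)]

/-- The running time. -/
def runningTime (n : ℕ) : ℕ := main.time (loopBound n)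

/-- The number of memory cells. -/
def memorySize (n : ℕ) : ℕ := 2 * n + 16 * (64 * n + 64)

theorem computesMaximalRadii : ComputesMaximalRadii main.toProg 130 runningTime memorySize := by
  intro w n S hn hw hS
  have hl : memorySize n = 2 * n + 16 * (64 * n + 64) := rfl
  refine ⟨by omega, by omega, ?_⟩
  have hspec := main_spec (E := machine n w hw) (σ := inputStore S) rfl rfl hw
    (by simp [inputStore, hn, machine]) (fun x hx i => by simp [inputStore, hx.ne])
  obtain ⟨t, s, τ, h1, h2, h3, id, i1, i2, i3⟩ :=
    Machine.exec_of_wp main wf_main (rel_inputStore hn hw hS) hspec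
  refine ⟨t, s, h1, h2, fun d hd hd' => ?_⟩
  obtain ⟨D, rfl⟩ := Nat.exists_eq_add_of_le' hd
  subst hn
  have hR := i3 D (by change D + 1 < S.length + S.length; omega)
  have hmem : τ.a 16 D = (s.mem D).toNat :=
    (h3.a 16 D (Or.inr ⟨rfl, by change D < 2 * S.length; omega⟩)).symm
  rw [hmem] at hR
  exact isMaximalRadius_of_isRadius i1 i2 hR

/-! ### Asymptotic bounds for time and space -/

theorem Expr.cost_sub (a b : Expr) : (a - b).cost = a.cost + b.cost + 1 := rfl

theorem Expr.cost_div (a b : Expr) : (a / b).cost = a.cost + b.cost + 1 := rfl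

/-- The syntactic time bound is a polynomial in `n`, `l`, `b` and `K`; 10000 is a generous bound for
its coefficients. -/
theorem time_main {n l b K : ℕ} {ν : ℕ → ℕ} (h0 : ν 0 = n) (h1 : ν 1 = l) (h2 : ν 2 = b)
    (h3 : ν 3 = 4 * b) (h4 : ν 4 = K) (h6 : ν 6 = 2 * b) (h8 : ν 8 = K + 1) (h9 : ν 9 = 2 * K)
    (h10 : ν 10 = 19) (h11 : ν 11 = 4 * b) :
    main.time ν ≤ 10000 * (1 + n + n * b + n * K + b + b * K + b * K * l + b * K ^ 2 + b ^ 2 +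
      b ^ 2 * K + b ^ 2 * K * l + K + K ^ 2) := by
  simp only [Cmd.time, main, copyInput, setup, computeSize, computeBlock, findPrime, rankLetters,
    rescan, argmin, assignRank, powerTable, transform, allRadii, prefixSums, storePrefix, answer,
    searchBlock, scan, Cmd.block, Expr.cost, Expr.cost_sub, Expr.cost_div, h0, h1, h2, h3, h4, h6, h8, h9, h10, h11]
  ring_nf
  omega

/-- Every monomial is at most a small multiple of `n * (b * l)`, because `b * K ≤ 3 * n` and both
`b` and `K` are at most `b * l`. -/
theorem runningTime_le {n : ℕ} (hn : 0 < n) :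
    runningTime n ≤ 400000 * (n * (blockLength n * Nat.size n)) := by
  have h := time_main (ν := loopBound n) (n := n) (l := Nat.size n) (b := blockLength n)
    (K := blockCount n) rfl rfl rfl rfl rfl rfl rfl rfl rfl rfl
  have b0 := blockLength_pos n
  have b1 := blockLength_le n
  have b2 := sq_blockLength_le n
  have k1 := blockCount_mul_le n
  have l0 := Nat.size_pos.2 hn
  -- The choice of `b` balances the two main costs: `n < b ^ 2 * Nat.size n` gives `n / b < b *
  -- Nat.size n`.
  have hK : blockCount n ≤ blockLength n * Nat.size n := by
    refine Nat.succ_le_of_lt ((Nat.div_lt_iff_lt_mul b0).2 ?_)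
    calc n < _ := lt_sq_blockLength_mul_size hn
      _ = _ := by ring
  unfold runningTime
  generalize blockLength n = b at *
  generalize blockCount n = K at *
  generalize Nat.size n = l at *
  have hbl : b ≤ b * l := Nat.le_mul_of_pos_right _ l0
  have hnT : n ≤ n * (b * l) := Nat.le_mul_of_pos_right _ (by positivity)
  have hKb : b * K ≤ 3 * n := by rw [mul_comm]; omega
  have m1 : n * b ≤ n * (b * l) := Nat.mul_le_mul_left _ hbl
  have m2 : n * K ≤ n * (b * l) := Nat.mul_le_mul_left _ hK
  have m3 : b * K * l ≤ 3 * (n * (b * l)) := by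
    calc b * K * l ≤ 3 * n * l := Nat.mul_le_mul_right _ hKb
      _ = 3 * (n * l) := by ring
      _ ≤ _ := Nat.mul_le_mul_left _ (Nat.mul_le_mul_left _ (Nat.le_mul_of_pos_left _ b0))
  have m4 : b * K ^ 2 ≤ 3 * (n * (b * l)) := by
    calc b * K ^ 2 = b * K * K := by ring
      _ ≤ 3 * n * (b * l) := Nat.mul_le_mul hKb hK
      _ = _ := by ring
  have m5 : b ^ 2 * K ≤ 3 * (n * (b * l)) := by
    calc b ^ 2 * K = b * K * b := by ring
      _ ≤ 3 * n * (b * l) := Nat.mul_le_mul hKb hbl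
      _ = _ := by ring
  have m6 : b ^ 2 * K * l ≤ 3 * (n * (b * l)) := by
    calc b ^ 2 * K * l = b * K * (b * l) := by ring
      _ ≤ 3 * n * (b * l) := Nat.mul_le_mul_right _ hKb
      _ = _ := by ring
  have m7 : K ^ 2 ≤ b * K ^ 2 := Nat.le_mul_of_pos_left _ b0
  have m8 : K ≤ b * K := Nat.le_mul_of_pos_left _ b0
  rw [← sq] at b2
  omega

/-- With `b = s + 1` and `l = Nat.size n`, use `(s + 1) ^ 2 ≤ 2 * s ^ 2 + 2`, `s ^ 2 * l ≤ n` and `l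
≤ n`. -/
theorem sq_blockLength_mul_size_le {n : ℕ} :
    (blockLength n * Nat.size n) ^ 2 ≤ 4 * (n * Nat.size n) := by
  rcases Nat.eq_zero_or_pos n with rfl | hn
  · simp
  have h1 : Nat.sqrt (n / Nat.size n) * Nat.sqrt (n / Nat.size n) * Nat.size n ≤ n :=
    (Nat.mul_le_mul_right _ (Nat.sqrt_le _)).trans (Nat.div_mul_le_self _ _)
  have h2 := size_le_self n
  unfold blockLength
  generalize Nat.sqrt (n / Nat.size n) = s at *
  generalize Nat.size n = l at *
  have h3 : (s * s * l) * l ≤ n * l := Nat.mul_le_mul_right _ h1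
  have h4 : l * l ≤ n * l := Nat.mul_le_mul_right _ h2
  have h5 : ((s + 1) * l) ^ 2 ≤ 2 * ((s * s * l) * l) + 2 * (l * l) := by
    have : 2 * s * l ^ 2 ≤ (s * s + 1) * l ^ 2 := Nat.mul_le_mul_right _ (by
      zify; nlinarith [sq_nonneg ((s : ℤ) - 1)])
    nlinarith
  omega

/-- If `Nat.size n = 1 + s`, then `s ≥ 1`, so the size is at most `2 * s`, and `s * log 2 ≤ log n`.
-/
theorem size_le_log {n : ℕ} (hn : 2 ≤ n) : (Nat.size n : ℝ) ≤ 4 * Real.log n := by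
  have h1 : 1 < Nat.size n := Nat.lt_size.2 (by simpa using hn)
  obtain ⟨s, hs⟩ := Nat.exists_eq_add_of_le h1.le
  have h2 : 2 ^ s ≤ n := Nat.lt_size.1 (by omega)
  have h3 : (s : ℝ) * Real.log 2 ≤ Real.log n := by
    rw [← Real.log_pow]
    exact Real.log_le_log (by positivity) (by exact_mod_cast h2)
  have h4 : (1 : ℝ) ≤ s := by exact_mod_cast (show 1 ≤ s by omega)
  have h5 := Real.log_two_gt_d9
  rw [hs]
  push_cast
  nlinarith

theorem runningTime_isBigO : Asymptotics.IsBigO Filter.atTop (fun n : ℕ => (runningTime n : ℝ))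
    (fun n : ℕ => (n : ℝ) * Real.sqrt ((n : ℝ) * Real.log (n : ℝ))) := by
  refine Asymptotics.IsBigO.of_bound 1600000 ?_
  filter_upwards [Filter.eventually_ge_atTop 2] with n hn
  have h1 : (runningTime n : ℝ) ≤ 400000 * (n * (blockLength n * Nat.size n : ℕ)) := by
    exact_mod_cast runningTime_le (by omega)
  have h2 : ((blockLength n * Nat.size n : ℕ) : ℝ) ≤ 4 * Real.sqrt (n * Real.log n) := by
    have h3 : ((blockLength n * Nat.size n : ℕ) : ℝ) ^ 2 ≤ 4 * (n * Nat.size n) := by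
      exact_mod_cast sq_blockLength_mul_size_le
    have h4 : (n : ℝ) * Nat.size n ≤ n * (4 * Real.log n) :=
      mul_le_mul_of_nonneg_left (size_le_log hn) (Nat.cast_nonneg _)
    have h5 : (4 : ℝ) * Real.sqrt (n * Real.log n) = Real.sqrt (4 ^ 2 * (n * Real.log n)) := by
      rw [Real.sqrt_mul (by norm_num : (0 : ℝ) ≤ 4 ^ 2), Real.sqrt_sq (by norm_num : (0 : ℝ) ≤ 4)]
    rw [h5]
    exact Real.le_sqrt_of_sq_le (by linarith)
  rw [Real.norm_of_nonneg (Nat.cast_nonneg _), Real.norm_of_nonneg (by positivity)]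
  calc (runningTime n : ℝ) ≤ 400000 * (n * (blockLength n * Nat.size n : ℕ)) := h1
    _ ≤ 400000 * (n * (4 * Real.sqrt (n * Real.log n))) := by gcongr
    _ = _ := by ring

theorem memorySize_isBigO : Asymptotics.IsBigO Filter.atTop (fun n : ℕ => (memorySize n : ℝ))
    (fun n : ℕ => (n : ℝ)) := by
  -- The memory has `1026 * n + 1024` cells.
  refine Asymptotics.IsBigO.of_bound 2050 ?_
  filter_upwards [Filter.eventually_ge_atTop 1] with n hn
  rw [Real.norm_of_nonneg (Nat.cast_nonneg _), Real.norm_of_nonneg (Nat.cast_nonneg _)]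
  have : memorySize n ≤ 2050 * n := by unfold memorySize; omega
  exact_mod_cast this

end WordRAM

/-- The radii of all maximal subpalindromes of a wildcard string of length `n` can be found in
`O(n √(n log n))` time and `O(n)` space: a single word RAM program does so, for words of a
sufficiently large constant multiple of `log n` bits or more. -/
theorem mainTheorem1 :
    ∃ (p : WordRAM.Prog) (k : ℕ) (time space : ℕ → ℕ),
      WordRAM.ComputesMaximalRadii p k time space ∧
      Asymptotics.IsBigO Filter.atTop (fun n : ℕ => (time n : ℝ))
        (fun n : ℕ => (n : ℝ) * Real.sqrt ((n : ℝ) * Real.log (n : ℝ))) ∧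
      Asymptotics.IsBigO Filter.atTop (fun n : ℕ => (space n : ℝ)) (fun n : ℕ => (n : ℝ)) := by
  exact ⟨WordRAM.main.toProg, 130, WordRAM.runningTime, WordRAM.memorySize,
    WordRAM.computesMaximalRadii, WordRAM.runningTime_isBigO, WordRAM.memorySize_isBigO⟩
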